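/- Let $d\ge 1$. For real-valued $f\in L^2(\mathbb R^d)$ let $\hat f(\xi)=(2\pi)^{-d/2}\int_{\mathbb R^d} f(x)e^{-ix\cdot\xi}\,dx$ (extended to $L^2$ by Plancherel) and $\|f\|_s=\int_{\mathbb R^d}|\xi|^s|\hat f(\xi)|\,d\xi\in[0,\infty]$. Let $\dot{\mathcal F}^{0,2}$ be the space of real-valued $f$ with $\int|\hat f(\xi)|^2\,d\xi<\infty$, i.e. $L^2(\mathbb R^d)$. Put $$f_2(y)=\sum_{j\ge1}\frac{(j+1)^3}{j!}\,y^j=(y^3+6y^2+7y+1)e^y-1 ,$$ where the equality of the series and the closed form holds for all real $y$. There is exactly one $y_*>0$ with $f_2(y_*)=1$, and $\frac{52}{500}<y_*<\frac{105}{1000}$. A (global, weak) solution of $h_t=\Delta e^{-\Delta h}$ in $\mathbb R^d$ with initial value $h_0\in\dot{\mathcal F}^{0,2}$ is a function $h\in C^0([0,\infty);\dot{\mathcal F}^{0,2})$ with $h(0)=h_0$ such that $\|h(t)\|_2$ is bounded on every bounded interval of times $t\ge 0$ and such that, with $\Delta h(t)$ the weak Laplacian, for all $\varphi\in C_c^\infty(\mathbb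 R^d)$ and all $t\ge0$ $$\int_{\mathbb R^d} h(t)\varphi\,dx-\int_{\mathbb R^d} h_0\varphi\,dx=\int_0^t\int_{\mathbb R^d} e^{-\Delta h(s,x)}\Delta\varphi(x)\,dx\,ds ,$$ the inner integral being an integrable function of $s\in(0,t)$. **Theorem.** Let $h_0\in\dot{\mathcal F}^{0,2}$ satisfy $\|h_0\|_2<y_*$, and let $\sigma_{2,1}=1-f_2(\|h_0\|_2)$. Then $\sigma_{2,1}>0$, there is a unique solution $h\in C^0([0,\infty);\dot{\mathcal F}^{0,2})$ of $h_t=\Delta e^{-\Delta h}$ with $h(0)=h_0$, and for all $t\ge0$ $$\|h(t)\|_2+\sigma_{2,1}\int_0^t\|h(\tau)\|_6\,d\tau\le\|h_0\|_2 .$$ -/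

import Mathlib

open MeasureTheory Set
open scoped FourierTransform ENNReal ContDiff

noncomputable section

namespace ExpPDE

/-- The space `ℝ^d` with the Euclidean norm. -/
abbrev Space (d : ℕ) : Type := EuclideanSpace ℝ (Fin d)

/-- Real-valued square integrable functions on `ℝ^d`; by Plancherel this is the space
`𝓕̇^{0,2}` of functions with `∫ |f̂(ξ)|² dξ < ∞`. -/
abbrev L2 (d : ℕ) : Type := Lp ℝ 2 (volume : Measure (Space d))

/-- The Fourier transform `f̂(ξ) = (2π)^{-d/2} ∫ f(x) e^{-i x·ξ} dx` of `f ∈ L²(ℝ^d)`.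
Mathlib's `𝓕` (on `L²`: the Plancherel extension) uses `e^{-2π i x·ξ}` and no prefactor, whence
the scaling. -/
def fhat {d : ℕ} (f : L2 d) (ξ : Space d) : ℂ :=
  (((2 * Real.pi) ^ (-(d : ℝ) / 2) : ℝ) : ℂ) *
    ((𝓕 (Complex.ofRealCLM.compLp f : Lp ℂ 2 (volume : Measure (Space d))) :
      Lp ℂ 2 (volume : Measure (Space d))) : Space d → ℂ) ((2 * Real.pi)⁻¹ • ξ)

/-- The `s`-norm `‖f‖_s = ∫ |ξ|^s |f̂(ξ)| dξ`, with values in `[0, ∞]`. -/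
def sNorm {d : ℕ} (s : ℝ) (f : L2 d) : ℝ≥0∞ :=
  ∫⁻ ξ : Space d, ‖ξ‖ₑ ^ s * ‖fhat f ξ‖ₑ

/-- `φ ∈ C_c^∞(ℝ^d)`. -/
def IsTest {d : ℕ} (φ : Space d → ℝ) : Prop :=
  ContDiff ℝ ∞ φ ∧ HasCompactSupport φ

/-- `v ∈ L¹_loc` is the weak (distributional) Laplacian of `u`. -/
def HasWeakLaplacian {d : ℕ} (u v : Space d → ℝ) : Prop :=
  LocallyIntegrable v ∧
    ∀ φ : Space d → ℝ, IsTest φ → ∫ x, u x * Laplacian.laplacian φ x = ∫ x, v x * φ x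

/-- `h` is a global in time (weak) solution of `h_t = Δ e^{-Δh}` on `ℝ^d` with initial value `h₀`:
`h ∈ C⁰([0,∞); 𝓕̇^{0,2})` with `h(0) = h₀`, the norm `‖h(t)‖_2` is bounded on bounded time
intervals (so that `Δh(t)` is a bounded function), and, with `w(t) = Δh(t)`, for every test
function `φ` the pairing `⟨h(t), φ⟩` has the integrable time derivative `⟨e^{-Δh(t)}, Δφ⟩`. Values
of `h` at negative times are irrelevant. -/
structure IsSolution {d : ℕ} (h₀ : L2 d) (h : ℝ → L2 d) : Prop where
  continuousOn : ContinuousOn h (Ici 0)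
  initial : h 0 = h₀
  bounded : ∀ T : ℝ, ∃ M : ℝ≥0∞, M ≠ ⊤ ∧ ∀ t ∈ Icc 0 T, sNorm 2 (h t) ≤ M
  equation : ∃ w : ℝ → Space d → ℝ,
    (∀ t, 0 ≤ t → HasWeakLaplacian (h t) (w t)) ∧
    ∀ φ : Space d → ℝ, IsTest φ → ∀ t, 0 ≤ t →
      IntervalIntegrable
        (fun s => ∫ x, Real.exp (-(w s x)) * Laplacian.laplacian φ x) volume 0 t ∧
      (∫ x, h t x * φ x) - ∫ x, h₀ x * φ x =
        ∫ s in (0 : ℝ)..t, ∫ x, Real.exp (-(w s x)) * Laplacian.laplacian φ x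

/-- `f₂(y) = (y³ + 6y² + 7y + 1) e^y - 1`. -/
def f2 (y : ℝ) : ℝ :=
  (y ^ 3 + 6 * y ^ 2 + 7 * y + 1) * Real.exp y - 1

/-- `σ_{2,1} = 1 - f₂(‖h₀‖_2)`. -/
def sigma21 {d : ℕ} (h₀ : L2 d) : ℝ :=
  1 - f2 (sNorm 2 h₀).toReal

end ExpPDE

end

/-!
The equation is `h_t = Δ e^{-w}` with `w = Δh`. Linearised at `0` it reads `ĥ_t = -|ξ|⁴ ĥ`, and it
is the gradient flow of a convex functional: `⟨e^{-w} - e^{-w'}, w - w'⟩ ≤ 0`. The first fact gives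
the decay of `‖h‖₂`, the second one gives contraction in `L²`, convergence of approximations and
uniqueness.

**Existence.** The flow is truncated to frequencies `|ξ| ≤ N`, and the exponential is clipped
outside `[-1, 1]`. This gives an ordinary differential equation with Lipschitz right-hand side in
`L²`, `u_t = Δ P_N (e^{-w} - 1)` with `w = Δ P_N u` (`galerkin`). The clipping is never active, because
`|w| ≤ ‖u‖₂` stays below `y_* < 1`. Indeed the power series of `e^{-w} - 1 + w` becomes a series of
convolution powers of `|ŵ|`, and `|ξ₀ + ⋯ + ξ_j|⁴ ≤ (j+1)³ ∑ |ξ_i|⁴` bounds its fourth moment by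
`f₂(‖u‖₂) ‖u‖₆` (`lintegral_norm_pow_four_mul_expMajorant_le`); hence
`d/dt ‖u‖₂ ≤ -(1 - f₂(‖u‖₂)) ‖u‖₆` (`bandMoment_galerkin_add_le`). The difference of two
truncations is controlled in `L²` by monotonicity and by the frequencies above `N`, which an `Ḣ¹`
energy estimate makes small (`norm_sq_galerkin_sub_le`); as the truncated flow does not expand `L²`
distances, this gives uniform convergence for all data (`exists_tendstoUniformlyOn_galerkin`). The
decay estimate is inherited by the limit through moments on bounded bands of frequencies
(`moment_add_le_of_limit`). The bound for the time integral of `‖u‖₆` keeps high frequencies small,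
so that the second moments converge in `L¹` in time and the equation passes to the limit
(`tendsto_lintegral_moment_sub`, `equation_of_limit`).

All estimates are proved for the moments `∫ (2π|ξ|)^k |𝓕u|` of Mathlib's Fourier transform. These
differ from `‖u‖_k` by the factor `(2π)^{d/2} ≥ 1` (`sNorm_eq`), so they satisfy the same smallness
condition, and the decay estimate is linear in them.

**Uniqueness.** Let `g` be the difference of two solutions. Formally
`d/dt ‖g‖² = 2 ∫ (e^{-w} - e^{-w'}) Δg ≤ 0`, but `Δg` is only known to be bounded, not square
integrable, and `g_t` is only a distribution. Therefore `g²` is integrated against a weight `η⁴` of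
compact support, with `η = 1` on the ball of radius `R`. The equation may be tested with `η⁴ g(σ)`
for a fixed time `σ` (`integral_sub_mul_eq`), and Riemann sums lead to the diagonal `σ = τ`
(`diag_sub_le`). There, strict monotonicity of the exponential absorbs the terms with derivatives of
the weight up to `O(R⁻⁴) ‖g‖²` (`integral_mul_laplacian_weight_le`). With `R → ∞` it follows that
`g = 0` (`IsSolution.eq`).
-/

open MeasureTheory Set
open scoped FourierTransform ENNReal ContDiff

noncomputable section

namespace ExpPDE

open Filter Topology
open scoped SchwartzMap

variable {d : ℕ}

/-! ### Fourier analysis of real square integrable functions -/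

/-- Complex-valued square integrable functions on `ℝ^d`. -/
abbrev L2C (d : ℕ) : Type := Lp ℂ 2 (volume : Measure (Space d))

/-- The inverse Fourier integral may be moved from one factor to the other. -/
theorem integral_fourierInv_mul_eq_of_integrable {f g : Space d → ℂ} (hf : Integrable f)
    (hg : Integrable g) : ∫ x, 𝓕⁻ f x * g x = ∫ x, f x * 𝓕⁻ g x := by
  have hc : Continuous fun p : Space d × Space d => (-(innerₗ (Space d))) p.1 p.2 := by
    have : Continuous fun p : Space d × Space d => -(inner ℝ p.1 p.2) := continuous_inner.neg
    exact this
  have h := VectorFourier.integral_fourierIntegral_smul_eq_flip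
    (μ := (volume : Measure (Space d))) (ν := (volume : Measure (Space d)))
    (L := -(innerₗ (Space d))) (f := f) (g := g) Real.continuous_fourierChar hc hf hg
  simp only [smul_eq_mul] at h
  have e1 : ∀ f : Space d → ℂ, ∀ x, VectorFourier.fourierIntegral Real.fourierChar volume
      (-(innerₗ (Space d))) f x = 𝓕⁻ f x := by
    intro f x
    simp [VectorFourier.fourierIntegral, Real.fourierInv_eq]
  have e2 : ∀ f : Space d → ℂ, ∀ x, VectorFourier.fourierIntegral Real.fourierChar volume
      (-(innerₗ (Space d))).flip f x = 𝓕⁻ f x := by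
    intro f x
    simp [VectorFourier.fourierIntegral, Real.fourierInv_eq, real_inner_comm]
  simpa only [e1, e2] using h

theorem integral_mul_schwartz_eq_toTemperedDistribution (u : L2C d) (φ : 𝓢(Space d, ℂ)) :
    ∫ x, u x * φ x = (Lp.toTemperedDistribution u) φ := by
  rw [Lp.toTemperedDistribution_apply]
  simp [mul_comm]

theorem integral_fourier_mul_schwartz (u : L2C d) (φ : 𝓢(Space d, ℂ)) :
    ∫ x, (𝓕 u : L2C d) x * φ x = ∫ x, u x * 𝓕 φ x := by
  rw [integral_mul_schwartz_eq_toTemperedDistribution,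
    integral_mul_schwartz_eq_toTemperedDistribution, ← Lp.fourier_toTemperedDistribution_eq,
    TemperedDistribution.fourier_apply]

theorem integral_fourierInv_mul_schwartz (u : L2C d) (φ : 𝓢(Space d, ℂ)) :
    ∫ x, (𝓕⁻ u : L2C d) x * φ x = ∫ x, u x * 𝓕⁻ φ x := by
  rw [integral_mul_schwartz_eq_toTemperedDistribution,
    integral_mul_schwartz_eq_toTemperedDistribution, ← Lp.fourierInv_toTemperedDistribution_eq,
    TemperedDistribution.fourierInv_apply]

/-- Locally integrable functions are determined by their integrals against Schwartz functions. -/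
theorem ae_eq_of_integral_mul_schwartz_eq {f g : Space d → ℂ} (hf : LocallyIntegrable f)
    (hg : LocallyIntegrable g) (h : ∀ φ : 𝓢(Space d, ℂ), (∀ x, starRingEnd ℂ (φ x) = φ x) →
      ∫ x, f x * φ x = ∫ x, g x * φ x) :
    f =ᵐ[volume] g := by
  apply ae_eq_of_integral_contDiff_smul_eq hf hg
  intro φ hφ hc
  have hc' : HasCompactSupport (fun x => (φ x : ℂ)) :=
    hc.comp_left (g := fun r : ℝ => (r : ℂ)) Complex.ofReal_zero
  have hs : ContDiff ℝ ∞ (fun x => (φ x : ℂ)) := Complex.ofRealCLM.contDiff.comp hφ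
  have := h (hc'.toSchwartzMap hs) (fun x => by simp)
  simpa [mul_comm] using this

theorem L2C.locallyIntegrable (u : L2C d) : LocallyIntegrable (u : Space d → ℂ) :=
  (Lp.memLp u).locallyIntegrable (by norm_num)

/-- If an `L²` function is the inverse Fourier integral of an integrable `F`, then its Fourier
transform is `F`. -/
theorem fourier_ae_eq_of_eq_fourierInv {u : L2C d} {F : Space d → ℂ} (hF : Integrable F)
    (h : u =ᵐ[volume] 𝓕⁻ F) : (𝓕 u : L2C d) =ᵐ[volume] F := by
  apply ae_eq_of_integral_mul_schwartz_eq (L2C.locallyIntegrable _) hF.locallyIntegrable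
  intro φ _
  rw [integral_fourier_mul_schwartz]
  calc ∫ x, u x * 𝓕 φ x = ∫ x, 𝓕⁻ F x * 𝓕 φ x := by
        apply integral_congr_ae
        filter_upwards [h] with x hx
        rw [hx]
    _ = ∫ x, F x * 𝓕⁻ (𝓕 φ : 𝓢(Space d, ℂ)) x := by
        rw [integral_fourierInv_mul_eq_of_integrable hF (SchwartzMap.integrable _),
          SchwartzMap.fourierInv_coe]
    _ = ∫ x, F x * φ x := by simp

/-- On `L¹ ∩ L²` the inverse Fourier transform is given by the integral. -/
theorem fourierInv_ae_eq_of_integrable {U : L2C d} (hU : Integrable (U : Space d → ℂ)) :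
    (𝓕⁻ U : L2C d) =ᵐ[volume] 𝓕⁻ (U : Space d → ℂ) := by
  have hcont : Continuous (𝓕⁻ (U : Space d → ℂ)) := by
    rw [Real.fourierInv_eq_fourier_comp_neg]
    exact VectorFourier.fourierIntegral_continuous Real.continuous_fourierChar
      (by simpa using continuous_inner) hU.comp_neg
  apply ae_eq_of_integral_mul_schwartz_eq (L2C.locallyIntegrable _) hcont.locallyIntegrable
  intro φ _
  rw [integral_fourierInv_mul_schwartz, integral_fourierInv_mul_eq_of_integrable hU
    (SchwartzMap.integrable _), SchwartzMap.fourierInv_coe]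

/-- The Fourier transform of a real-valued square integrable function, as a real-linear isometry
into `L²(ℝ^d; ℂ)`. -/
def FT : L2 d →ₗᵢ[ℝ] L2C d where
  toFun f := 𝓕 (Complex.ofRealCLM.compLp f : L2C d)
  map_add' f g := by
    rw [← FourierTransform.fourier_add]
    congr 1
    exact (Complex.ofRealCLM.compLpₗ 2 volume).map_add f g
  map_smul' c f := by
    have : (Complex.ofRealCLM.compLp (c • f) : L2C d) = (c : ℂ) • Complex.ofRealCLM.compLp f := by
      ext1
      filter_upwards [Complex.ofRealCLM.coeFn_compLp (c • f), Lp.coeFn_smul c f,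
        Lp.coeFn_smul (c : ℂ) (Complex.ofRealCLM.compLp f : L2C d),
        Complex.ofRealCLM.coeFn_compLp f] with x h1 h2 h3 h4
      rw [h1, h3, h2, Pi.smul_apply, Pi.smul_apply, h4]
      simp
    rw [this, FourierTransform.fourier_smul]
    rfl
  norm_map' f := by
    change ‖(𝓕 (Complex.ofRealCLM.compLp f : L2C d) : L2C d)‖ = ‖f‖
    rw [Lp.norm_fourier_eq]
    apply le_antisymm
    · simpa using Complex.ofRealCLM.norm_compLp_le f
    · apply Lp.norm_le_norm_of_ae_le
      filter_upwards [Complex.ofRealCLM.coeFn_compLp f] with x h1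
      simp [h1]

theorem FT_apply (f : L2 d) : FT f = 𝓕 (Complex.ofRealCLM.compLp f : L2C d) := rfl

theorem fourierInv_FT (f : L2 d) : (𝓕⁻ (FT f) : L2C d) = Complex.ofRealCLM.compLp f := by
  rw [FT_apply, FourierTransform.fourierInv_fourier_eq]

theorem fourierInv_FT_ae (f : L2 d) : (𝓕⁻ (FT f) : L2C d) =ᵐ[volume] fun x => (f x : ℂ) := by
  rw [fourierInv_FT]
  exact Complex.ofRealCLM.coeFn_compLp' f

/-- If a real `L²` function is the inverse Fourier integral of an integrable `F`, then its Fourier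
transform is `F`. -/
theorem FT_ae_eq_of_eq_fourierInv {u : L2 d} {F : Space d → ℂ} (hF : Integrable F)
    (h : (fun x => (u x : ℂ)) =ᵐ[volume] 𝓕⁻ F) : FT u =ᵐ[volume] F :=
  fourier_ae_eq_of_eq_fourierInv hF ((Complex.ofRealCLM.coeFn_compLp' u).trans h)

theorem ae_eq_fourierInv_FT {u : L2 d} (hu : Integrable (FT u : Space d → ℂ)) :
    (fun x => (u x : ℂ)) =ᵐ[volume] 𝓕⁻ (FT u : Space d → ℂ) :=
  (fourierInv_FT_ae u).symm.trans (fourierInv_ae_eq_of_integrable hu)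

theorem inner_eq_re_inner_FT (u v : L2 d) : inner ℝ u v = (inner ℂ (FT u) (FT v)).re := by
  have h : (inner ℝ (FT u) (FT v) : ℝ) = inner ℝ u v := FT.inner_map_map u v
  rw [← h, L2.inner_def, L2.inner_def]
  exact integral_re (𝕜 := ℂ) (L2.integrable_inner (FT u) (FT v))

theorem conj_fourier_real (φ : 𝓢(Space d, ℂ)) (h : ∀ x, starRingEnd ℂ (φ x) = φ x) (x : Space d) :
    starRingEnd ℂ ((𝓕 φ : 𝓢(Space d, ℂ)) x) = (𝓕⁻ φ : 𝓢(Space d, ℂ)) x := by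
  rw [SchwartzMap.fourier_coe, SchwartzMap.fourierInv_coe, Real.fourier_eq', Real.fourierInv_eq',
    ← integral_conj]
  congr 1
  ext y
  simp only [smul_eq_mul, map_mul, h, ← Complex.exp_conj, Complex.conj_ofReal, Complex.conj_I]
  congr 2
  push_cast
  ring

/-- Conjugation intertwines the Fourier transform and its inverse. -/
theorem fourier_star_eq {u v : L2C d} (h : v =ᵐ[volume] fun x => starRingEnd ℂ (u x)) :
    (𝓕 v : L2C d) =ᵐ[volume] fun x => starRingEnd ℂ ((𝓕⁻ u : L2C d) x) := by
  have hl : LocallyIntegrable (fun x => starRingEnd ℂ ((𝓕⁻ u : L2C d) x)) := by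
    apply MemLp.locallyIntegrable (p := 2) _ (by norm_num)
    exact (Lp.memLp (𝓕⁻ u : L2C d)).star
  apply ae_eq_of_integral_mul_schwartz_eq (L2C.locallyIntegrable _) hl
  intro φ hφ
  rw [integral_fourier_mul_schwartz]
  calc ∫ x, v x * (𝓕 φ : 𝓢(Space d, ℂ)) x
      = ∫ x, starRingEnd ℂ (u x * (𝓕⁻ φ : 𝓢(Space d, ℂ)) x) := by
        apply integral_congr_ae
        filter_upwards [h] with x hx
        rw [hx, map_mul, ← conj_fourier_real φ hφ, Complex.conj_conj]
    _ = ∫ x, starRingEnd ℂ ((𝓕⁻ u : L2C d) x) * φ x := by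
        rw [integral_conj, ← integral_fourierInv_mul_schwartz, ← integral_conj]
        simp [hφ]

/-- Reflection intertwines the Fourier transform and its inverse. -/
theorem fourier_comp_neg {U W : L2C d} (h : W =ᵐ[volume] fun x => U (-x)) :
    (𝓕 W : L2C d) = 𝓕⁻ U := by
  ext1
  apply ae_eq_of_integral_mul_schwartz_eq (L2C.locallyIntegrable _) (L2C.locallyIntegrable _)
  intro φ _
  rw [integral_fourier_mul_schwartz, integral_fourierInv_mul_schwartz]
  calc ∫ x, W x * (𝓕 φ : 𝓢(Space d, ℂ)) x
      = ∫ x, (fun y => U y * (𝓕⁻ φ : 𝓢(Space d, ℂ)) y) (-x) := by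
        apply integral_congr_ae
        filter_upwards [h] with x hx
        rw [hx]
        simp only [SchwartzMap.fourier_coe, SchwartzMap.fourierInv_coe,
          Real.fourierInv_eq_fourier_neg, neg_neg]
    _ = _ := integral_neg_eq_self (fun y => U y * (𝓕⁻ φ : 𝓢(Space d, ℂ)) y) volume

theorem ae_neg {p : Space d → Prop} (h : ∀ᵐ x, p x) : ∀ᵐ x : Space d, p (-x) :=
  (Measure.measurePreserving_neg (volume : Measure (Space d))).quasiMeasurePreserving.ae h

/-- The reflection `U(-·)` of a square integrable function. -/
theorem exists_reflection (U : L2C d) : ∃ W : L2C d, W =ᵐ[volume] fun x => U (-x) :=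
  ⟨Lp.compMeasurePreserving _ (Measure.measurePreserving_neg volume) U,
    Lp.coeFn_compMeasurePreserving _ _⟩

/-- The Fourier transform of a real function is Hermitian. -/
theorem FT_neg (u : L2 d) : ∀ᵐ ξ, FT u (-ξ) = starRingEnd ℂ (FT u ξ) := by
  obtain ⟨W, hW⟩ := exists_reflection (FT u)
  have h2 : (𝓕 W : L2C d) = Complex.ofRealCLM.compLp u := by
    rw [fourier_comp_neg hW, fourierInv_FT]
  have h3 : W = 𝓕⁻ (Complex.ofRealCLM.compLp u : L2C d) := by
    rw [← h2, FourierTransform.fourierInv_fourier_eq]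
  have h4 := fourier_star_eq (u := (Complex.ofRealCLM.compLp u : L2C d))
    (v := (Complex.ofRealCLM.compLp u : L2C d)) (by
      filter_upwards [Complex.ofRealCLM.coeFn_compLp u] with x hx
      simp [hx])
  filter_upwards [hW, h4] with ξ a b
  rw [← a, h3, FT_apply, b, Complex.conj_conj]

/-- A Hermitian square integrable function is the Fourier transform of a real function. -/
theorem exists_FT_eq {U : L2C d} (hU : ∀ᵐ ξ, U (-ξ) = starRingEnd ℂ (U ξ)) :
    (∀ᵐ x, ((𝓕⁻ U : L2C d) x).im = 0) ∧
    FT (Complex.reCLM.compLp (𝓕⁻ U : L2C d)) = U := by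
  obtain ⟨W, hW⟩ := exists_reflection U
  have h1 : (𝓕 W : L2C d) = 𝓕⁻ U := fourier_comp_neg hW
  have h2 := fourier_star_eq (u := U) (v := W) (by
    filter_upwards [hW, hU] with x a b
    rw [a, b])
  rw [h1] at h2
  have h3 : ∀ᵐ x, ((𝓕⁻ U : L2C d) x).im = 0 := by
    filter_upwards [h2] with x hx
    exact Complex.conj_eq_iff_im.1 hx.symm
  refine ⟨h3, ?_⟩
  have : (Complex.ofRealCLM.compLp (Complex.reCLM.compLp (𝓕⁻ U : L2C d)) : L2C d) = 𝓕⁻ U := by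
    ext1
    filter_upwards [h3, Complex.ofRealCLM.coeFn_compLp (Complex.reCLM.compLp (𝓕⁻ U : L2C d)),
      Complex.reCLM.coeFn_compLp (𝓕⁻ U : L2C d)] with x a b c
    rw [b, c]
    apply Complex.ext <;> simp [a]
  rw [FT_apply, this, FourierTransform.fourier_fourierInv_eq]

/-- Bounded measurable even real functions, the symbols of the Fourier multipliers acting on real
square integrable functions. -/
structure IsSymbol (m : Space d → ℝ) : Prop where
  measurable : Measurable m
  bounded : ∃ C : ℝ, ∀ ξ, |m ξ| ≤ C
  even : ∀ ξ, m (-ξ) = m ξ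

theorem IsSymbol.memLp {m : Space d → ℝ} (hm : IsSymbol m) (U : L2C d) :
    MemLp (fun ξ => (m ξ : ℂ) * U ξ) 2 := by
  obtain ⟨C, hC⟩ := hm.bounded
  refine (Lp.memLp U).of_le_mul (c := C) ?_ ?_
  · exact (Complex.measurable_ofReal.comp hm.measurable).aestronglyMeasurable.mul
      (Lp.aestronglyMeasurable U)
  · filter_upwards with ξ
    rw [norm_mul, Complex.norm_real]
    exact mul_le_mul_of_nonneg_right (hC ξ) (norm_nonneg _)

/-- Real even multipliers preserve real-valued functions. -/
theorem exists_FT_eq_mul {m : Space d → ℝ} (hm : IsSymbol m) (u : L2 d) :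
    FT (Complex.reCLM.compLp (𝓕⁻ ((hm.memLp (FT u)).toLp) : L2C d)) =
      (hm.memLp (FT u)).toLp :=
  (exists_FT_eq (U := (hm.memLp (FT u)).toLp) (by
    filter_upwards [(hm.memLp (FT u)).coeFn_toLp, ae_neg (hm.memLp (FT u)).coeFn_toLp, FT_neg u]
      with ξ a b c
    rw [a, b, c, hm.even]
    simp)).2

/-- The Fourier multiplier with symbol `m` on real square integrable functions. -/
def multiplier (m : Space d → ℝ) (hm : IsSymbol m) : L2 d →L[ℝ] L2 d :=
  LinearMap.mkContinuousOfExistsBound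
    { toFun := fun u => Complex.reCLM.compLp (𝓕⁻ ((hm.memLp (FT u)).toLp) : L2C d)
      map_add' := fun u v => by
        apply FT.injective
        refine (exists_FT_eq_mul hm _).trans (((FT.map_add _ _).trans ?_).symm)
        rw [exists_FT_eq_mul hm, exists_FT_eq_mul hm, ← MemLp.toLp_add]
        apply MemLp.toLp_congr
        rw [FT.map_add]
        filter_upwards [Lp.coeFn_add (FT u) (FT v)] with ξ h
        rw [Pi.add_apply, h, Pi.add_apply, mul_add]
      map_smul' := fun c u => by
        apply FT.injective
        refine (exists_FT_eq_mul hm _).trans (((FT.map_smul _ _).trans ?_).symm)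
        rw [RingHom.id_apply, exists_FT_eq_mul hm, ← MemLp.toLp_const_smul]
        apply MemLp.toLp_congr
        rw [FT.map_smul]
        filter_upwards [Lp.coeFn_smul c (FT u)] with ξ h
        rw [Pi.smul_apply, h, Pi.smul_apply, mul_smul_comm] } (by
    obtain ⟨C, hC⟩ := hm.bounded
    refine ⟨C, fun u => ?_⟩
    simp only [LinearMap.coe_mk, AddHom.coe_mk]
    rw [← FT.norm_map, exists_FT_eq_mul hm, ← FT.norm_map u]
    apply Lp.norm_le_mul_norm_of_ae_le_mul
    filter_upwards [(hm.memLp (FT u)).coeFn_toLp] with ξ h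
    rw [h, norm_mul, Complex.norm_real]
    exact mul_le_mul_of_nonneg_right (hC ξ) (norm_nonneg _))

theorem FT_multiplier (m : Space d → ℝ) (hm : IsSymbol m) (u : L2 d) :
    FT (multiplier m hm u) =ᵐ[volume] fun ξ => (m ξ : ℂ) * FT u ξ := by
  have h' : FT (multiplier m hm u) = (hm.memLp (FT u)).toLp := exists_FT_eq_mul hm u
  rw [h']
  exact (hm.memLp (FT u)).coeFn_toLp

theorem inner_multiplier_left (m : Space d → ℝ) (hm : IsSymbol m) (u v : L2 d) :
    inner ℝ (multiplier m hm u) v = inner ℝ u (multiplier m hm v) := by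
  rw [inner_eq_re_inner_FT, inner_eq_re_inner_FT, L2.inner_def, L2.inner_def]
  congr 1
  apply integral_congr_ae
  filter_upwards [FT_multiplier m hm u, FT_multiplier m hm v] with ξ a b
  rw [a, b]
  simp only [RCLike.inner_apply, map_mul, Complex.conj_ofReal]
  ring

theorem multiplier_multiplier (m m' m'' : Space d → ℝ) (hm : IsSymbol m) (hm' : IsSymbol m')
    (hm'' : IsSymbol m'') (h : ∀ ξ, m ξ * m' ξ = m'' ξ) (u : L2 d) :
    multiplier m hm (multiplier m' hm' u) = multiplier m'' hm'' u := by
  apply FT.injective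
  ext1
  filter_upwards [FT_multiplier m hm (multiplier m' hm' u), FT_multiplier m' hm' u,
    FT_multiplier m'' hm'' u] with ξ a b c
  rw [a, b, c, ← h]
  push_cast
  ring

/-! ### The function `f2` -/

theorem f2_eq (y : ℝ) : f2 y = (y ^ 3 + 6 * y ^ 2 + 7 * y + 1) * Real.exp y - 1 := rfl

/-- The power series of `f₂`. The polynomial identity
`(k+1)³ = k(k-1)(k-2) + 6k(k-1) + 7k + 1` reduces it to shifted exponential series. -/
theorem hasSum_f2 (y : ℝ) :
    HasSum (fun j : ℕ => ((j : ℝ) + 2) ^ 3 / (Nat.factorial (j + 1) : ℝ) * y ^ (j + 1)) (f2 y) := by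
  have he : HasSum (fun n : ℕ => y ^ n / (n.factorial : ℝ)) (Real.exp y) := by
    rw [Real.exp_eq_exp_ℝ]
    exact NormedSpace.expSeries_div_hasSum_exp y
  have shift : ∀ {g : ℕ → ℝ} {s : ℝ}, HasSum g s → HasSum (fun n => if n =
      0 then 0 else g (n - 1)) s := by
    intro g s h
    rw [← hasSum_nat_add_iff' 1]
    simpa using h
  have h1 : HasSum (fun n : ℕ => (n : ℝ) * (y ^ n / (n.factorial : ℝ))) (y * Real.exp y) := by
    rw [← hasSum_nat_add_iff' 1]
    simp only [Finset.range_one, Finset.sum_singleton, Nat.cast_zero, zero_mul, sub_zero]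
    convert! he.mul_left y using 2 with n
    rw [Nat.factorial_succ]
    push_cast
    field_simp
    ring
  have h2 : HasSum (fun n : ℕ => (n : ℝ) * (n - 1) * (y ^ n / (n.factorial : ℝ)))
      (y ^ 2 * Real.exp y) := by
    rw [← hasSum_nat_add_iff' 2]
    simp only [Finset.sum_range_succ, Finset.range_one, Finset.sum_singleton]
    norm_num
    convert! he.mul_left (y ^ 2) using 2 with n
    rw [Nat.factorial_succ, Nat.factorial_succ]
    push_cast
    have : (n.factorial : ℝ) ≠ 0 := by positivity
    field_simp
    ring
  have h3 : HasSum (fun n : ℕ => (n : ℝ) * (n - 1) * (n - 2) * (y ^ n / (n.factorial : ℝ)))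
      (y ^ 3 * Real.exp y) := by
    rw [← hasSum_nat_add_iff' 3]
    simp only [Finset.sum_range_succ, Finset.range_one, Finset.sum_singleton]
    norm_num
    convert! he.mul_left (y ^ 3) using 2 with n
    rw [Nat.factorial_succ, Nat.factorial_succ, Nat.factorial_succ]
    push_cast
    have : (n.factorial : ℝ) ≠ 0 := by positivity
    field_simp
    ring
  have h4 := ((h3.add (h2.mul_left 6)).add (h1.mul_left 7)).add he
  rw [← hasSum_nat_add_iff' 1] at h4
  convert! h4 using 1
  · ext n
    push_cast
    ring
  · rw [f2_eq]
    simp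
    ring

theorem f2_strictMonoOn : StrictMonoOn f2 (Ici 0) := by
  intro a ha b hb hab
  rw [f2_eq, f2_eq]
  have ha : 0 ≤ a := ha
  have hb : 0 ≤ b := hb
  have h1 : a ^ 3 + 6 * a ^ 2 + 7 * a + 1 < b ^ 3 + 6 * b ^ 2 + 7 * b + 1 := by
    have : a ^ 2 ≤ b ^ 2 := by gcongr
    have : a ^ 3 ≤ b ^ 3 := by gcongr
    linarith
  have h2 : Real.exp a ≤ Real.exp b := Real.exp_le_exp.2 hab.le
  have := mul_lt_mul h1 h2 (Real.exp_pos a) (by positivity)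
  linarith

theorem continuous_f2 : Continuous f2 := by
  unfold f2
  fun_prop

theorem f2_zero : f2 0 = 0 := by simp [f2]

theorem f2_lower : f2 (52 / 500) < 1 := by
  have h := Real.exp_bound' (x := 52 / 500) (by norm_num) (by norm_num) (n := 4) (by norm_num)
  norm_num [Finset.sum_range_succ, Nat.factorial] at h
  rw [f2_eq]
  norm_num
  linarith

theorem f2_upper : 1 < f2 (105 / 1000) := by
  have h := Real.sum_le_exp_of_nonneg (x := 105 / 1000) (by norm_num) 5
  norm_num [Finset.sum_range_succ, Nat.factorial] at h
  rw [f2_eq]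
  norm_num
  linarith

theorem exists_f2_eq_one : ∃ y, 52 / 500 < y ∧ y < 105 / 1000 ∧ f2 y = 1 := by
  obtain ⟨y, hy, h⟩ := intermediate_value_Ioo (by norm_num : (52 / 500 : ℝ) ≤ 105 / 1000)
    continuous_f2.continuousOn ⟨f2_lower, f2_upper⟩
  exact ⟨y, hy.1, hy.2, h⟩

/-! ### Convolution majorants -/

theorem lintegral_mul_lconvolution {P Q φ : Space d → ℝ≥0∞} (hP : Measurable P)
    (hQ : Measurable Q) (hφ : Measurable φ) :
    ∫⁻ ξ, φ ξ * (P ⋆ₗ Q) ξ = ∫⁻ η, ∫⁻ ζ, φ (η + ζ) * (P η * Q ζ) := by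
  simp only [lconvolution_def]
  calc ∫⁻ ξ, φ ξ * ∫⁻ y, P y * Q (-y + ξ) = ∫⁻ ξ, ∫⁻ y, φ ξ * (P y * Q (-y + ξ)) := by
        congr 1; ext ξ
        rw [lintegral_const_mul _ (by fun_prop)]
    _ = ∫⁻ y, ∫⁻ ξ, φ ξ * (P y * Q (-y + ξ)) := by
        rw [lintegral_lintegral_swap]
        exact Measurable.aemeasurable (by fun_prop)
    _ = _ := by
        congr 1; ext y
        rw [← lintegral_add_left_eq_self _ y]
        simp

theorem lintegral_lconvolution {P Q : Space d → ℝ≥0∞} (hP : Measurable P) (hQ : Measurable Q) :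
    ∫⁻ ξ, (P ⋆ₗ Q) ξ = (∫⁻ ξ, P ξ) * ∫⁻ ξ, Q ξ := by
  have h := lintegral_mul_lconvolution hP hQ (measurable_const (a := (1 : ℝ≥0∞)))
  simp only [one_mul] at h
  rw [h, ← lintegral_mul_const _ hP]
  congr 1; ext η
  rw [lintegral_const_mul _ hQ]

/-- Young's inequality `‖P ⋆ Q‖₂ ≤ ‖P‖₂ ‖Q‖₁`. -/
theorem lintegral_lconvolution_sq_le {P Q : Space d → ℝ≥0∞} (hP : Measurable P)
    (hQ : Measurable Q) :
    ∫⁻ ξ, (P ⋆ₗ Q) ξ ^ 2 ≤ (∫⁻ ξ, P ξ ^ 2) * (∫⁻ ξ, Q ξ) ^ 2 := by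
  have key : ∀ ξ, (P ⋆ₗ Q) ξ ^ 2 ≤ ((fun η => P η ^ 2) ⋆ₗ Q) ξ * ∫⁻ ζ, Q ζ := by
    intro ξ
    have hmono : ∫⁻ y, Q (-y + ξ) = ∫⁻ ζ, Q ζ := by
      have := lintegral_sub_left_eq_self (μ := (volume : Measure (Space d))) Q ξ
      rw [← this]
      congr 1; ext y
      congr 1; abel
    have hH := ENNReal.lintegral_mul_le_Lp_mul_Lq (volume : Measure (Space d))
      (Real.HolderConjugate.two_two)
      (f := fun y => P y * Q (-y + ξ) ^ (1 / 2 : ℝ)) (g := fun y => Q (-y + ξ) ^ (1 / 2 : ℝ))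
      (by fun_prop) (by fun_prop)
    have e0 : ∀ q : ℝ≥0∞, q ^ (1 / 2 : ℝ) * q ^ (1 / 2 : ℝ) = q := by
      intro q
      rw [← ENNReal.rpow_add_of_nonneg _ _ (by norm_num) (by norm_num)]
      norm_num
    have e1 : (∫⁻ y, ((fun y => P y * Q (-y + ξ) ^ (1 / 2 : ℝ)) * fun y => Q (-y +
        ξ) ^ (1 / 2 : ℝ)) y)
        = (P ⋆ₗ Q) ξ := by
      rw [lconvolution_def]
      congr 1; ext y
      simp only [Pi.mul_apply]
      rw [mul_assoc, e0]
    have e3 : ∀ q : ℝ≥0∞, (q ^ (1 / 2 : ℝ)) ^ (2 : ℝ) = q := by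
      intro q
      rw [← ENNReal.rpow_mul]; norm_num
    simp only [ENNReal.mul_rpow_of_nonneg _ _ (by norm_num : (0 : ℝ) ≤ 2), e3] at hH
    rw [e1] at hH
    calc (P ⋆ₗ Q) ξ ^ 2 = ((P ⋆ₗ Q) ξ) ^ (2 : ℝ) := by norm_cast
      _ ≤ _ := ENNReal.rpow_le_rpow hH (by norm_num)
      _ = _ := by
        rw [ENNReal.mul_rpow_of_nonneg _ _ (by norm_num), e3, e3, hmono, lconvolution_def]
        norm_cast
  calc ∫⁻ ξ, (P ⋆ₗ Q) ξ ^ 2 ≤ ∫⁻ ξ, ((fun η => P η ^ 2) ⋆ₗ Q) ξ * ∫⁻ ζ, Q ζ :=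
        lintegral_mono key
    _ = _ := by
        rw [lintegral_mul_const _ (measurable_lconvolution _ (by fun_prop) hQ),
          lintegral_lconvolution (by fun_prop) hQ]
        ring

/-- The convolution powers: `convPow P j` is the `(j+1)`-fold convolution of `P`. -/
def convPow (P : Space d → ℝ≥0∞) : ℕ → Space d → ℝ≥0∞
  | 0 => P
  | j + 1 => P ⋆ₗ convPow P j

theorem measurable_convPow {P : Space d → ℝ≥0∞} (hP : Measurable P) (j : ℕ) :
    Measurable (convPow P j) := by
  induction j with
  | zero => exact hP
  | succ j ih => exact measurable_lconvolution _ hP ih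

theorem lintegral_convPow {P : Space d → ℝ≥0∞} (hP : Measurable P) (j : ℕ) :
    ∫⁻ ξ, convPow P j ξ = (∫⁻ ξ, P ξ) ^ (j + 1) := by
  induction j with
  | zero => simp [convPow]
  | succ j ih =>
    rw [convPow, lintegral_lconvolution hP (measurable_convPow hP j), ih]
    ring

/-- Convexity of `x ↦ x⁴` with the weights `1 / (n + 1)` and `n / (n + 1)`, which are those of one
summand and of the mean of the other `n`. -/
theorem add_pow_four_le {a b n : ℝ} (ha : 0 ≤ a) (hb : 0 ≤ b) (hn : 0 < n) :
    (a + b) ^ 4 ≤ (n + 1) ^ 3 * a ^ 4 + ((n + 1) / n) ^ 3 * b ^ 4 := by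
  have h := (convexOn_pow (𝕜 := ℝ) 4).2 (show (n + 1) *
      a ∈ Ici 0 from by simp only [mem_Ici]; positivity)
    (show (n + 1) / n * b ∈ Ici 0 from by simp only [mem_Ici]; positivity)
    (show 0 ≤ 1 / (n + 1) by positivity) (show 0 ≤ n / (n + 1) by positivity) (by field_simp; ring)
  simp only [smul_eq_mul] at h
  have e1 : 1 / (n + 1) * ((n + 1) * a) + n / (n + 1) * ((n + 1) / n * b) = a + b := by
    field_simp
  have e2 : 1 / (n + 1) * ((n + 1) * a) ^ 4 + n / (n + 1) * ((n + 1) / n * b) ^ 4 =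
      (n + 1) ^ 3 * a ^ 4 + ((n + 1) / n) ^ 3 * b ^ 4 := by
    field_simp
  rwa [e1, e2] at h

theorem lintegral_norm_pow_four_mul_lconvolution_le {P Q : Space d → ℝ≥0∞} (hP : Measurable P)
    (hQ : Measurable Q) {n : ℝ} (hn : 0 < n) :
    ∫⁻ ξ, ‖ξ‖ₑ ^ 4 * (P ⋆ₗ Q) ξ ≤
      ENNReal.ofReal ((n + 1) ^ 3) * (∫⁻ ξ, ‖ξ‖ₑ ^ 4 * P ξ) * (∫⁻ ξ, Q ξ) +
        ENNReal.ofReal (((n + 1) / n) ^ 3) * (∫⁻ ξ, P ξ) * (∫⁻ ξ, ‖ξ‖ₑ ^ 4 * Q ξ) := by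
  rw [lintegral_mul_lconvolution hP hQ (by fun_prop)]
  have hpt : ∀ η ζ : Space d, ‖η + ζ‖ₑ ^ 4 ≤
      ENNReal.ofReal ((n + 1) ^ 3) * ‖η‖ₑ ^ 4 + ENNReal.ofReal (((n + 1) / n) ^ 3) * ‖ζ‖ₑ ^ 4 := by
    intro η ζ
    simp only [← ofReal_norm]
    rw [← ENNReal.ofReal_pow (norm_nonneg _), ← ENNReal.ofReal_pow (norm_nonneg _),
      ← ENNReal.ofReal_pow (norm_nonneg _), ← ENNReal.ofReal_mul (by positivity),
      ← ENNReal.ofReal_mul (by positivity), ← ENNReal.ofReal_add (by positivity) (by positivity)]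
    apply ENNReal.ofReal_le_ofReal
    exact (pow_le_pow_left₀ (norm_nonneg _) (norm_add_le η ζ) 4).trans
      (add_pow_four_le (norm_nonneg _) (norm_nonneg _) hn)
  calc ∫⁻ η, ∫⁻ ζ, ‖η + ζ‖ₑ ^ 4 * (P η * Q ζ)
      ≤ ∫⁻ η, ∫⁻ ζ, (ENNReal.ofReal ((n + 1) ^ 3) * (‖η‖ₑ ^ 4 * P η) * Q ζ +
          ENNReal.ofReal (((n + 1) / n) ^ 3) * P η * (‖ζ‖ₑ ^ 4 * Q ζ)) := by
        gcongr with η ζ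
        calc ‖η + ζ‖ₑ ^ 4 * (P η * Q ζ) ≤ _ * (P η * Q ζ) := mul_le_mul' (hpt η ζ) le_rfl
          _ = _ := by ring
    _ = ∫⁻ η, (ENNReal.ofReal ((n + 1) ^ 3) * (‖η‖ₑ ^ 4 * P η) * (∫⁻ ζ, Q ζ) +
          ENNReal.ofReal (((n + 1) / n) ^ 3) * P η * (∫⁻ ζ, ‖ζ‖ₑ ^ 4 * Q ζ)) := by
        congr 1; ext η
        rw [lintegral_add_left (by fun_prop), lintegral_const_mul _ hQ,
          lintegral_const_mul _ (by fun_prop)]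
    _ = _ := by
        rw [lintegral_add_left (by fun_prop), lintegral_mul_const _ (by fun_prop),
          lintegral_mul_const _ (by fun_prop), lintegral_const_mul _ (by fun_prop),
          lintegral_const_mul _ (by fun_prop)]

/-- The fourth moment of a convolution power: the constant `(j+1)⁴ = (j+1) (j+1)³` is the one
which the power mean inequality `|ξ₀ + ⋯ + ξ_j|⁴ ≤ (j+1)³ ∑ |ξ_i|⁴` gives. -/
theorem lintegral_norm_pow_four_mul_convPow_le {P : Space d → ℝ≥0∞} (hP : Measurable P) (j : ℕ) :
    ∫⁻ ξ, ‖ξ‖ₑ ^ 4 * convPow P j ξ ≤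
      ((j : ℝ≥0∞) + 1) ^ 4 * (∫⁻ ξ, P ξ) ^ j * ∫⁻ ξ, ‖ξ‖ₑ ^ 4 * P ξ := by
  induction j with
  | zero => simp [convPow]
  | succ j ih =>
    have hn : (0 : ℝ) < (j : ℝ) + 1 := by positivity
    refine (lintegral_norm_pow_four_mul_lconvolution_le hP (measurable_convPow hP j) hn).trans ?_
    rw [lintegral_convPow hP]
    have e1 : ENNReal.ofReal (((j : ℝ) + 1 + 1) ^ 3) = ((j : ℝ≥0∞) + 1 + 1) ^ 3 := by
      rw [ENNReal.ofReal_pow (by positivity)]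
      congr 1
      have : ((j : ℝ) + 1 + 1) = ((j + 1 + 1 : ℕ) : ℝ) := by push_cast; ring
      rw [this, ENNReal.ofReal_natCast]
      push_cast
      ring
    have e2 : ENNReal.ofReal ((((j : ℝ) + 1 + 1) / (j + 1)) ^ 3) * ((j : ℝ≥0∞) + 1) ^ 4 =
        ((j : ℝ≥0∞) + 1 + 1) ^ 3 * ((j : ℝ≥0∞) + 1) := by
      have h1 : ((j : ℝ≥0∞) + 1) = ENNReal.ofReal ((j : ℝ) + 1) := by
        rw [ENNReal.ofReal_add (by positivity) (by positivity)]
        simp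
      rw [← e1, h1, ← ENNReal.ofReal_pow (by positivity), ← ENNReal.ofReal_mul (by positivity),
        ← ENNReal.ofReal_mul (by positivity)]
      congr 1
      field_simp
    set M := ∫⁻ ξ, P ξ
    set M4 := ∫⁻ ξ, ‖ξ‖ₑ ^ 4 * P ξ
    calc _ ≤ ENNReal.ofReal (((j : ℝ) + 1 + 1) ^ 3) * M4 * M ^ (j + 1) +
          ENNReal.ofReal ((((j : ℝ) + 1 + 1) / (j + 1)) ^ 3) * M *
            (((j : ℝ≥0∞) + 1) ^ 4 * M ^ j * M4) := by gcongr
      _ = ENNReal.ofReal (((j : ℝ) + 1 + 1) ^ 3) * M4 * M ^ (j + 1) +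
          (ENNReal.ofReal ((((j : ℝ) + 1 + 1) / (j + 1)) ^ 3) * ((j : ℝ≥0∞) + 1) ^ 4) *
            (M ^ (j + 1) * M4) := by ring
      _ = _ := by
        rw [e1, e2]
        push_cast
        ring

theorem norm_mul_lconvolution_le {P Q : Space d → ℝ≥0∞} (hP : Measurable P)
    (hQ : Measurable Q) (ξ : Space d) :
    ‖ξ‖ₑ * (P ⋆ₗ Q) ξ ≤ ((fun η => ‖η‖ₑ * P η) ⋆ₗ Q) ξ + (P ⋆ₗ fun η => ‖η‖ₑ * Q η) ξ := by
  simp only [lconvolution_def]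
  rw [← lintegral_const_mul _ (by fun_prop), ← lintegral_add_left (by fun_prop)]
  gcongr with y
  calc ‖ξ‖ₑ * (P y * Q (-y + ξ)) = ‖y + (-y + ξ)‖ₑ * (P y * Q (-y + ξ)) := by simp
    _ ≤ (‖y‖ₑ + ‖-y + ξ‖ₑ) * (P y * Q (-y + ξ)) := by gcongr; exact enorm_add_le _ _
    _ = _ := by ring

theorem lconvolution_mono {P Q R : Space d → ℝ≥0∞} (h : ∀ ξ, Q ξ ≤ R ξ) (ξ : Space d) :
    (P ⋆ₗ Q) ξ ≤ (P ⋆ₗ R) ξ := by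
  simp only [lconvolution_def]
  gcongr with y
  exact h _

/-- A factor `|ξ|` on a convolution power is moved to one of the `j + 2` convolved functions. -/
theorem norm_mul_convPow_le {P : Space d → ℝ≥0∞} (hP : Measurable P) (j : ℕ) (ξ : Space d) :
    ‖ξ‖ₑ * convPow P (j + 1) ξ ≤ ((j : ℝ≥0∞) + 2) * ((fun η => ‖η‖ₑ * P η) ⋆ₗ convPow P j) ξ := by
  induction j generalizing ξ with
  | zero =>
    refine (norm_mul_lconvolution_le hP hP ξ).trans ?_
    rw [lconvolution_comm (f := P)]
    simp only [convPow, Nat.cast_zero, zero_add]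
    rw [two_mul]
  | succ j ih =>
    refine (norm_mul_lconvolution_le hP (measurable_convPow hP (j + 1)) ξ).trans ?_
    have h1 : (P ⋆ₗ fun η => ‖η‖ₑ * convPow P (j + 1) η) ξ ≤
        ((j : ℝ≥0∞) + 2) * ((fun η => ‖η‖ₑ * P η) ⋆ₗ convPow P (j + 1)) ξ := by
      refine (lconvolution_mono ih ξ).trans ?_
      have hm : Measurable ((fun η => ‖η‖ₑ * P η) ⋆ₗ convPow P j) :=
        measurable_lconvolution _ (by fun_prop) (measurable_convPow hP j)
      have e : (P ⋆ₗ fun η => ((j : ℝ≥0∞) + 2) * ((fun η => ‖η‖ₑ * P η) ⋆ₗ convPow P j) η) ξ =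
          ((j : ℝ≥0∞) + 2) * (P ⋆ₗ ((fun η => ‖η‖ₑ * P η) ⋆ₗ convPow P j)) ξ := by
        rw [lconvolution_def, lconvolution_def, ← lintegral_const_mul _ (by fun_prop)]
        congr 1; ext y
        ring
      rw [e, lconvolution_assoc hP (by fun_prop) (measurable_convPow hP j),
        lconvolution_comm (f := P) (g := fun η => ‖η‖ₑ * P η),
        ← lconvolution_assoc (by fun_prop) hP (measurable_convPow hP j)]
      rfl
    calc _ ≤ _ + _ := add_le_add le_rfl h1
      _ = _ := by push_cast; ring

/-- The majorant `∑_{j ≥ 2} P^{⋆j} / j!` of the Fourier transform of `e^{-w} - 1 + w` for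
`|ŵ| ≤ P`. -/
def expMajorant (P : Space d → ℝ≥0∞) (ξ : Space d) : ℝ≥0∞ :=
  ∑' j : ℕ, ((j + 2).factorial : ℝ≥0∞)⁻¹ * convPow P (j + 1) ξ

theorem measurable_expMajorant {P : Space d → ℝ≥0∞} (hP : Measurable P) :
    Measurable (expMajorant P) :=
  Measurable.tsum fun j => (measurable_convPow hP (j + 1)).const_mul _

/-- The estimate behind the smallness condition: `(j+1)⁴ / (j+1)! = (j+1)³ / j!` turns the fourth
moments of the convolution powers into the coefficients of `f₂`. -/
theorem lintegral_norm_pow_four_mul_expMajorant_le {P : Space d → ℝ≥0∞} (hP : Measurable P)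
    {y : ℝ} (hy : 0 ≤ y) (h : ∫⁻ ξ, P ξ ≤ ENNReal.ofReal y) :
    ∫⁻ ξ, ‖ξ‖ₑ ^ 4 * expMajorant P ξ ≤ ENNReal.ofReal (f2 y) * ∫⁻ ξ, ‖ξ‖ₑ ^ 4 * P ξ := by
  set M4 := ∫⁻ ξ, ‖ξ‖ₑ ^ 4 * P ξ
  have hm := fun j => measurable_convPow hP j
  calc ∫⁻ ξ, ‖ξ‖ₑ ^ 4 * expMajorant P ξ
      = ∑' j : ℕ, ((j + 2).factorial : ℝ≥0∞)⁻¹ * ∫⁻ ξ, ‖ξ‖ₑ ^ 4 * convPow P (j + 1) ξ := by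
        simp only [expMajorant, ← ENNReal.tsum_mul_left]
        rw [lintegral_tsum fun j => by fun_prop]
        congr 1; ext j
        rw [← lintegral_const_mul _ (by fun_prop)]
        congr 1; ext ξ
        ring
    _ ≤ ∑' j : ℕ, ENNReal.ofReal (((j : ℝ) + 2) ^ 3 / ((j + 1).factorial : ℝ) * y ^ (j + 1)) *
        M4 := by
        refine ENNReal.tsum_le_tsum fun j => ?_
        calc _ ≤ ((j + 2).factorial : ℝ≥0∞)⁻¹ *
              ((((j + 1 : ℕ) : ℝ≥0∞) + 1) ^ 4 * (∫⁻ ξ, P ξ) ^ (j + 1) * M4) := by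
              gcongr
              exact lintegral_norm_pow_four_mul_convPow_le hP (j + 1)
          _ ≤ ((j + 2).factorial : ℝ≥0∞)⁻¹ *
              ((((j + 1 : ℕ) : ℝ≥0∞) + 1) ^ 4 * (ENNReal.ofReal y) ^ (j + 1) * M4) := by gcongr
          _ = _ := by
              rw [← mul_assoc, ← mul_assoc]
              congr 1
              have e1 : ((j + 2).factorial : ℝ≥0∞)⁻¹ =
                  ENNReal.ofReal ((j + 2).factorial : ℝ)⁻¹ := by
                rw [ENNReal.ofReal_inv_of_pos (by positivity), ENNReal.ofReal_natCast]
              have e2 : (((j + 1 : ℕ) : ℝ≥0∞) + 1) = ENNReal.ofReal ((j : ℝ) + 2) := by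
                have : ((j : ℝ) + 2) = ((j + 2 : ℕ) : ℝ) := by push_cast; ring
                rw [this, ENNReal.ofReal_natCast]
                push_cast; ring
              rw [e1, e2, ← ENNReal.ofReal_pow (by positivity), ← ENNReal.ofReal_pow hy,
                ← ENNReal.ofReal_mul (by positivity), ← ENNReal.ofReal_mul (by positivity)]
              congr 1
              rw [Nat.factorial_succ (j + 1)]
              push_cast
              field_simp
              ring
    _ = _ := by
        rw [ENNReal.tsum_mul_right, ← (hasSum_f2 y).tsum_eq,
          ENNReal.ofReal_tsum_of_nonneg (fun j => by positivity) (hasSum_f2 y).summable]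

theorem hasSum_exp_sub_one (y : ℝ) :
    HasSum (fun j : ℕ => ((j + 1).factorial : ℝ)⁻¹ * y ^ (j + 1)) (Real.exp y - 1) := by
  have he : HasSum (fun n : ℕ => y ^ n / (n.factorial : ℝ)) (Real.exp y) := by
    rw [Real.exp_eq_exp_ℝ]
    exact NormedSpace.expSeries_div_hasSum_exp y
  rw [← hasSum_nat_add_iff' 1] at he
  simpa [div_eq_inv_mul] using he

/-- The `Ḣ¹` bound for the majorant. -/
theorem lintegral_norm_mul_expMajorant_sq_le {P : Space d → ℝ≥0∞} (hP : Measurable P)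
    {y : ℝ} (hy : 0 ≤ y) (h : ∫⁻ ξ, P ξ ≤ ENNReal.ofReal y) :
    ∫⁻ ξ, (‖ξ‖ₑ * expMajorant P ξ) ^ 2 ≤
      ENNReal.ofReal (Real.exp y - 1) ^ 2 * ∫⁻ ξ, (‖ξ‖ₑ * P ξ) ^ 2 := by
  have hm := fun j => measurable_convPow hP j
  set Q : Space d → ℝ≥0∞ := fun ξ => ∑' j : ℕ, ((j + 1).factorial : ℝ≥0∞)⁻¹ * convPow P j ξ with hQ
  have hQm : Measurable Q := Measurable.tsum fun j => (hm j).const_mul _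
  have hfac : ∀ n : ℕ, ((n.factorial : ℕ) : ℝ≥0∞)⁻¹ = ENNReal.ofReal ((n.factorial : ℝ)⁻¹) := by
    intro n
    rw [ENNReal.ofReal_inv_of_pos (by positivity), ENNReal.ofReal_natCast]
  have hQ1 : ∫⁻ ξ, Q ξ ≤ ENNReal.ofReal (Real.exp y - 1) := by
    rw [hQ, lintegral_tsum fun j => by fun_prop, ← (hasSum_exp_sub_one y).tsum_eq,
          ENNReal.ofReal_tsum_of_nonneg (fun j => by positivity) (hasSum_exp_sub_one y).summable]
    gcongr with j
    rw [lintegral_const_mul _ (hm j), lintegral_convPow hP, ENNReal.ofReal_mul (by positivity),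
      ENNReal.ofReal_pow hy, hfac]
    gcongr
  have key : ∀ ξ, ‖ξ‖ₑ * expMajorant P ξ ≤ ((fun η => ‖η‖ₑ * P η) ⋆ₗ Q) ξ := by
    intro ξ
    have e : ((fun η => ‖η‖ₑ * P η) ⋆ₗ Q) ξ =
        ∑' j : ℕ, ((j + 1).factorial : ℝ≥0∞)⁻¹ * ((fun η => ‖η‖ₑ * P η) ⋆ₗ convPow P j) ξ := by
      simp only [lconvolution_def, hQ, ← ENNReal.tsum_mul_left]
      rw [lintegral_tsum fun j => by fun_prop]
      congr 1; ext j
      rw [← lintegral_const_mul _ (by fun_prop)]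
      congr 1; ext y
      ring
    rw [e, expMajorant, ← ENNReal.tsum_mul_left]
    refine ENNReal.tsum_le_tsum fun j => ?_
    calc ‖ξ‖ₑ * (((j + 2).factorial : ℝ≥0∞)⁻¹ * convPow P (j + 1) ξ)
        = ((j + 2).factorial : ℝ≥0∞)⁻¹ * (‖ξ‖ₑ * convPow P (j + 1) ξ) := by ring
      _ ≤ ((j + 2).factorial : ℝ≥0∞)⁻¹ *
          (((j : ℝ≥0∞) + 2) * ((fun η => ‖η‖ₑ * P η) ⋆ₗ convPow P j) ξ) := by
          exact mul_le_mul' le_rfl (norm_mul_convPow_le hP j ξ)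
      _ = _ := by
          rw [← mul_assoc]
          congr 1
          have e2 : ((j : ℝ≥0∞) + 2) = ENNReal.ofReal ((j : ℝ) + 2) := by
            have : ((j : ℝ) + 2) = ((j + 2 : ℕ) : ℝ) := by push_cast; ring
            rw [this, ENNReal.ofReal_natCast]
            push_cast; ring
          rw [hfac, hfac, e2, ← ENNReal.ofReal_mul (by positivity)]
          congr 1
          rw [Nat.factorial_succ (j + 1)]
          push_cast
          field_simp
          ring
  calc ∫⁻ ξ, (‖ξ‖ₑ * expMajorant P ξ) ^ 2 ≤ ∫⁻ ξ, (((fun η => ‖η‖ₑ * P η) ⋆ₗ Q) ξ) ^ 2 := by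
        gcongr with ξ
        exact key ξ
    _ ≤ _ := lintegral_lconvolution_sq_le (by fun_prop) hQm
    _ ≤ _ := by
        rw [mul_comm]
        gcongr

theorem lintegral_expMajorant_lt_top {P : Space d → ℝ≥0∞} (hP : Measurable P)
    (h : ∫⁻ ξ, P ξ < ⊤) : ∑' j : ℕ, ∫⁻ ξ,
        ((j + 2).factorial : ℝ≥0∞)⁻¹ * convPow P (j + 1) ξ < ⊤ := by
  have hm := fun j => measurable_convPow hP j
  obtain ⟨y, hy⟩ : ∃ y : NNReal, ∫⁻ ξ, P ξ = y := ⟨_, (ENNReal.coe_toNNReal h.ne).symm⟩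
  have hs : Summable fun j : ℕ => ((j + 2).factorial : ℝ)⁻¹ * (y : ℝ) ^ (j + 2) :=
    (summable_nat_add_iff 1).2 (hasSum_exp_sub_one (y : ℝ)).summable
  have : ∀ j : ℕ, ∫⁻ ξ, ((j + 2).factorial : ℝ≥0∞)⁻¹ * convPow P (j + 1) ξ =
      ENNReal.ofReal (((j + 2).factorial : ℝ)⁻¹ * (y : ℝ) ^ (j + 2)) := by
    intro j
    rw [lintegral_const_mul _ (hm _), lintegral_convPow hP, hy, ENNReal.ofReal_mul (by positivity),
      ENNReal.ofReal_inv_of_pos (by positivity), ENNReal.ofReal_natCast,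
      ENNReal.ofReal_pow (by positivity), ENNReal.ofReal_coe_nnreal]
  simp only [this]
  rw [← ENNReal.ofReal_tsum_of_nonneg (fun j => by positivity) hs]
  exact ENNReal.ofReal_lt_top

/-! ### Exponentials of Fourier majorised functions and a global Picard theorem -/

open Convolution in
theorem fourierInv_convolution {F G : Space d → ℂ} (hF : Integrable F) (hG : Integrable G)
    (x : Space d) : 𝓕⁻ (F ⋆[ContinuousLinearMap.mul ℂ ℂ] G) x = 𝓕⁻ F x * 𝓕⁻ G x := by
  simp only [Real.fourierInv_eq_fourier_neg]
  exact Real.fourier_mul_convolution_eq hF hG (-x)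

open Convolution in
/-- The convolution powers of a complex function: `cPow F j` is the `(j+1)`-fold convolution. -/
def cPow (F : Space d → ℂ) : ℕ → Space d → ℂ
  | 0 => F
  | j + 1 => F ⋆[ContinuousLinearMap.mul ℂ ℂ] cPow F j

theorem integrable_cPow {F : Space d → ℂ} (hF : Integrable F) (j : ℕ) : Integrable (cPow F j) := by
  induction j with
  | zero => exact hF
  | succ j ih => exact hF.integrable_convolution _ ih

theorem fourierInv_cPow {F : Space d → ℂ} (hF : Integrable F) (j : ℕ) (x : Space d) :
    𝓕⁻ (cPow F j) x = 𝓕⁻ F x ^ (j + 1) := by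
  induction j with
  | zero => simp [cPow]
  | succ j ih => rw [cPow, fourierInv_convolution hF (integrable_cPow hF j), ih]; ring

theorem enorm_cPow_le (F : Space d → ℂ) (j : ℕ) (ξ : Space d) :
    ‖cPow F j ξ‖ₑ ≤ convPow (fun η => ‖F η‖ₑ) j ξ := by
  induction j generalizing ξ with
  | zero => exact le_rfl
  | succ j ih =>
    rw [cPow, convPow, lconvolution_def, convolution]
    refine (enorm_integral_le_lintegral_enorm _).trans ?_
    refine lintegral_mono fun y => ?_
    simp only [ContinuousLinearMap.mul_apply', enorm_mul]
    refine mul_le_mul' le_rfl ?_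
    rw [neg_add_eq_sub]
    exact ih _

/-- If `|ŵ|` is integrable, then the Fourier transform of `e^{-w} - 1 + w` is bounded by the
majorant of `|ŵ|`: the exponential series turns into a series of convolution powers. -/
theorem enorm_FT_exp_le {w n : L2 d} (hw : Integrable (FT w : Space d → ℂ))
    (hn : ∀ᵐ x, n x = Real.exp (-(w x)) - 1 + w x) :
    ∀ᵐ ξ, ‖FT n ξ‖ₑ ≤ expMajorant (fun η => ‖FT w η‖ₑ) ξ := by
  set F : Space d → ℂ := (FT w : Space d → ℂ) with hFdef
  have hPm : Measurable (fun η => ‖F η‖ₑ) := (Lp.stronglyMeasurable (FT w)).measurable.enorm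
  have hlt := lintegral_expMajorant_lt_top hPm hw.2
  set c : ℕ → ℂ := fun j => (-1) ^ j * ((j + 2).factorial : ℂ)⁻¹ with hc
  set G : ℕ → Space d → ℂ := fun j ξ => c j * cPow F (j + 1) ξ with hG
  have hGi : ∀ j, Integrable (G j) := fun j => (integrable_cPow hw (j + 1)).const_mul _
  have hGle : ∀ j ξ, ‖G j ξ‖ₑ ≤ ((j + 2).factorial : ℝ≥0∞)⁻¹ * convPow (fun η => ‖F η‖ₑ) (j +
      1) ξ := by
    intro j ξ
    simp only [hG, hc, enorm_mul, enorm_pow, enorm_neg, enorm_one, one_pow, one_mul]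
    refine mul_le_mul' (le_of_eq ?_) (enorm_cPow_le F (j + 1) ξ)
    rw [enorm_inv (Nat.cast_ne_zero.2 (Nat.factorial_ne_zero _))]
    congr 1
    rw [← ofReal_norm, Complex.norm_natCast, ENNReal.ofReal_natCast]
  have hGn : ∑' j, ∫⁻ ξ, ‖G j ξ‖ₑ < ⊤ :=
    (ENNReal.tsum_le_tsum fun j => lintegral_mono (hGle j)).trans_lt hlt
  -- Tonelli's theorem: the series converges absolutely at almost every frequency
  have hGae : ∀ᵐ ξ, Summable fun j => ‖G j ξ‖ := by
    rw [← lintegral_tsum fun j => (hGi j).1.enorm] at hGn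
    filter_upwards [ae_lt_top' (AEMeasurable.tsum fun j => (hGi j).1.enorm) hGn.ne] with ξ hξ
    have h2 := ENNReal.summable_toReal hξ.ne
    simpa using h2
  set S : Space d → ℂ := fun ξ => ∑' j, G j ξ with hS
  have hSm : AEStronglyMeasurable S volume := by
    apply aestronglyMeasurable_of_tendsto_ae (u := atTop)
      (f := fun (n : ℕ) ξ => ∑ j ∈ Finset.range n, G j ξ)
    · intro n
      exact (integrable_finsetSum _ fun j _ => hGi j).1
    · filter_upwards [hGae] with ξ hξ
      exact hξ.of_norm.hasSum.tendsto_sum_nat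
  have hSle : ∀ᵐ ξ, ‖S ξ‖ₑ ≤ ∑' j, ‖G j ξ‖ₑ := by
    filter_upwards [hGae] with ξ hξ
    exact enorm_tsum_le_tsum_enorm
  have hSi : Integrable S := by
    refine ⟨hSm, ?_⟩
    rw [HasFiniteIntegral]
    refine (lintegral_mono_ae hSle).trans_lt ?_
    rwa [lintegral_tsum fun j => (hGi j).1.enorm]
  -- the inverse Fourier transform is applied term by term
  have hinv : ∀ x, HasSum (fun j => c j * 𝓕⁻ F x ^ (j + 2)) (𝓕⁻ S x) := by
    intro x
    have h1 : ∀ j, c j * 𝓕⁻ F x ^ (j + 2) =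
        ∫ ξ, Real.fourierChar (inner ℝ ξ x) • G j ξ := by
      intro j
      rw [← fourierInv_cPow hw (j + 1), Real.fourierInv_eq, ← integral_const_mul]
      congr 1; ext ξ
      simp only [hG, Circle.smul_def, smul_eq_mul]
      ring
    simp only [h1]
    rw [Real.fourierInv_eq]
    have h2 := hasSum_integral_of_summable_integral_norm (μ := volume)
      (F := fun j ξ => Real.fourierChar (inner ℝ ξ x) • G j ξ) ?_ ?_
    · have e : ∫ ξ, Real.fourierChar (inner ℝ ξ x) • S ξ =
          ∫ ξ, ∑' j, Real.fourierChar (inner ℝ ξ x) • G j ξ := by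
        congr 1
        ext ξ
        simp only [Circle.smul_def, smul_eq_mul, hS, tsum_mul_left]
      rw [e]
      exact h2
    · intro j
      have := (hGi j).norm
      refine (Integrable.mono' this ?_ ?_)
      · simp only [Circle.smul_def, smul_eq_mul]
        refine AEStronglyMeasurable.mul ?_ (hGi j).1
        refine Continuous.aestronglyMeasurable ?_
        have := Real.continuous_fourierChar
        fun_prop
      · filter_upwards with ξ
        simp
    · have h3 := ENNReal.summable_toReal hGn.ne
      convert h3 using 2 with j
      rw [integral_norm_eq_lintegral_enorm]
      · congr 1
        refine lintegral_congr fun ξ => ?_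
        rw [Circle.smul_def, enorm_smul]
        have h4 : ‖((Real.fourierChar (inner ℝ ξ x) : Circle) : ℂ)‖ₑ = 1 := by
          rw [← ofReal_norm, Circle.norm_coe, ENNReal.ofReal_one]
        rw [h4, one_mul]
      · simp only [Circle.smul_def, smul_eq_mul]
        refine AEStronglyMeasurable.mul ?_ (hGi j).1
        refine Continuous.aestronglyMeasurable ?_
        have := Real.continuous_fourierChar
        fun_prop
  have hexp : ∀ z : ℂ, HasSum (fun j => c j * z ^ (j + 2)) (Complex.exp (-z) - 1 + z) := by
    intro z
    have h1 : HasSum (fun n : ℕ => (-z) ^ n / (n.factorial : ℂ)) (Complex.exp (-z)) := by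
      rw [Complex.exp_eq_exp_ℂ]
      exact NormedSpace.expSeries_div_hasSum_exp (-z)
    rw [← hasSum_nat_add_iff' 2] at h1
    convert! h1 using 1
    · ext j
      simp only [hc]
      rw [neg_pow z, pow_add (-1 : ℂ) j 2]
      simp [div_eq_mul_inv]
      ring
    · simp [Finset.sum_range_succ]
      ring
  have hnS : FT n =ᵐ[volume] S := by
    apply FT_ae_eq_of_eq_fourierInv hSi
    filter_upwards [ae_eq_fourierInv_FT hw, hn] with x h1 h2
    rw [← (hexp _).unique (hinv x), hFdef, ← h1, h2]
    push_cast
    ring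
  filter_upwards [hnS, hSle] with ξ h1 h2
  rw [h1]
  exact h2.trans (ENNReal.tsum_le_tsum fun j => hGle j ξ)

/-- Global existence for an ordinary differential equation with a globally Lipschitz right-hand
side. The integral equation for `e^{-λ t} u(t)` is a contraction of the bounded continuous
functions once `λ` exceeds the Lipschitz constant. For negative times, `u` is continued with a
constant derivative. -/
theorem exists_global_ode {E : Type*} [NormedAddCommGroup E] [NormedSpace ℝ E] [CompleteSpace E]
    {G : E → E} {K : NNReal} (hG : LipschitzWith K G) (x₀ : E) :
    ∃ u : ℝ → E, u 0 = x₀ ∧ Continuous u ∧ ∀ t, 0 ≤ t → HasDerivAt u (G (u t)) t := by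
  -- with this rate the integral operator has Lipschitz constant `K / l ≤ 1 / 2`
  set l : ℝ := 2 * K + 1 with hl
  have hl0 : 0 < l := by positivity
  have hGc := hG.continuous
  have cont_int : ∀ v : ℝ → E, Continuous v →
      Continuous fun s : ℝ => G (Real.exp (l * s) • v s) := by
    intro v hv
    exact hGc.comp (by fun_prop)
  have hint : ∀ t : ℝ, ∫ s in (0 : ℝ)..t, Real.exp (l * s) = (Real.exp (l * t) - 1) / l := by
    intro t
    rw [intervalIntegral.integral_comp_mul_left (fun x => Real.exp x) hl0.ne', integral_exp]
    simp [div_eq_inv_mul]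
  have hbound : ∀ (f : ℝ → E) (C : ℝ), (∀ s, 0 ≤ s → ‖f s‖ ≤ C * Real.exp (l * s)) → 0 ≤ C →
      ∀ t, 0 ≤ t → ‖Real.exp (-(l * t)) • ∫ s in (0 : ℝ)..t, f s‖ ≤ C / l := by
    intro f C hf hC t ht
    have h1 : ‖∫ s in (0 : ℝ)..t, f s‖ ≤ ∫ s in (0 : ℝ)..t, C * Real.exp (l * s) :=
      intervalIntegral.norm_integral_le_of_norm_le ht (by filter_upwards with s hs using hf s hs.1.le)
        (Continuous.intervalIntegrable (by fun_prop) _ _)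
    rw [intervalIntegral.integral_const_mul, hint] at h1
    rw [norm_smul, Real.norm_of_nonneg (Real.exp_pos _).le]
    calc Real.exp (-(l * t)) * ‖∫ s in (0 : ℝ)..t, f s‖
        ≤ Real.exp (-(l * t)) * (C * ((Real.exp (l * t) - 1) / l)) := by gcongr
      _ = C / l * (1 - Real.exp (-(l * t))) := by
        rw [Real.exp_neg]
        field_simp
      _ ≤ C / l * 1 := by
        gcongr
        linarith [Real.exp_pos (-(l * t))]
      _ = C / l := mul_one _
  -- `max t 0` lets bounded continuous functions on all of `ℝ` be used
  set Φ : (BoundedContinuousFunction ℝ E) → ℝ → E := fun v t =>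
    Real.exp (-(l * max t 0)) • (x₀ + ∫ s in (0 : ℝ)..(max t 0), G (Real.exp (l * s) • v s)) with hΦ
  have hGle : ∀ x, ‖G x‖ ≤ ‖G 0‖ + K * ‖x‖ := by
    intro x
    have h1 := hG.norm_sub_le x 0
    have h2 := norm_le_norm_add_norm_sub' (G x) (G 0)
    simp only [sub_zero] at h1
    linarith
  have hprim : ∀ v : ℝ → E, Continuous v → Continuous fun t : ℝ =>
      ∫ s in (0 : ℝ)..t, G (Real.exp (l * s) • v s) := fun v hv =>
    intervalIntegral.continuous_primitive (fun a b => (cont_int v hv).intervalIntegrable a b) 0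
  have hΦc : ∀ v, Continuous (Φ v) := by
    intro v
    have h2 := (hprim v v.continuous).comp (continuous_id.max (continuous_const (y := (0 : ℝ))))
    simp only [hΦ]
    refine Continuous.smul (by fun_prop) (continuous_const.add h2)
  have hΦb : ∀ v : BoundedContinuousFunction ℝ E, ∀ t,
      ‖Φ v t‖ ≤ ‖x₀‖ + (‖G 0‖ + K * ‖v‖) / l := by
    intro v t
    have ht : 0 ≤ max t 0 := le_max_right _ _
    simp only [hΦ]
    rw [smul_add]
    refine (norm_add_le _ _).trans (add_le_add ?_ ?_)
    · rw [norm_smul, Real.norm_of_nonneg (Real.exp_pos _).le]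
      have : Real.exp (-(l * max t 0)) ≤ 1 := Real.exp_le_one_iff.2 (by nlinarith)
      nlinarith [norm_nonneg x₀]
    · refine hbound _ _ (fun s hs => (hGle _).trans ?_) (by positivity) _ ht
      have h1 : 1 ≤ Real.exp (l * s) := Real.one_le_exp (by positivity)
      rw [norm_smul, Real.norm_of_nonneg (Real.exp_pos _).le]
      have h2 := v.norm_coe_le_norm s
      calc ‖G 0‖ + K * (Real.exp (l * s) * ‖v s‖)
          ≤ ‖G 0‖ * Real.exp (l * s) + K * (Real.exp (l * s) * ‖v‖) := by
            gcongr
            exact le_mul_of_one_le_right (norm_nonneg _) h1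
        _ = _ := by ring
  let T : BoundedContinuousFunction ℝ E → BoundedContinuousFunction ℝ E := fun v =>
    BoundedContinuousFunction.ofNormedAddCommGroup (Φ v) (hΦc v) _ (hΦb v)
  have hT : ContractingWith (1 / 2) T := by
    refine ⟨by norm_num, LipschitzWith.of_dist_le_mul fun v v' => ?_⟩
    rw [BoundedContinuousFunction.dist_le (by positivity)]
    intro t
    have ht : 0 ≤ max t 0 := le_max_right _ _
    have e : T v t - T v' t = Real.exp (-(l * max t 0)) • ∫ s in (0 : ℝ)..(max t 0),
        (G (Real.exp (l * s) • v s) - G (Real.exp (l * s) • v' s)) := by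
      rw [intervalIntegral.integral_sub ((cont_int v v.continuous).intervalIntegrable _ _)
        ((cont_int v' v'.continuous).intervalIntegrable _ _)]
      change Φ v t - Φ v' t = _
      simp only [hΦ]
      rw [← smul_sub]
      congr 1
      abel
    rw [dist_eq_norm, e]
    have h1 := hbound (fun s => G (Real.exp (l * s) • v s) - G (Real.exp (l * s) • v' s))
      (K * dist v v') (fun s _ => ?_) (by positivity) _ ht
    · refine h1.trans ?_
      rw [div_le_iff₀ hl0]
      have : 0 ≤ dist v v' := dist_nonneg
      have hK : (0 : ℝ) ≤ K := K.2
      push_cast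
      rw [hl]
      nlinarith
    · refine (hG.norm_sub_le _ _).trans ?_
      rw [← smul_sub, norm_smul, Real.norm_of_nonneg (Real.exp_pos _).le, ← dist_eq_norm]
      have := BoundedContinuousFunction.dist_coe_le_dist (f := v) (g := v') s
      calc K * (Real.exp (l * s) * dist (v s) (v' s))
          ≤ K * (Real.exp (l * s) * dist v v') := by gcongr
        _ = _ := by ring
  obtain ⟨v, hv⟩ : ∃ v, T v = v := ⟨_, hT.fixedPoint_isFixedPt⟩
  have hv' : ∀ t, 0 ≤ t → Real.exp (l * t) • v t =
      x₀ + ∫ s in (0 : ℝ)..t, G (Real.exp (l * s) • v s) := by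
    intro t ht
    have h1 : v t = Φ v t := by
      conv_lhs => rw [← hv]
      rfl
    rw [h1]
    simp only [hΦ, max_eq_left ht]
    rw [smul_smul, ← Real.exp_add]
    simp
  have hgc : Continuous fun s : ℝ => G (Real.exp (l * max s 0) • v (max s 0)) :=
    (cont_int v v.continuous).comp (continuous_id.max continuous_const)
  refine ⟨fun t => x₀ + ∫ s in (0 : ℝ)..t, G (Real.exp (l * max s 0) • v (max s 0)), by simp, ?_,
      ?_⟩
  · exact continuous_const.add
      (intervalIntegral.continuous_primitive (fun a b => hgc.intervalIntegrable a b) 0)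
  · intro t ht
    have h1 := intervalIntegral.integral_hasDerivAt_right (hgc.intervalIntegrable 0 t)
      (hgc.stronglyMeasurableAtFilter _ _) hgc.continuousAt
    have h2 : x₀ + ∫ s in (0 : ℝ)..t, G (Real.exp (l * max s 0) • v (max s 0)) =
        Real.exp (l * max t 0) • v (max t 0) := by
      rw [max_eq_left ht, hv' t ht]
      congr 1
      apply intervalIntegral.integral_congr
      intro s hs
      rw [uIcc_of_le ht] at hs
      simp only [max_eq_left hs.1]
    simp only [h2]
    exact h1.const_add x₀

/-! ### Cut-off Fourier multipliers and the Galerkin flow -/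

/-- The radial symbol `p(|ξ|)`, cut off to the ball `|ξ| ≤ N`. -/
def cutSymbol (p : C(ℝ, ℝ)) (N : ℝ) (ξ : Space d) : ℝ :=
  if ‖ξ‖ ≤ N then p ‖ξ‖ else 0

theorem isSymbol_cutSymbol (p : C(ℝ, ℝ)) (N : ℝ) : IsSymbol (cutSymbol (d := d) p N) where
  measurable := Measurable.ite (measurableSet_le measurable_norm measurable_const)
    (p.continuous.measurable.comp measurable_norm) measurable_const
  bounded := by
    obtain ⟨C, hC⟩ := (isCompact_Icc (a := (0 : ℝ)) (b := N)).exists_bound_of_continuousOn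
      p.continuous.continuousOn
    refine ⟨max C 0, fun ξ => ?_⟩
    unfold cutSymbol
    split_ifs with h
    · exact (hC _ ⟨norm_nonneg _, h⟩).trans (le_max_left _ _)
    · simp
  even ξ := by simp [cutSymbol]

/-- The Fourier multiplier with symbol `p(|ξ|) 1_{|ξ| ≤ N}`. -/
def cutMul (p : C(ℝ, ℝ)) (N : ℝ) : L2 d →L[ℝ] L2 d :=
  multiplier (cutSymbol p N) (isSymbol_cutSymbol p N)

theorem FT_cutMul (p : C(ℝ, ℝ)) (N : ℝ) (u : L2 d) :
    FT (cutMul p N u) =ᵐ[volume] fun ξ => (cutSymbol p N ξ : ℂ) * FT u ξ :=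
  FT_multiplier _ _ u

theorem inner_cutMul_left (p : C(ℝ, ℝ)) (N : ℝ) (u v : L2 d) :
    inner ℝ (cutMul p N u) v = inner ℝ u (cutMul p N v) :=
  inner_multiplier_left _ _ u v

theorem cutMul_cutMul (p q : C(ℝ, ℝ)) (N M : ℝ) (u : L2 d) :
    cutMul p N (cutMul q M u) = cutMul (p * q) (min N M) u := by
  apply multiplier_multiplier
  intro ξ
  simp only [cutSymbol, le_min_iff, ContinuousMap.mul_apply]
  split_ifs <;> simp_all

/-- The projection onto the frequencies `|ξ| ≤ N`. -/
abbrev lowPass (N : ℝ) : L2 d →L[ℝ] L2 d := cutMul 1 N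

/-- The symbol `-(2πr)²` of the Laplacian. -/
def lapSym : C(ℝ, ℝ) := ⟨fun r => -(2 * Real.pi * r) ^ 2, by fun_prop⟩

/-- The Laplacian composed with the projection onto the frequencies `|ξ| ≤ N`. -/
abbrev cutLap (N : ℝ) : L2 d →L[ℝ] L2 d := cutMul lapSym N

/-- The multiplier `|ξ|` on the frequencies `|ξ| ≤ N`, whose `L²` norm is that of the gradient. -/
abbrev cutGrad (N : ℝ) : L2 d →L[ℝ] L2 d := cutMul (ContinuousMap.id ℝ) N

theorem lapSym_apply (r : ℝ) : lapSym r = -(2 * Real.pi * r) ^ 2 := rfl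

theorem lowPass_cutMul (p : C(ℝ, ℝ)) {N M : ℝ} (h : N ≤ M) (u : L2 d) :
    lowPass M (cutMul p N u) = cutMul p N u := by
  rw [cutMul_cutMul, one_mul, min_eq_right h]

theorem cutMul_comm (p q : C(ℝ, ℝ)) (N M : ℝ) (u : L2 d) :
    cutMul p N (cutMul q M u) = cutMul q M (cutMul p N u) := by
  rw [cutMul_cutMul, cutMul_cutMul, mul_comm, min_comm]

theorem norm_lowPass_le (N : ℝ) (u : L2 d) : ‖lowPass N u‖ ≤ ‖u‖ := by
  rw [← FT.norm_map, ← FT.norm_map u]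
  apply Lp.norm_le_norm_of_ae_le
  filter_upwards [FT_cutMul 1 N u] with ξ h
  rw [h, norm_mul, Complex.norm_real]
  have : ‖cutSymbol 1 N ξ‖ ≤ 1 := by
    unfold cutSymbol
    split_ifs <;> simp
  exact mul_le_of_le_one_left (norm_nonneg _) this

/-- The function `s ↦ e^{-s} - 1`, with `s` clipped to `[-1, 1]` so that it is Lipschitz. -/
def clipExp (s : ℝ) : ℝ := Real.exp (-(max (-1) (min 1 s))) - 1

theorem clipExp_of_abs_le {s : ℝ} (h : |s| ≤ 1) : clipExp s = Real.exp (-s) - 1 := by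
  obtain ⟨h1, h2⟩ := abs_le.1 h
  rw [clipExp, min_eq_right h2, max_eq_right h1]

theorem clipExp_zero : clipExp 0 = 0 := by simp [clipExp_of_abs_le]

theorem exp_sub_exp_le {a b C : ℝ} (ha : a ≤ C) (hab : b ≤ a) :
    Real.exp a - Real.exp b ≤ Real.exp C * (a - b) := by
  have h1 := Real.add_one_le_exp (b - a)
  have h2 : Real.exp b = Real.exp a * Real.exp (b - a) := by rw [← Real.exp_add]; ring_nf
  have h3 : Real.exp a ≤ Real.exp C := Real.exp_le_exp.2 ha
  have h4 := Real.exp_pos a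
  nlinarith

theorem abs_exp_sub_exp_le {a b C : ℝ} (ha : a ≤ C) (hb : b ≤ C) :
    |Real.exp a - Real.exp b| ≤ Real.exp C * |a - b| := by
  rcases le_total b a with h | h
  · rw [abs_of_nonneg (sub_nonneg.2 (Real.exp_le_exp.2 h)), abs_of_nonneg (sub_nonneg.2 h)]
    exact exp_sub_exp_le ha h
  · rw [abs_sub_comm, abs_sub_comm a, abs_of_nonneg (sub_nonneg.2 (Real.exp_le_exp.2 h)),
      abs_of_nonneg (sub_nonneg.2 h)]
    exact exp_sub_exp_le hb h

theorem lipschitzWith_clipExp : LipschitzWith ⟨Real.exp 1, (Real.exp_pos 1).le⟩ clipExp := by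
  refine LipschitzWith.of_dist_le_mul fun a b => ?_
  rw [Real.dist_eq, Real.dist_eq]
  unfold clipExp
  rw [sub_sub_sub_cancel_right]
  refine (abs_exp_sub_exp_le (C := 1) ?_ ?_).trans ?_
  · linarith [le_max_left (-1) (min 1 a)]
  · linarith [le_max_left (-1) (min 1 b)]
  · refine mul_le_mul_of_nonneg_left ?_ (Real.exp_pos 1).le
    have h1 := abs_max_sub_max_le_abs (min 1 b) (min 1 a) (-1)
    have h2 := abs_min_sub_min_le_max 1 b 1 a
    rw [neg_sub_neg, max_comm (-1) (min 1 b), max_comm (-1) (min 1 a)]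
    refine h1.trans (h2.trans ?_)
    rw [sub_self, abs_zero, abs_sub_comm]
    exact max_le (abs_nonneg _) le_rfl

theorem antitone_clipExp : Antitone clipExp := by
  intro a b h
  unfold clipExp
  gcongr

/-- Monotonicity of the nonlinearity. -/
theorem clipExp_mul_nonpos (a b : ℝ) : (clipExp a - clipExp b) * (a - b) ≤ 0 := by
  rcases le_total a b with h | h
  · exact mul_nonpos_of_nonneg_of_nonpos (sub_nonneg.2 (antitone_clipExp h)) (sub_nonpos.2 h)
  · exact mul_nonpos_of_nonpos_of_nonneg (sub_nonpos.2 (antitone_clipExp h)) (sub_nonneg.2 h)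

/-- The superposition operator `w ↦ e^{-w} - 1` on `L²`, with `w` clipped to `[-1, 1]`. -/
def nem (w : L2 d) : L2 d := lipschitzWith_clipExp.compLp clipExp_zero w

theorem coeFn_nem (w : L2 d) : nem w =ᵐ[volume] fun x => clipExp (w x) :=
  lipschitzWith_clipExp.coeFn_compLp clipExp_zero w

theorem lipschitzWith_nem :
    LipschitzWith ⟨Real.exp 1, (Real.exp_pos 1).le⟩ (nem : L2 d → L2 d) :=
  lipschitzWith_clipExp.lipschitzWith_compLp clipExp_zero

theorem norm_nem_le (w : L2 d) : ‖nem w‖ ≤ Real.exp 1 * ‖w‖ :=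
  lipschitzWith_clipExp.norm_compLp_le clipExp_zero w

theorem inner_nem_sub_nonpos (w w' : L2 d) : inner ℝ (nem w - nem w') (w - w') ≤ 0 := by
  rw [L2.inner_def]
  apply integral_nonpos_of_ae
  filter_upwards [coeFn_nem w, coeFn_nem w', Lp.coeFn_sub (nem w) (nem w'), Lp.coeFn_sub w w']
    with x h1 h2 h3 h4
  rw [h3, h4, Pi.sub_apply, Pi.sub_apply, h1, h2]
  simpa [mul_comm] using clipExp_mul_nonpos (w x) (w' x)

/-- Coercivity of `w ↦ -(e^{-w} - 1)` for small `w`. -/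
theorem inner_nem_le {w : L2 d} (hw : ∀ᵐ x, |w x| ≤ 1) :
    inner ℝ w (nem w) ≤ -Real.exp (-1) * ‖w‖ ^ 2 := by
  rw [← real_inner_self_eq_norm_sq, ← inner_smul_right, ← sub_nonpos, ← inner_sub_right,
    L2.inner_def]
  apply integral_nonpos_of_ae
  filter_upwards [coeFn_nem w, hw, Lp.coeFn_sub (nem w) (-Real.exp (-1) • w),
    Lp.coeFn_smul (-Real.exp (-1)) w] with x h1 h2 h3 h4
  rw [h3, Pi.sub_apply, h1, h4, clipExp_of_abs_le h2]
  simp only [Pi.smul_apply, smul_eq_mul, RCLike.inner_apply, conj_trivial, Pi.zero_apply]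
  obtain ⟨h5, h6⟩ := abs_le.1 h2
  have hm : Real.exp (-1) ≤ Real.exp (-(w x)) := Real.exp_le_exp.2 (by linarith)
  rcases le_total 0 (w x) with h | h
  · have h7 := Real.add_one_le_exp (w x)
    have h8 : Real.exp (-(w x)) * Real.exp (w x) = 1 := by rw [← Real.exp_add]; simp
    have h9 := Real.exp_pos (-(w x))
    have h10 : Real.exp (-(w x)) - 1 ≤ -Real.exp (-1) * w x := by nlinarith
    nlinarith
  · have h7 := Real.add_one_le_exp (-(w x))
    have h8 : Real.exp (-1) ≤ 1 := by simp
    have h10 : -Real.exp (-1) * w x ≤ Real.exp (-(w x)) - 1 := by nlinarith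
    nlinarith

/-- The vector field of the Galerkin system `u_t = P_N Δ (e^{-Δ P_N u} - 1)`. -/
def galerkinField (N : ℝ) (u : L2 d) : L2 d := cutLap N (nem (cutLap N u))

theorem exists_galerkin (N : ℝ) (a : L2 d) : ∃ u : ℝ → L2 d, u 0 = lowPass N a ∧ Continuous u ∧
    ∀ t, 0 ≤ t → HasDerivAt u (galerkinField N (u t)) t :=
  exists_global_ode (((cutLap (d := d) N).lipschitz.comp lipschitzWith_nem).comp
    (cutLap (d := d) N).lipschitz) _

/-- The solution of the Galerkin system with initial value `P_N a`. -/
def galerkin (N : ℝ) (a : L2 d) : ℝ → L2 d := (exists_galerkin N a).choose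

theorem galerkin_zero (N : ℝ) (a : L2 d) : galerkin N a 0 = lowPass N a :=
  (exists_galerkin N a).choose_spec.1

theorem continuous_galerkin (N : ℝ) (a : L2 d) : Continuous (galerkin N a) :=
  (exists_galerkin N a).choose_spec.2.1

theorem hasDerivAt_galerkin (N : ℝ) (a : L2 d) {t : ℝ} (ht : 0 ≤ t) :
    HasDerivAt (galerkin N a) (galerkinField N (galerkin N a t)) t :=
  (exists_galerkin N a).choose_spec.2.2 t ht

/-- The Galerkin flow stays in the band `|ξ| ≤ N`. -/
theorem lowPass_galerkin {N M : ℝ} (h : N ≤ M) (a : L2 d) {t : ℝ} (ht : 0 ≤ t) :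
    lowPass M (galerkin N a t) = galerkin N a t := by
  have h1 := constant_of_has_deriv_right_zero (a := 0) (b := t)
    (f := fun s => lowPass M (galerkin N a s) - galerkin N a s)
    (((lowPass M).continuous.comp (continuous_galerkin N a)).sub
      (continuous_galerkin N a)).continuousOn (fun s hs => by
      have h2 := hasDerivAt_galerkin N a hs.1
      have h3 := ((lowPass (d := d) M).hasFDerivAt.comp_hasDerivAt s h2).sub h2
      refine (h3.congr_deriv ?_).hasDerivWithinAt
      rw [galerkinField, lowPass_cutMul _ h, sub_self]) t ⟨ht, le_rfl⟩
  simp only [galerkin_zero, lowPass_cutMul _ h, sub_self] at h1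
  exact sub_eq_zero.1 h1

/-- The energy estimate for a curve `v` with `⟨v, v'⟩ ≤ g`. -/
theorem norm_sq_le_of_inner_le {E : Type*} [NormedAddCommGroup E] [InnerProductSpace ℝ E]
    {v v' : ℝ → E} {g : ℝ → ℝ} (hv : ∀ t, 0 ≤ t → HasDerivAt v (v' t) t) (hg : Continuous g)
    (h : ∀ t, 0 ≤ t → inner ℝ (v t) (v' t) ≤ g t) {t : ℝ} (ht : 0 ≤ t) :
    ‖v t‖ ^ 2 ≤ ‖v 0‖ ^ 2 + 2 * ∫ s in (0 : ℝ)..t, g s := by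
  have hd : ∀ s, 0 ≤ s → HasDerivAt (fun s => ‖v s‖ ^ 2 - 2 * ∫ r in (0 : ℝ)..s, g r)
      (2 * inner ℝ (v s) (v' s) - 2 * g s) s := by
    intro s hs
    exact (hv s hs).norm_sq.sub ((intervalIntegral.integral_hasDerivAt_right
      (hg.intervalIntegrable _ _) (hg.stronglyMeasurableAtFilter _ _) hg.continuousAt).const_mul 2)
  have ha : AntitoneOn (fun s => ‖v s‖ ^ 2 - 2 * ∫ r in (0 : ℝ)..s, g r) (Ici 0) := by
    apply antitoneOn_of_deriv_nonpos (convex_Ici 0)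
    · exact fun s hs => (hd s hs).continuousAt.continuousWithinAt
    · intro s hs
      rw [interior_Ici] at hs
      exact (hd s hs.le).differentiableAt.differentiableWithinAt
    · intro s hs
      rw [interior_Ici] at hs
      rw [(hd s hs.le).deriv]
      linarith [h s hs.le]
  have := ha self_mem_Ici ht ht
  simp only [intervalIntegral.integral_same, mul_zero, sub_zero] at this
  linarith

theorem inner_galerkinField (N : ℝ) (u v : L2 d) :
    inner ℝ (galerkinField N u) v = inner ℝ (nem (cutLap N u)) (cutLap N v) :=
  inner_cutMul_left _ _ _ _

/-- The Galerkin flow is a contraction of `L²`, because `w ↦ e^{-w}` is decreasing. -/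
theorem norm_galerkin_sub_le (N : ℝ) (a b : L2 d) {t : ℝ} (ht : 0 ≤ t) :
    ‖galerkin N a t - galerkin N b t‖ ≤ ‖a - b‖ := by
  have h1 := norm_sq_le_of_inner_le (v := fun t => galerkin N a t - galerkin N b t)
    (g := fun _ => 0) (fun s hs => (hasDerivAt_galerkin N a hs).sub (hasDerivAt_galerkin N b hs))
    continuous_const (fun s hs => by
      rw [real_inner_comm, inner_sub_left, inner_galerkinField, inner_galerkinField,
        ← inner_sub_left, map_sub]
      exact inner_nem_sub_nonpos _ _) ht
  simp only [galerkin_zero, intervalIntegral.integral_zero, mul_zero, add_zero, ← map_sub] at h1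
  have h2 := norm_lowPass_le N (a - b)
  exact (pow_le_pow_iff_left₀ (norm_nonneg _) (norm_nonneg _) two_ne_zero).1 h1 |>.trans h2

/-! ### Moments of the Fourier transform -/

/-- The moment `∫ (2π|ξ|)^k |û(ξ)| dξ` of the Fourier transform. -/
def moment (k : ℕ) (u : L2 d) : ℝ≥0∞ :=
  ∫⁻ ξ : Space d, ENNReal.ofReal ((2 * Real.pi * ‖ξ‖) ^ k) * ‖FT u ξ‖ₑ

/-- The part of the moment `∫ (2π|ξ|)^k |û(ξ)| dξ` which comes from the ball `|ξ| ≤ N`. -/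
def bandMoment (k : ℕ) (N : ℝ) (u : L2 d) : ℝ :=
  ∫ ξ in Metric.closedBall (0 : Space d) N, (2 * Real.pi * ‖ξ‖) ^ k * ‖FT u ξ‖

theorem measurable_FT (u : L2 d) : Measurable (FT u : Space d → ℂ) :=
  (Lp.stronglyMeasurable (FT u)).measurable

theorem lintegral_closedBall_enorm_le (N : ℝ) (U : L2C d) :
    ∫⁻ ξ in Metric.closedBall (0 : Space d) N, ‖U ξ‖ₑ ≤
      ‖U‖ₑ * volume (Metric.closedBall (0 : Space d) N) ^ (1 / 2 : ℝ) := by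
  have h := eLpNorm_le_eLpNorm_mul_rpow_measure_univ (p := 1) (q := 2)
    (μ := volume.restrict (Metric.closedBall (0 : Space d) N)) (f := (U : Space d → ℂ))
    (by norm_num) (Lp.aestronglyMeasurable U).restrict
  rw [eLpNorm_one_eq_lintegral_enorm, Measure.restrict_apply_univ] at h
  refine h.trans ?_
  have h2 : eLpNorm (U : Space d → ℂ) 2 (volume.restrict (Metric.closedBall (0 : Space d) N)) ≤
      ‖U‖ₑ := by
    rw [Lp.enorm_def]
    exact eLpNorm_mono_measure _ Measure.restrict_le_self
  refine (mul_le_mul' h2 le_rfl).trans (le_of_eq ?_)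
  norm_num

theorem integrableOn_FT_closedBall (N : ℝ) (u : L2 d) :
    IntegrableOn (FT u : Space d → ℂ) (Metric.closedBall 0 N) := by
  refine ⟨(Lp.aestronglyMeasurable _).restrict, ?_⟩
  refine (lintegral_closedBall_enorm_le N (FT u)).trans_lt (ENNReal.mul_lt_top enorm_lt_top ?_)
  exact ENNReal.rpow_lt_top_of_nonneg (by norm_num) measure_closedBall_lt_top.ne

theorem integrableOn_moment (k : ℕ) (N : ℝ) (u : L2 d) :
    IntegrableOn (fun ξ => (2 * Real.pi * ‖ξ‖) ^ k * ‖FT u ξ‖)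
        (Metric.closedBall (0 : Space d) N) := by
  refine Integrable.bdd_mul (c := (2 * Real.pi * N) ^ k) (integrableOn_FT_closedBall N u).norm
    (Continuous.aestronglyMeasurable (by fun_prop)) ?_
  filter_upwards [ae_restrict_mem Metric.isClosed_closedBall.measurableSet] with ξ hξ
  rw [mem_closedBall_zero_iff] at hξ
  rw [Real.norm_of_nonneg (by positivity)]
  gcongr

theorem bandMoment_nonneg (k : ℕ) (N : ℝ) (u : L2 d) : 0 ≤ bandMoment k N u :=
  integral_nonneg fun ξ => by positivity

/-- On a bounded band the moments are controlled by the `L²` norm. -/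
theorem exists_bandMoment_le (d k : ℕ) {N : ℝ} (hN : 0 ≤ N) :
    ∃ C : ℝ, 0 ≤ C ∧ ∀ u : L2 d, bandMoment k N u ≤ C * ‖u‖ := by
  refine ⟨(2 * Real.pi * N) ^ k * (volume (Metric.closedBall (0 : Space d) N) ^ (1 / 2 : ℝ)).toReal,
    by positivity, fun u => ?_⟩
  have h1 : bandMoment k N u ≤
      ∫ ξ in Metric.closedBall (0 : Space d) N, (2 * Real.pi * N) ^ k * ‖FT u ξ‖ := by
    apply setIntegral_mono_on (integrableOn_moment k N u)
      ((integrableOn_FT_closedBall N u).norm.const_mul _) Metric.isClosed_closedBall.measurableSet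
    intro ξ hξ
    rw [mem_closedBall_zero_iff] at hξ
    gcongr
  refine h1.trans ?_
  rw [integral_const_mul, mul_assoc ((2 * Real.pi * N) ^ k)]
  refine mul_le_mul_of_nonneg_left ?_ (by positivity)
  rw [integral_norm_eq_lintegral_enorm (Lp.aestronglyMeasurable _).restrict]
  have h2 := lintegral_closedBall_enorm_le N (FT u)
  have h3 : ‖FT u‖ₑ * volume (Metric.closedBall (0 : Space d) N) ^ (1 / 2 : ℝ) ≠ ⊤ :=
    (ENNReal.mul_lt_top enorm_lt_top
      (ENNReal.rpow_lt_top_of_nonneg (by norm_num) measure_closedBall_lt_top.ne)).ne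
  refine (ENNReal.toReal_mono h3 h2).trans ?_
  rw [ENNReal.toReal_mul, toReal_enorm, FT.norm_map, mul_comm]

theorem bandMoment_le_add (k : ℕ) (N : ℝ) (u v : L2 d) :
    bandMoment k N u ≤ bandMoment k N v + bandMoment k N (u - v) := by
  unfold bandMoment
  rw [← integral_add (integrableOn_moment k N v) (integrableOn_moment k N (u - v))]
  apply integral_mono_ae (integrableOn_moment k N u)
    ((integrableOn_moment k N v).add (integrableOn_moment k N (u - v)))
  rw [FT.map_sub]
  filter_upwards [ae_restrict_of_ae (Lp.coeFn_sub (FT u) (FT v))] with ξ h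
  simp only [h, Pi.sub_apply, Pi.add_apply]
  rw [← mul_add]
  gcongr
  exact norm_le_norm_add_norm_sub' _ _

theorem bandMoment_neg (k : ℕ) (N : ℝ) (u : L2 d) : bandMoment k N (-u) = bandMoment k N u := by
  unfold bandMoment
  apply integral_congr_ae
  rw [FT.map_neg]
  filter_upwards [ae_restrict_of_ae (Lp.coeFn_neg (FT u))] with ξ h
  rw [h, Pi.neg_apply, norm_neg]

theorem continuous_bandMoment (k : ℕ) {N : ℝ} (hN : 0 ≤ N) :
    Continuous (bandMoment (d := d) k N) := by
  obtain ⟨C, hC, h⟩ := exists_bandMoment_le d k hN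
  refine (LipschitzWith.of_dist_le_mul (K := C.toNNReal) fun u v => ?_).continuous
  rw [Real.dist_eq, dist_eq_norm, abs_le]
  have h1 := bandMoment_le_add k N u v
  have h2 := bandMoment_le_add k N v u
  have h3 := h (u - v)
  rw [← neg_sub u v, bandMoment_neg] at h2
  rw [Real.coe_toNNReal C hC]
  constructor <;> linarith

theorem ofReal_bandMoment (k : ℕ) (N : ℝ) (u : L2 d) : ENNReal.ofReal (bandMoment k N u) =
    ∫⁻ ξ in Metric.closedBall (0 : Space d) N,
      ENNReal.ofReal ((2 * Real.pi * ‖ξ‖) ^ k) * ‖FT u ξ‖ₑ := by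
  rw [bandMoment, ofReal_integral_eq_lintegral_ofReal (integrableOn_moment k N u)
    (by filter_upwards with ξ; simp only [Pi.zero_apply]; positivity)]
  congr 1; ext ξ
  rw [ENNReal.ofReal_mul (by positivity), ofReal_norm]

theorem ofReal_bandMoment_le (k : ℕ) (N : ℝ) (u : L2 d) :
    ENNReal.ofReal (bandMoment k N u) ≤ moment k u := by
  rw [ofReal_bandMoment]
  exact setLIntegral_le_lintegral _ _

theorem FT_eq_zero_of_lowPass {N : ℝ} {u : L2 d} (hu : lowPass N u = u) :
    ∀ᵐ ξ, N < ‖ξ‖ → FT u ξ = 0 := by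
  have h := FT_cutMul 1 N u
  rw [hu] at h
  filter_upwards [h] with ξ h1 h2
  rw [h1]
  simp [cutSymbol, not_le.2 h2]

theorem moment_eq_ofReal_bandMoment (k : ℕ) {N : ℝ} {u : L2 d} (hu : lowPass N u = u) :
    moment k u = ENNReal.ofReal (bandMoment k N u) := by
  rw [ofReal_bandMoment, moment, ← lintegral_indicator Metric.isClosed_closedBall.measurableSet]
  apply lintegral_congr_ae
  filter_upwards [FT_eq_zero_of_lowPass hu] with ξ h
  by_cases hξ : ‖ξ‖ ≤ N
  · rw [indicator_of_mem (by simpa using hξ)]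
  · rw [indicator_of_notMem (by simpa using hξ), h (not_le.1 hξ)]
    simp

/-- The Laplacian of the projection of `u` has the moments of `u` of an order higher by two. -/
theorem lintegral_FT_cutLap (k : ℕ) (N : ℝ) (u : L2 d) :
    ∫⁻ ξ, ENNReal.ofReal ((2 * Real.pi * ‖ξ‖) ^ k) * ‖FT (cutLap N u) ξ‖ₑ =
      ENNReal.ofReal (bandMoment (k + 2) N u) := by
  rw [ofReal_bandMoment, ← lintegral_indicator Metric.isClosed_closedBall.measurableSet]
  apply lintegral_congr_ae
  filter_upwards [FT_cutMul lapSym N u] with ξ h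
  rw [h, cutSymbol]
  by_cases hξ : ‖ξ‖ ≤ N
  · rw [indicator_of_mem (by simpa using hξ), if_pos hξ, enorm_mul, ← mul_assoc, lapSym_apply,
      ← ofReal_norm, Complex.norm_real, norm_neg, Real.norm_of_nonneg (by positivity),
      ← ENNReal.ofReal_mul (by positivity), pow_add]
  · rw [indicator_of_notMem (by simpa using hξ), if_neg hξ]
    simp

theorem lintegral_FT_cutLap_zero (N : ℝ) (u : L2 d) :
    ∫⁻ ξ, ‖FT (cutLap N u) ξ‖ₑ = ENNReal.ofReal (bandMoment 2 N u) := by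
  simpa using lintegral_FT_cutLap 0 N u

theorem integrable_FT_cutLap (N : ℝ) (u : L2 d) :
    Integrable (FT (cutLap N u) : Space d → ℂ) := by
  refine ⟨Lp.aestronglyMeasurable _, ?_⟩
  rw [HasFiniteIntegral, lintegral_FT_cutLap_zero]
  exact ENNReal.ofReal_lt_top

theorem norm_fourierInv_le (F : Space d → ℂ) (x : Space d) : ‖𝓕⁻ F x‖ ≤ ∫ ξ, ‖F ξ‖ := by
  rw [Real.fourierInv_eq]
  refine (norm_integral_le_integral_norm _).trans (le_of_eq ?_)
  congr 1; ext ξ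
  simp

/-- The second moment bounds `|Δ P_N u|`, which keeps it in the range where `clipExp` is the
exponential. -/
theorem abs_cutLap_le (N : ℝ) (u : L2 d) : ∀ᵐ x, |cutLap N u x| ≤ bandMoment 2 N u := by
  filter_upwards [ae_eq_fourierInv_FT (integrable_FT_cutLap N u)] with x hx
  rw [← Real.norm_eq_abs, ← Complex.norm_real, hx]
  refine (norm_fourierInv_le _ _).trans (le_of_eq ?_)
  rw [integral_norm_eq_lintegral_enorm (Lp.aestronglyMeasurable _), lintegral_FT_cutLap_zero,
    ENNReal.toReal_ofReal (bandMoment_nonneg _ _ _)]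

/-- The superlinear part `e^{-w} - 1 + w` of the nonlinearity, for `w = Δ P_N u`. -/
def nlPart (N : ℝ) (u : L2 d) : L2 d := nem (cutLap N u) + cutLap N u

theorem enorm_FT_nlPart_le {N : ℝ} {u : L2 d} (h : bandMoment 2 N u ≤ 1) :
    ∀ᵐ ξ, ‖FT (nlPart N u) ξ‖ₑ ≤ expMajorant (fun η => ‖FT (cutLap N u) η‖ₑ) ξ := by
  apply enorm_FT_exp_le (integrable_FT_cutLap N u)
  filter_upwards [Lp.coeFn_add (nem (cutLap N u)) (cutLap N u), coeFn_nem (cutLap N u),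
    abs_cutLap_le N u] with x h1 h2 h3
  rw [nlPart, h1, Pi.add_apply, h2, clipExp_of_abs_le (h3.trans h)]

/-- The nonlinearity, measured in the norm of the linear term. -/
theorem bandMoment_four_nlPart_le {N : ℝ} {u : L2 d} (h : bandMoment 2 N u ≤ 1) :
    bandMoment 4 N (nlPart N u) ≤ f2 (bandMoment 2 N u) * bandMoment 6 N u := by
  have hy := bandMoment_nonneg 2 N u
  have hf : 0 ≤ f2 (bandMoment 2 N u) := by
    rw [← f2_zero]
    exact f2_strictMonoOn.monotoneOn self_mem_Ici hy hy
  rw [← ENNReal.ofReal_le_ofReal_iff (mul_nonneg hf (bandMoment_nonneg _ _ _)),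
    ENNReal.ofReal_mul hf]
  refine (ofReal_bandMoment_le _ _ _).trans ?_
  have hc : ∀ ξ : Space d, ENNReal.ofReal ((2 * Real.pi * ‖ξ‖) ^ 4) =
      ENNReal.ofReal ((2 * Real.pi) ^ 4) * ‖ξ‖ₑ ^ 4 := by
    intro ξ
    rw [← ofReal_norm, ← ENNReal.ofReal_pow (norm_nonneg _), ← ENNReal.ofReal_mul (by positivity),
      mul_pow]
  have hm : Measurable (fun η => ‖FT (cutLap N u) η‖ₑ) := (measurable_FT _).enorm
  calc moment 4 (nlPart N u)
      ≤ ∫⁻ ξ, ENNReal.ofReal ((2 * Real.pi * ‖ξ‖) ^ 4) *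
          expMajorant (fun η => ‖FT (cutLap N u) η‖ₑ) ξ := by
        apply lintegral_mono_ae
        filter_upwards [enorm_FT_nlPart_le h] with ξ h1
        exact mul_le_mul' le_rfl h1
    _ = ENNReal.ofReal ((2 * Real.pi) ^ 4) *
          ∫⁻ ξ, ‖ξ‖ₑ ^ 4 * expMajorant (fun η => ‖FT (cutLap N u) η‖ₑ) ξ := by
        simp only [hc]
        simp only [mul_assoc]
        exact lintegral_const_mul _ ((by fun_prop : Measurable fun ξ : Space d => ‖ξ‖ₑ ^ 4).mul
          (measurable_expMajorant hm))
    _ ≤ ENNReal.ofReal ((2 * Real.pi) ^ 4) * (ENNReal.ofReal (f2 (bandMoment 2 N u)) *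
          ∫⁻ ξ, ‖ξ‖ₑ ^ 4 * ‖FT (cutLap N u) ξ‖ₑ) := by
        gcongr
        exact lintegral_norm_pow_four_mul_expMajorant_le hm hy
          (lintegral_FT_cutLap_zero N u).le
    _ = ENNReal.ofReal (f2 (bandMoment 2 N u)) *
          ∫⁻ ξ, ENNReal.ofReal ((2 * Real.pi * ‖ξ‖) ^ 4) * ‖FT (cutLap N u) ξ‖ₑ := by
        simp only [hc]
        simp only [mul_assoc]
        have e := lintegral_const_mul (μ := volume) (ENNReal.ofReal ((2 * Real.pi) ^ 4))
          ((by fun_prop : Measurable fun ξ : Space d => ‖ξ‖ₑ ^ 4).mul hm)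
        simp only [Pi.mul_apply] at e
        rw [e]
        ring
    _ = _ := by rw [lintegral_FT_cutLap]

theorem lowPass_cutLap_eq (N : ℝ) (u : L2 d) : lowPass N (cutLap N u) = cutLap N u :=
  lowPass_cutMul _ le_rfl u

/-- One explicit Euler step. The part `(2π|ξ|)⁴ û` of the vector field is linear and damping, and
the step size is small enough for it not to overshoot. -/
theorem bandMoment_two_euler_le {N h : ℝ} {u : L2 d} (hu : bandMoment 2 N u ≤ 1)
    (h0 : 0 ≤ h) (h1 : h * (2 * Real.pi * N) ^ 4 ≤ 1) :
    bandMoment 2 N (u + h • galerkinField N u) ≤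
      bandMoment 2 N u + h * ((f2 (bandMoment 2 N u) - 1) * bandMoment 6 N u) := by
  have hpt : ∀ᵐ ξ ∂(volume.restrict (Metric.closedBall (0 : Space d) N)),
      (2 * Real.pi * ‖ξ‖) ^ 2 * ‖FT (u + h • galerkinField N u) ξ‖ ≤
      (2 * Real.pi * ‖ξ‖) ^ 2 * ‖FT u ξ‖ - h * ((2 * Real.pi * ‖ξ‖) ^ 6 * ‖FT u ξ‖) +
        h * ((2 * Real.pi * ‖ξ‖) ^ 4 * ‖FT (nlPart N u) ξ‖) := by
    filter_upwards [ae_restrict_mem Metric.isClosed_closedBall.measurableSet,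
      ae_restrict_of_ae (FT_cutMul lapSym N (nem (cutLap N u))),
      ae_restrict_of_ae (FT_cutMul lapSym N u),
      ae_restrict_of_ae (Lp.coeFn_add (FT u) (FT (h • galerkinField N u))),
      ae_restrict_of_ae (Lp.coeFn_smul h (FT (galerkinField N u))),
      ae_restrict_of_ae (Lp.coeFn_add (FT (nem (cutLap N u))) (FT (cutLap N u)))]
      with ξ hξ e1 e2 e3 e4 e5
    rw [mem_closedBall_zero_iff] at hξ
    set r := 2 * Real.pi * ‖ξ‖ with hr
    have hr0 : 0 ≤ r := by positivity
    have hrN : r ≤ 2 * Real.pi * N := by rw [hr]; gcongr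
    rw [FT.map_add, e3, Pi.add_apply, FT.map_smul, e4, Pi.smul_apply, nlPart, FT.map_add, e5,
      Pi.add_apply, e2, galerkinField, e1, cutSymbol, if_pos hξ, lapSym_apply, ← hr]
    set z := FT u ξ
    set n := FT (nem (cutLap N u)) ξ
    have hh : h * r ^ 4 ≤ 1 := by
      refine le_trans ?_ h1
      gcongr
    -- the linear part of the step is `(1 - h r⁴) z`, with a nonnegative factor
    have e : z + h • (((-r ^ 2 : ℝ) : ℂ) * n) = ((1 - h * r ^ 4 : ℝ) : ℂ) * z +
        ((h * -r ^ 2 : ℝ) : ℂ) * (n + ((-r ^ 2 : ℝ) : ℂ) * z) := by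
      rw [Complex.real_smul]
      push_cast
      ring
    rw [e]
    have h2 := norm_add_le (((1 - h * r ^ 4 : ℝ) : ℂ) * z)
      (((h * -r ^ 2 : ℝ) : ℂ) * (n + ((-r ^ 2 : ℝ) : ℂ) * z))
    rw [norm_mul, norm_mul, Complex.norm_real, Complex.norm_real,
      Real.norm_of_nonneg (by linarith : 0 ≤ 1 - h * r ^ 4), mul_neg, norm_neg,
      Real.norm_of_nonneg (by positivity : 0 ≤ h * r ^ 2)] at h2
    have h3 := mul_le_mul_of_nonneg_left h2 (by positivity : 0 ≤ r ^ 2)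
    rw [mul_neg]
    refine h3.trans (le_of_eq ?_)
    ring
  have i1 := integrableOn_moment 2 N u
  have i2 := integrableOn_moment 6 N u
  have i3 := integrableOn_moment 4 N (nlPart N u)
  have h2 := integral_mono_ae (integrableOn_moment 2 N (u + h • galerkinField N u))
    ((i1.sub (i2.const_mul h)).add (i3.const_mul h)) hpt
  have e1 : ∫ ξ in Metric.closedBall (0 : Space d) N,
      ((2 * Real.pi * ‖ξ‖) ^ 2 * ‖FT u ξ‖ - h * ((2 * Real.pi * ‖ξ‖) ^ 6 * ‖FT u ξ‖) +
        h * ((2 * Real.pi * ‖ξ‖) ^ 4 * ‖FT (nlPart N u) ξ‖)) =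
      bandMoment 2 N u - h * bandMoment 6 N u + h * bandMoment 4 N (nlPart N u) := by
    refine (integral_add (i1.sub (i2.const_mul h)) (i3.const_mul h)).trans ?_
    refine congrArg₂ (· + ·) ((integral_sub i1 (i2.const_mul h)).trans ?_) (integral_const_mul _ _)
    exact congrArg₂ (· - ·) rfl (integral_const_mul _ _)
  have h3 := bandMoment_four_nlPart_le hu
  calc bandMoment 2 N (u + h • galerkinField N u) ≤ _ := h2
    _ = _ := e1
    _ ≤ bandMoment 2 N u - h * bandMoment 6 N u +
        h * (f2 (bandMoment 2 N u) * bandMoment 6 N u) := by gcongr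
    _ = _ := by ring

/-! ### A priori estimates for the Galerkin flow -/

/-- An upper bound for the right Dini derivative of a Lipschitz functional `S` along a
differentiable curve, from a bound for `S` along the tangent. -/
theorem eventually_slope_lt {E : Type*} [NormedAddCommGroup E] [NormedSpace ℝ E] {S : E → ℝ}
    {C : ℝ} (hC : 0 ≤ C) (hS : ∀ x y, S x ≤ S y + C * ‖x - y‖) {v : ℝ → E} {v' : E} {t q δ : ℝ}
    (hv : HasDerivAt v v' t) (hδ : 0 < δ)
    (hq : ∀ h, 0 ≤ h → h ≤ δ → S (v t + h • v') ≤ S (v t) + h * q) {r : ℝ} (hr : q < r) :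
    ∀ᶠ z in 𝓝[>] t, slope (fun s => S (v s)) t z < r := by
  set ε := (r - q) / (2 * (C + 1)) with hε
  have hε0 : 0 < ε := by
    have : 0 < r - q := by linarith
    positivity
  have h1 : ∀ᶠ z in 𝓝 t, ‖v z - v t - (z - t) • v'‖ ≤ ε * ‖z - t‖ :=
    hv.isLittleO.def hε0
  have h2 : ∀ᶠ z in 𝓝[>] t, z ∈ Ioc t (t + δ) := Ioc_mem_nhdsGT (by linarith)
  filter_upwards [h1.filter_mono nhdsWithin_le_nhds, h2] with z hz hzt
  have hpos : 0 < z - t := sub_pos.2 hzt.1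
  rw [slope_def_field, div_lt_iff₀ hpos]
  have h3 := hS (v z) (v t + (z - t) • v')
  have h4 := hq (z - t) hpos.le (by linarith [hzt.2])
  rw [Real.norm_of_nonneg hpos.le] at hz
  rw [← sub_sub] at h3
  have h5 : C * ‖v z - v t - (z - t) • v'‖ ≤ C * (ε * (z - t)) := by gcongr
  have h6 : C * ε < r - q := by
    rw [hε]
    have : 0 < r - q := by linarith
    rw [← mul_div_assoc, div_lt_iff₀ (by positivity)]
    nlinarith
  nlinarith

theorem bandMoment_le_add_mul (k : ℕ) {N C : ℝ} (hC : ∀ u : L2 d, bandMoment k N u ≤ C * ‖u‖)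
    (u v : L2 d) : bandMoment k N u ≤ bandMoment k N v + C * ‖u - v‖ :=
  (bandMoment_le_add k N u v).trans (by gcongr; exact hC _)

/-- Along the Galerkin flow, `‖u‖₂` has the right Dini derivative at most
`(f₂(‖u‖₂) - 1) ‖u‖₆`. -/
theorem slope_bandMoment_lt {N : ℝ} (hN : 0 ≤ N) (a : L2 d) {t r : ℝ} (ht : 0 ≤ t)
    (hu : bandMoment 2 N (galerkin N a t) ≤ 1)
    (hr : (f2 (bandMoment 2 N (galerkin N a t)) - 1) * bandMoment 6 N (galerkin N a t) < r) :
    ∀ᶠ z in 𝓝[>] t, slope (fun s => bandMoment 2 N (galerkin N a s)) t z < r := by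
  obtain ⟨C, hC, h⟩ := exists_bandMoment_le d 2 hN
  have hδ : 0 < 1 / ((2 * Real.pi * N) ^ 4 + 1) := by positivity
  refine eventually_slope_lt hC (bandMoment_le_add_mul 2 h) (hasDerivAt_galerkin N a ht) hδ
    (fun s hs hs' => bandMoment_two_euler_le hu hs ?_) hr
  rw [le_div_iff₀ (by positivity)] at hs'
  nlinarith

/-- If `‖u‖₂` starts below the zero `y` of `1 - f₂`, then it never exceeds its initial value. -/
theorem bandMoment_galerkin_le {N : ℝ} (hN : 0 ≤ N) (a : L2 d) {y : ℝ} (hy1 : y ≤ 1)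
    (hy : f2 y = 1) (ha : bandMoment 2 N (lowPass N a) < y) {t : ℝ} (ht : 0 ≤ t) :
    bandMoment 2 N (galerkin N a t) ≤ bandMoment 2 N (lowPass N a) := by
  set y0 := bandMoment 2 N (lowPass N a) with hy0
  have hcont : Continuous fun s => bandMoment 2 N (galerkin N a s) :=
    (continuous_bandMoment 2 hN).comp (continuous_galerkin N a)
  obtain ⟨C, hC, hCb⟩ := exists_bandMoment_le d 2 hN
  -- the barrier `y0 + ε s` is steeper than the flow at a time of contact, as `f₂ < 1` there
  have key : ∀ ε : ℝ, 0 < ε → y0 + ε * t < y → bandMoment 2 N (galerkin N a t) ≤ y0 + ε * t := by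
    intro ε hε hεt
    refine image_le_of_liminf_slope_right_lt_deriv_boundary' (a := 0) (b := t)
      (f := fun s => bandMoment 2 N (galerkin N a s))
      -- the Dini bound with `f₂` holds only for moments at most `1`; elsewhere any bound will do
      (f' := fun s => if bandMoment 2 N (galerkin N a s) ≤ 1 then
        (f2 (bandMoment 2 N (galerkin N a s)) - 1) * bandMoment 6 N (galerkin N a s) else
        C * ‖galerkinField N (galerkin N a s)‖) (B := fun s => y0 + ε * s) (B' := fun _ => ε)
      hcont.continuousOn ?_ ?_ (by fun_prop) ?_ ?_ ⟨ht, le_rfl⟩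
    · intro x hx r hr
      refine Eventually.frequently ?_
      split_ifs at hr with h
      · exact slope_bandMoment_lt hN a hx.1 h hr
      · refine eventually_slope_lt hC (bandMoment_le_add_mul 2 hCb) (hasDerivAt_galerkin N a hx.1)
          one_pos (fun s hs _ => ?_) hr
        refine (bandMoment_le_add_mul 2 hCb _ (galerkin N a x)).trans (le_of_eq ?_)
        rw [add_sub_cancel_left, norm_smul, Real.norm_of_nonneg hs]
        ring
    · simp [galerkin_zero, hy0]
    · intro x hx
      have := (((hasDerivAt_id x).const_mul ε).const_add y0).hasDerivWithinAt (s := Ici x)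
      simpa using this
    · intro x hx hfx
      have hlt : bandMoment 2 N (galerkin N a x) < y := by
        rw [hfx]
        refine lt_of_le_of_lt ?_ hεt
        have := hx.2.le
        gcongr
      rw [if_pos (hlt.le.trans hy1)]
      have hf : f2 (bandMoment 2 N (galerkin N a x)) < 1 := by
        rw [← hy]
        exact f2_strictMonoOn (bandMoment_nonneg _ _ _) ((bandMoment_nonneg _ _ _).trans hlt.le) hlt
      have := bandMoment_nonneg 6 N (galerkin N a x)
      nlinarith
  by_contra hlt
  push Not at hlt
  set m := min (bandMoment 2 N (galerkin N a t)) y with hm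
  have hm0 : 0 < m - y0 := by
    rw [hm]
    have := lt_min hlt ha
    linarith
  have hε : 0 < (m - y0) / (2 * (t + 1)) := by positivity
  have h1 : (m - y0) / (2 * (t + 1)) * t < m - y0 := by
    rw [div_mul_eq_mul_div, div_lt_iff₀ (by positivity)]
    nlinarith
  have h2 := key _ hε (by linarith [min_le_right (bandMoment 2 N (galerkin N a t)) y])
  linarith [min_le_left (bandMoment 2 N (galerkin N a t)) y]

/-- The decay estimate for the Galerkin solutions. -/
theorem bandMoment_galerkin_add_le {N : ℝ} (hN : 0 ≤ N) (a : L2 d) {y A : ℝ} (hy1 : y ≤ 1)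
    (hy : f2 y = 1) (hA : A < y) (ha : bandMoment 2 N (lowPass N a) ≤ A) {t : ℝ} (ht : 0 ≤ t) :
    bandMoment 2 N (galerkin N a t) +
      (1 - f2 A) * ∫ s in (0 : ℝ)..t, bandMoment 6 N (galerkin N a s) ≤
      bandMoment 2 N (lowPass N a) := by
  have hcont : Continuous fun s => bandMoment 2 N (galerkin N a s) :=
    (continuous_bandMoment 2 hN).comp (continuous_galerkin N a)
  have hcont6 : Continuous fun s => bandMoment 6 N (galerkin N a s) :=
    (continuous_bandMoment 6 hN).comp (continuous_galerkin N a)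
  have hd : ∀ x, HasDerivAt (fun t => bandMoment 2 N (lowPass N a) -
      (1 - f2 A) * ∫ s in (0 : ℝ)..t, bandMoment 6 N (galerkin N a s))
      (-((1 - f2 A) * bandMoment 6 N (galerkin N a x))) x := by
    intro x
    exact ((intervalIntegral.integral_hasDerivAt_right (hcont6.intervalIntegrable _ _)
      (hcont6.stronglyMeasurableAtFilter _ _) hcont6.continuousAt).const_mul _).const_sub _
  have := image_le_of_liminf_slope_right_le_deriv_boundary (a := 0) (b := t)
      (f := fun s => bandMoment 2 N (galerkin N a s))
      (B := fun t => bandMoment 2 N (lowPass N a) -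
        (1 - f2 A) * ∫ s in (0 : ℝ)..t, bandMoment 6 N (galerkin N a s))
      (B' := fun x => -((1 - f2 A) * bandMoment 6 N (galerkin N a x)))
      hcont.continuousOn (by simp [galerkin_zero])
      (fun x _ => (hd x).continuousAt.continuousWithinAt) (fun x _ => (hd x).hasDerivWithinAt)
      (fun x hx r hr => by
        have h1 := bandMoment_galerkin_le hN a hy1 hy (ha.trans_lt hA) hx.1
        refine Eventually.frequently (slope_bandMoment_lt hN a hx.1
          (h1.trans ((ha.trans hA.le).trans hy1)) (lt_of_le_of_lt ?_ hr))
        have h2 : f2 (bandMoment 2 N (galerkin N a x)) ≤ f2 A :=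
          f2_strictMonoOn.monotoneOn (bandMoment_nonneg _ _ _)
            ((bandMoment_nonneg _ _ _).trans ha) (h1.trans ha)
        have := bandMoment_nonneg 6 N (galerkin N a x)
        nlinarith) ⟨ht, le_rfl⟩
  linarith

theorem continuous_norm_sq_cutMul_galerkin (p q : C(ℝ, ℝ)) (N : ℝ) (a : L2 d) :
    Continuous fun t => ‖cutMul p N (cutMul q N (galerkin N a t))‖ ^ 2 :=
  (((cutMul p N).continuous.comp
    ((cutMul q N).continuous.comp (continuous_galerkin N a))).norm).pow 2

/-- The `L²` energy estimate. -/
theorem integral_norm_sq_cutLap_le (N : ℝ) (a : L2 d)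
    (hu : ∀ t, 0 ≤ t → bandMoment 2 N (galerkin N a t) ≤ 1) {t : ℝ} (ht : 0 ≤ t) :
    2 * Real.exp (-1) * ∫ s in (0 : ℝ)..t, ‖cutLap N (galerkin N a s)‖ ^ 2 ≤ ‖a‖ ^ 2 := by
  have h := norm_sq_le_of_inner_le (v := galerkin N a)
    (g := fun s => -Real.exp (-1) * ‖cutLap N (galerkin N a s)‖ ^ 2)
    (fun s hs => hasDerivAt_galerkin N a hs)
    (continuous_const.mul
      ((((cutLap (d := d) N).continuous.comp (continuous_galerkin N a)).norm).pow 2))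
    (fun s hs => by
      rw [real_inner_comm, inner_galerkinField, real_inner_comm]
      apply inner_nem_le
      filter_upwards [abs_cutLap_le N (galerkin N a s)] with x hx
      exact hx.trans (hu s hs)) ht
  rw [intervalIntegral.integral_const_mul, galerkin_zero] at h
  have h2 : ‖lowPass N a‖ ^ 2 ≤ ‖a‖ ^ 2 := by
    gcongr
    exact norm_lowPass_le N a
  nlinarith [sq_nonneg ‖galerkin N a t‖]

theorem ofReal_norm_sq (u : L2 d) : ENNReal.ofReal (‖u‖ ^ 2) = ∫⁻ ξ, ‖FT u ξ‖ₑ ^ 2 := by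
  rw [← FT.norm_map u, ENNReal.ofReal_pow (norm_nonneg _), ofReal_norm, Lp.enorm_def,
    eLpNorm_eq_lintegral_rpow_enorm_toReal (by norm_num) (by norm_num), ← ENNReal.rpow_natCast,
    ← ENNReal.rpow_mul]
  norm_num

/-- The nonlinearity acts on the homogeneous Sobolev space `Ḣ¹`. -/
theorem lintegral_norm_mul_FT_nlPart_sq_le {N : ℝ} {u : L2 d} (h : bandMoment 2 N u ≤ 1 / 4) :
    ∫⁻ ξ, (‖ξ‖ₑ * ‖FT (nlPart N u) ξ‖ₑ) ^ 2 ≤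
      ENNReal.ofReal (1 / 4 * ‖cutGrad N (cutLap N u)‖ ^ 2) := by
  have hy := bandMoment_nonneg 2 N u
  have hm : Measurable (fun η => ‖FT (cutLap N u) η‖ₑ) := (measurable_FT _).enorm
  -- the nonlinear part is at most half of the linear one in `Ḣ¹`
  have hexp : Real.exp (bandMoment 2 N u) - 1 ≤ 1 / 2 := by
    have h1 : Real.exp (bandMoment 2 N u) ≤ Real.exp (1 / 4) := Real.exp_le_exp.2 h
    have h2 := Real.exp_bound' (x := 1 / 4) (by norm_num) (by norm_num) (n := 2) (by norm_num)
    norm_num [Finset.sum_range_succ, Nat.factorial] at h2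
    linarith
  have h1 : ∫⁻ ξ, (‖ξ‖ₑ * ‖FT (nlPart N u) ξ‖ₑ) ^ 2 ≤
      ∫⁻ ξ, (‖ξ‖ₑ * expMajorant (fun η => ‖FT (cutLap N u) η‖ₑ) ξ) ^ 2 := by
    apply lintegral_mono_ae
    filter_upwards [enorm_FT_nlPart_le (h.trans (by norm_num))] with ξ h2
    gcongr
  have h2 : ∫⁻ ξ, (‖ξ‖ₑ * ‖FT (cutLap N u) ξ‖ₑ) ^ 2 =
      ENNReal.ofReal (‖cutGrad N (cutLap N u)‖ ^ 2) := by
    rw [ofReal_norm_sq]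
    apply lintegral_congr_ae
    filter_upwards [FT_cutMul (ContinuousMap.id ℝ) N (cutLap N u),
      FT_eq_zero_of_lowPass (lowPass_cutLap_eq N u)] with ξ h3 h4
    rw [h3, cutSymbol]
    split_ifs with h5
    · rw [enorm_mul, ContinuousMap.id_apply, ← ofReal_norm ((‖ξ‖ : ℝ) : ℂ), Complex.norm_real,
        norm_norm, ofReal_norm]
    · rw [h4 (not_le.1 h5)]
      simp
  refine h1.trans ((lintegral_norm_mul_expMajorant_sq_le hm hy
    (lintegral_FT_cutLap_zero N u).le).trans ?_)
  rw [h2, ← ENNReal.ofReal_pow (by linarith [Real.one_le_exp hy]),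
      ← ENNReal.ofReal_mul (by positivity)]
  apply ENNReal.ofReal_le_ofReal
  have h5 : 0 ≤ Real.exp (bandMoment 2 N u) - 1 := by linarith [Real.one_le_exp hy]
  gcongr
  nlinarith

theorem norm_cutGrad_nlPart_le {N : ℝ} {u : L2 d} (h : bandMoment 2 N u ≤ 1 / 4) :
    ‖cutGrad N (nlPart N u)‖ ≤ 1 / 2 * ‖cutGrad N (cutLap N u)‖ := by
  rw [← pow_le_pow_iff_left₀ (norm_nonneg _) (by positivity) two_ne_zero,
    ← ENNReal.ofReal_le_ofReal_iff (by positivity), ofReal_norm_sq]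
  refine le_trans ?_ ((lintegral_norm_mul_FT_nlPart_sq_le h).trans (le_of_eq ?_))
  · apply lintegral_mono_ae
    filter_upwards [FT_cutMul (ContinuousMap.id ℝ) N (nlPart N u)] with ξ h3
    rw [h3, cutSymbol, enorm_mul]
    gcongr
    split_ifs with h5
    · rw [ContinuousMap.id_apply, ← ofReal_norm ((‖ξ‖ : ℝ) : ℂ), Complex.norm_real,
        norm_norm, ofReal_norm]
    · simp
  · congr 1
    ring

/-- High frequencies of the nonlinearity are small if `w ∈ Ḣ¹`. -/
theorem norm_nem_sub_lowPass_le {N : ℝ} (hN : 0 < N) {u : L2 d} (h : bandMoment 2 N u ≤ 1 / 4) :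
    ‖nem (cutLap N u) - lowPass N (nem (cutLap N u))‖ ≤
      N⁻¹ * ‖cutGrad N (cutLap N u)‖ := by
  have e1 : nem (cutLap N u) - lowPass N (nem (cutLap N u)) =
      nlPart N u - lowPass N (nlPart N u) := by
    rw [nlPart, map_add, lowPass_cutLap_eq]
    abel
  rw [e1, ← pow_le_pow_iff_left₀ (norm_nonneg _) (by positivity) two_ne_zero,
    ← ENNReal.ofReal_le_ofReal_iff (by positivity), ofReal_norm_sq, mul_pow,
    ENNReal.ofReal_mul (by positivity)]
  calc ∫⁻ ξ, ‖FT (nlPart N u - lowPass N (nlPart N u)) ξ‖ₑ ^ 2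
      ≤ ∫⁻ ξ, ENNReal.ofReal (N⁻¹ ^ 2) * (‖ξ‖ₑ * ‖FT (nlPart N u) ξ‖ₑ) ^ 2 := by
        apply lintegral_mono_ae
        rw [FT.map_sub]
        filter_upwards [FT_cutMul 1 N (nlPart N u),
          Lp.coeFn_sub (FT (nlPart N u)) (FT (lowPass N (nlPart N u)))] with ξ h1 h2
        rw [h2, Pi.sub_apply, h1, cutSymbol]
        split_ifs with h3
        · simp
        · rw [Complex.ofReal_zero, zero_mul, sub_zero, ENNReal.ofReal_pow (by positivity),
            ← mul_pow, ← mul_assoc]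
          gcongr
          refine le_mul_of_one_le_left (zero_le) ?_
          rw [← ofReal_norm ξ, ← ENNReal.ofReal_mul (by positivity), ENNReal.one_le_ofReal,
            inv_mul_eq_div, one_le_div hN]
          exact (not_le.1 h3).le
    _ = ENNReal.ofReal (N⁻¹ ^ 2) * ∫⁻ ξ, (‖ξ‖ₑ * ‖FT (nlPart N u) ξ‖ₑ) ^ 2 := by
        have hm : Measurable fun ξ => ‖FT (nlPart N u) ξ‖ₑ := (measurable_FT _).enorm
        exact lintegral_const_mul _ ((measurable_enorm.mul hm).pow_const 2)
    _ ≤ ENNReal.ofReal (N⁻¹ ^ 2) * ENNReal.ofReal (‖cutGrad N (cutLap N u)‖ ^ 2) := by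
        refine mul_le_mul' le_rfl ((lintegral_norm_mul_FT_nlPart_sq_le h).trans ?_)
        apply ENNReal.ofReal_le_ofReal
        nlinarith [sq_nonneg ‖cutGrad N (cutLap N u)‖]

theorem norm_sub_lowPass_le_cutGrad {N M : ℝ} (hN : 0 < N) (w : L2 d)
    (hw : lowPass M w = w) : ‖w - lowPass N w‖ ≤ N⁻¹ * ‖cutGrad M w‖ := by
  rw [← pow_le_pow_iff_left₀ (norm_nonneg _) (by positivity) two_ne_zero,
    ← ENNReal.ofReal_le_ofReal_iff (by positivity), ofReal_norm_sq, mul_pow,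
    ENNReal.ofReal_mul (by positivity), ofReal_norm_sq,
    ← lintegral_const_mul _ ((measurable_FT _).enorm.pow_const 2)]
  apply lintegral_mono_ae
  rw [FT.map_sub]
  filter_upwards [FT_cutMul 1 N w, Lp.coeFn_sub (FT w) (FT (lowPass N w)),
    FT_cutMul (ContinuousMap.id ℝ) M w, FT_eq_zero_of_lowPass hw] with ξ h1 h2 h4 h5
  rw [h2, Pi.sub_apply, h1, h4, cutSymbol, cutSymbol]
  split_ifs with h3 h6 h6
  · simp
  · simp
  · rw [Complex.ofReal_zero, zero_mul, sub_zero, ENNReal.ofReal_pow (by positivity),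
      ← mul_pow, enorm_mul, ← mul_assoc]
    gcongr
    refine le_mul_of_one_le_left (zero_le) ?_
    rw [ContinuousMap.id_apply, ← ofReal_norm ((‖ξ‖ : ℝ) : ℂ), Complex.norm_real, norm_norm,
      ← ENNReal.ofReal_mul (by positivity), ENNReal.one_le_ofReal, inv_mul_eq_div, one_le_div hN]
    exact (not_le.1 h3).le
  · rw [h5 (not_le.1 h6)]
    simp

/-- The `Ḣ¹` energy estimate. -/
theorem integral_norm_sq_cutGrad_le (N : ℝ) (a : L2 d)
    (hu : ∀ t, 0 ≤ t → bandMoment 2 N (galerkin N a t) ≤ 1 / 4) {t : ℝ} (ht : 0 ≤ t) :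
    ∫ s in (0 : ℝ)..t, ‖cutGrad N (cutLap N (galerkin N a s))‖ ^ 2 ≤ ‖cutGrad N a‖ ^ 2 := by
  have h := norm_sq_le_of_inner_le (v := fun s => cutGrad N (galerkin N a s))
    (g := fun s => -(1 / 2) * ‖cutGrad N (cutLap N (galerkin N a s))‖ ^ 2)
    (fun s hs => (cutGrad (d := d) N).hasFDerivAt.comp_hasDerivAt s (hasDerivAt_galerkin N a hs))
    (continuous_const.mul (continuous_norm_sq_cutMul_galerkin _ _ N a))
    (fun s hs => by
      set u := galerkin N a s
      have e : nem (cutLap N u) = nlPart N u - cutLap N u := by rw [nlPart]; abel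
      rw [galerkinField, cutMul_comm _ lapSym, ← inner_cutMul_left, cutMul_comm lapSym, e, map_sub,
        inner_sub_right, real_inner_self_eq_norm_sq]
      have h1 := real_inner_le_norm (cutGrad N (cutLap N u)) (cutGrad N (nlPart N u))
      have h2 := norm_cutGrad_nlPart_le (hu s hs)
      nlinarith [norm_nonneg (cutGrad N (cutLap N u))]) ht
  simp only [intervalIntegral.integral_const_mul, galerkin_zero] at h
  rw [cutMul_cutMul, mul_one, min_self] at h
  nlinarith [sq_nonneg ‖cutGrad N (galerkin N a t)‖]

/-- Comparison of two Galerkin solutions with the same band-limited initial value. -/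
theorem norm_sq_galerkin_sub_le {K N M : ℝ} (hN : 0 < N) (hKN : K ≤ N) (hNM : N ≤ M) (b : L2 d)
    (huN : ∀ t, 0 ≤ t → bandMoment 2 N (galerkin N (lowPass K b) t) ≤ 1 / 4)
    (huM : ∀ t, 0 ≤ t → bandMoment 2 M (galerkin M (lowPass K b) t) ≤ 1 / 4) {t : ℝ} (ht : 0 ≤ t) :
    ‖galerkin N (lowPass K b) t - galerkin M (lowPass K b) t‖ ^ 2 ≤
      2 * (N⁻¹ * ‖cutGrad K b‖) ^ 2 := by
  set a := lowPass K b with ha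
  set gN := fun s => ‖cutGrad N (cutLap N (galerkin N a s))‖ ^ 2 with hgN
  set gM := fun s => ‖cutGrad M (cutLap M (galerkin M a s))‖ ^ 2 with hgM
  have cN : Continuous gN := continuous_norm_sq_cutMul_galerkin _ _ N a
  have cM : Continuous gM := continuous_norm_sq_cutMul_galerkin _ _ M a
  have h := norm_sq_le_of_inner_le (v := fun s => galerkin N a s - galerkin M a s)
    (g := fun s => N⁻¹ ^ 2 / 2 * (gN s + gM s))
    (fun s hs => (hasDerivAt_galerkin N a hs).sub (hasDerivAt_galerkin M a hs))
    (continuous_const.mul (cN.add cM))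
    (fun s hs => by
      have eN : galerkin N a s = lowPass N (galerkin N a s) := (lowPass_galerkin le_rfl a hs).symm
      have hNs := huN s hs
      set u := galerkin N a s with hu
      set v := galerkin M a s with hv
      have e1 : cutLap N v = lowPass N (cutLap M v) := by
        rw [cutMul_cutMul, one_mul, min_eq_left hNM]
      have e2 : cutLap M u = cutLap N u := by
        conv_lhs => rw [eN]
        rw [cutMul_cutMul, mul_one, min_eq_right hNM]
      rw [real_inner_comm, inner_sub_left, inner_galerkinField, inner_galerkinField, map_sub,
          map_sub,
        e1, e2]
      set wN := cutLap N u
      set wM := cutLap M v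
      have h1 := inner_nem_sub_nonpos wN wM
      -- only frequencies above `N` of `nem wN` see those of `wM`
      have h2 : inner ℝ (lowPass N (nem wN)) (wM - lowPass N wM) = (0 : ℝ) := by
        rw [inner_cutMul_left, map_sub, lowPass_cutMul _ le_rfl, sub_self, inner_zero_right]
      have h3 := real_inner_le_norm (nem wN - lowPass N (nem wN)) (wM - lowPass N wM)
      have h4 : ‖nem wN - lowPass N (nem wN)‖ ≤ N⁻¹ * ‖cutGrad N wN‖ :=
        norm_nem_sub_lowPass_le hN hNs
      have h5 : ‖wM - lowPass N wM‖ ≤ N⁻¹ * ‖cutGrad M wM‖ :=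
        norm_sub_lowPass_le_cutGrad hN wM (lowPass_cutLap_eq M v)
      have h6 : ‖nem wN - lowPass N (nem wN)‖ * ‖wM - lowPass N wM‖ ≤
          (N⁻¹ * ‖cutGrad N wN‖) * (N⁻¹ * ‖cutGrad M wM‖) := by gcongr
      have h7 : (N⁻¹ * ‖cutGrad N wN‖) * (N⁻¹ * ‖cutGrad M wM‖) ≤
          N⁻¹ ^ 2 / 2 * (‖cutGrad N wN‖ ^ 2 + ‖cutGrad M wM‖ ^ 2) := by
        nlinarith [sq_nonneg (‖cutGrad N wN‖ - ‖cutGrad M wM‖), sq_nonneg N⁻¹]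
      -- the first term on the right is nonpositive by monotonicity
      have h8 : inner ℝ (nem wN) (wN - lowPass N wM) - inner ℝ (nem wM) (wN - wM) =
          inner ℝ (nem wN - nem wM) (wN - wM) +
            inner ℝ (nem wN - lowPass N (nem wN)) (wM - lowPass N wM) := by
        rw [inner_sub_left (nem wN) (lowPass N (nem wN)), h2]
        simp only [inner_sub_left, inner_sub_right]
        ring
      rw [h8]
      exact (add_le_add h1 (h3.trans (h6.trans h7))).trans (le_of_eq (zero_add _))) ht
  have e0 : galerkin N a 0 - galerkin M a 0 = 0 := by
    rw [galerkin_zero, galerkin_zero, ha, lowPass_cutMul _ hKN, lowPass_cutMul _ (hKN.trans hNM),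
      sub_self]
  have iN := integral_norm_sq_cutGrad_le N a huN ht
  have iM := integral_norm_sq_cutGrad_le M a huM ht
  have g1 : cutGrad N a = cutGrad K b := by
    rw [ha, cutMul_cutMul, mul_one, min_eq_right hKN]
  have g2 : cutGrad M a = cutGrad K b := by
    rw [ha, cutMul_cutMul, mul_one, min_eq_right (hKN.trans hNM)]
  rw [g1] at iN
  rw [g2] at iM
  simp only [e0, norm_zero] at h
  rw [intervalIntegral.integral_const_mul, intervalIntegral.integral_add (cN.intervalIntegrable _ _)
    (cM.intervalIntegrable _ _)] at h
  refine h.trans ?_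
  have : N⁻¹ ^ 2 * ((∫ s in (0 : ℝ)..t, gN s) + ∫ s in (0 : ℝ)..t, gM s) ≤
      N⁻¹ ^ 2 * (‖cutGrad K b‖ ^ 2 + ‖cutGrad K b‖ ^ 2) := by gcongr
  nlinarith

/-! ### Moments, low-pass approximation and test functions -/

/-- The `s`-norm is a dimensional constant times the moment of order `s`. -/
theorem sNorm_eq (k : ℕ) (u : L2 d) :
    sNorm k u = ENNReal.ofReal ((2 * Real.pi) ^ ((d : ℝ) / 2)) * moment k u := by
  have hpi : (0 : ℝ) < 2 * Real.pi := by positivity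
  set c : ℝ := (2 * Real.pi) ^ (-(d : ℝ) / 2)
  have hc : 0 ≤ c := by positivity
  set G : Space d → ℝ≥0∞ := fun η => ENNReal.ofReal c *
    (ENNReal.ofReal ((2 * Real.pi * ‖η‖) ^ k) * ‖FT u η‖ₑ)
  have hG : Measurable G := by
    have := measurable_FT u
    fun_prop
  have h1 : sNorm k u = ∫⁻ ξ : Space d, G ((2 * Real.pi)⁻¹ • ξ) := by
    unfold sNorm
    congr 1; ext ξ
    simp only [G]
    rw [fhat, enorm_mul, ← FT_apply, norm_smul, Real.norm_of_nonneg (by positivity : (0:ℝ) ≤ (2 *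
        Real.pi)⁻¹),
      mul_inv_cancel_left₀ hpi.ne', ENNReal.rpow_natCast, ENNReal.ofReal_pow (norm_nonneg _),
          ofReal_norm,
      mul_left_comm, ← ofReal_norm (_ : ℂ), Complex.norm_real, Real.norm_of_nonneg hc]
  have h2 := lintegral_map (μ := (volume : Measure (Space d))) hG
    (measurable_const_smul ((2 * Real.pi)⁻¹))
  rw [Measure.map_addHaar_smul _ (inv_ne_zero hpi.ne'), lintegral_smul_measure] at h2
  rw [h1, ← h2]
  simp only [G]
  have hm : Measurable fun η : Space d => ENNReal.ofReal ((2 * Real.pi * ‖η‖) ^ k) * ‖FT u η‖ₑ := by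
    have := measurable_FT u
    fun_prop
  rw [lintegral_const_mul _ hm, smul_eq_mul, ← mul_assoc, ← ENNReal.ofReal_mul (by positivity),
      moment]
  congr 2
  rw [inv_pow, inv_inv, abs_of_pos (by positivity), finrank_euclideanSpace_fin, ← Real.rpow_natCast,
    ← Real.rpow_add hpi]
  congr 1; ring

theorem one_le_two_pi_rpow (d : ℕ) : (1 : ℝ) ≤ (2 * Real.pi) ^ ((d : ℝ) / 2) :=
  Real.one_le_rpow (by linarith [Real.pi_gt_three]) (by positivity)

theorem moment_le_sNorm (k : ℕ) (u : L2 d) : moment k u ≤ sNorm k u := by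
  rw [sNorm_eq]
  refine le_mul_of_one_le_left' ?_
  rw [← ENNReal.ofReal_one]
  exact ENNReal.ofReal_le_ofReal (one_le_two_pi_rpow d)

theorem bandMoment_mono (k : ℕ) {N M : ℝ} (h : N ≤ M) (u : L2 d) :
    bandMoment k N u ≤ bandMoment k M u :=
  setIntegral_mono_set (integrableOn_moment k M u)
    (by filter_upwards with ξ; simp only [Pi.zero_apply]; positivity)
    (Metric.closedBall_subset_closedBall h).eventuallyLE

theorem bandMoment_le_toReal_moment (k : ℕ) (N : ℝ) {u : L2 d} (hu : moment k u ≠ ⊤) :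
    bandMoment k N u ≤ (moment k u).toReal :=
  (ENNReal.ofReal_le_iff_le_toReal hu).1 (ofReal_bandMoment_le k N u)

theorem bandMoment_lowPass_le (k : ℕ) (N M : ℝ) (u : L2 d) :
    bandMoment k N (lowPass M u) ≤ bandMoment k N u := by
  unfold bandMoment
  apply integral_mono_ae (integrableOn_moment k N _) (integrableOn_moment k N _)
  filter_upwards [ae_restrict_of_ae (FT_cutMul 1 M u)] with ξ h
  rw [h]
  refine mul_le_mul_of_nonneg_left ?_ (by positivity)
  rw [norm_mul, cutSymbol]
  split_ifs <;> simp

/-- The moment is the monotone limit of its parts which come from balls. -/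
theorem moment_eq_iSup (k : ℕ) (u : L2 d) :
    moment k u = ⨆ n : ℕ, ENNReal.ofReal (bandMoment k n u) := by
  simp_rw [ofReal_bandMoment]
  have h : (⋃ n : ℕ, Metric.closedBall (0 : Space d) n) = univ :=
    Metric.iUnion_closedBall_nat 0
  rw [moment, ← setLIntegral_univ, ← h, setLIntegral_iUnion_of_directed]
  exact Monotone.directed_le fun n m h => Metric.closedBall_subset_closedBall (Nat.cast_le.2 h)

theorem tendsto_lowPass (u : L2 d) : Tendsto (fun n : ℕ => lowPass (n : ℝ) u) atTop (𝓝 u) := by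
  rw [tendsto_iff_norm_sub_tendsto_zero]
  have h : Tendsto (fun n : ℕ => ∫⁻ ξ, ‖FT (lowPass (n : ℝ) u - u) ξ‖ₑ ^ 2) atTop (𝓝 0) := by
    have h0 : (0 : ℝ≥0∞) = ∫⁻ _ : Space d, 0 := by simp
    rw [h0]
    have hb (n : ℕ) : ∀ᵐ ξ, FT (lowPass (n : ℝ) u - u) ξ = if ‖ξ‖ ≤ n then 0 else - FT u ξ := by
      rw [FT.map_sub]
      filter_upwards [Lp.coeFn_sub (FT (lowPass (n : ℝ) u)) (FT u), FT_cutMul 1 n u] with ξ h1 h2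
      rw [h1, Pi.sub_apply, h2, cutSymbol]
      split_ifs <;> simp
    refine tendsto_lintegral_of_dominated_convergence (fun ξ => ‖FT u ξ‖ₑ ^ 2)
      (fun n => ((measurable_FT _).enorm.pow_const 2)) (fun n => ?_) ?_ ?_
    · filter_upwards [hb n] with ξ h
      rw [h]
      split_ifs <;> simp
    · rw [← ofReal_norm_sq]; exact ENNReal.ofReal_ne_top
    · filter_upwards [ae_all_iff.2 hb] with ξ h
      refine tendsto_const_nhds.congr' ?_
      filter_upwards [eventually_ge_atTop ⌈‖ξ‖⌉₊] with n hn
      rw [h, if_pos (Nat.ceil_le.1 hn)]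
      simp
  simp_rw [← ofReal_norm_sq] at h
  have h2 := (ENNReal.tendsto_toReal ENNReal.zero_ne_top).comp h
  simp only [Function.comp_def, ENNReal.toReal_ofReal (sq_nonneg _), ENNReal.toReal_zero] at h2
  simpa using h2.sqrt

/-- Moments are controlled by the band up to `L` and by a fraction of a higher moment. -/
theorem moment_two_le (u : L2 d) {L : ℝ} (hL : 0 < L) :
    moment 2 u ≤ ENNReal.ofReal (bandMoment 2 L u) +
      ENNReal.ofReal ((2 * Real.pi * L)⁻¹ ^ 4) * moment 6 u := by
  have hm : Measurable fun η : Space d => ENNReal.ofReal ((2 * Real.pi * ‖η‖) ^ 6) * ‖FT u η‖ₑ := by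
    have := measurable_FT u
    fun_prop
  have hs : MeasurableSet (Metric.closedBall (0 : Space d) L) :=
      Metric.isClosed_closedBall.measurableSet
  rw [ofReal_bandMoment, moment, ← lintegral_add_compl _ hs]
  refine add_le_add le_rfl ?_
  rw [moment, ← lintegral_const_mul _ hm]
  refine le_trans ?_ (setLIntegral_le_lintegral (Metric.closedBall (0 : Space d) L)ᶜ _)
  refine setLIntegral_mono (hm.const_mul _) fun ξ hξ => ?_
  have hξ' : L < ‖ξ‖ := by simpa using hξ
  rw [← mul_assoc, ← ENNReal.ofReal_mul (by positivity)]
  refine mul_le_mul' (ENNReal.ofReal_le_ofReal ?_) le_rfl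
  have h1 : 1 ≤ (2 * Real.pi * L)⁻¹ * (2 * Real.pi * ‖ξ‖) := by
    rw [inv_mul_eq_div, one_le_div (by positivity)]
    gcongr
  calc (2 * Real.pi * ‖ξ‖) ^ 2 = 1 ^ 4 * (2 * Real.pi * ‖ξ‖) ^ 2 := by ring
    _ ≤ ((2 * Real.pi * L)⁻¹ * (2 * Real.pi * ‖ξ‖)) ^ 4 * (2 * Real.pi * ‖ξ‖) ^ 2 := by gcongr
    _ = _ := by ring

theorem moment_sub_le (k : ℕ) (u v : L2 d) : moment k (u - v) ≤ moment k u + moment k v := by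
  have hm (u : L2 d) : Measurable fun η : Space d => ENNReal.ofReal ((2 * Real.pi * ‖η‖) ^ k) *
      ‖FT u η‖ₑ := by
    have := measurable_FT u
    fun_prop
  unfold moment
  rw [← lintegral_add_left (hm u)]
  apply lintegral_mono_ae
  rw [FT.map_sub]
  filter_upwards [Lp.coeFn_sub (FT u) (FT v)] with ξ h
  rw [h, ← mul_add]
  exact mul_le_mul' le_rfl (by simpa using enorm_sub_le)

/-! ### Test functions -/

theorem IsTest.memLp {φ : Space d → ℝ} (hφ : IsTest φ) : MemLp φ 2 :=
  hφ.1.continuous.memLp_of_hasCompactSupport hφ.2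

/-- A test function as an element of `L²`. -/
def IsTest.toL2 {φ : Space d → ℝ} (hφ : IsTest φ) : L2 d := hφ.memLp.toLp φ

theorem IsTest.coeFn_toL2 {φ : Space d → ℝ} (hφ : IsTest φ) : hφ.toL2 =ᵐ[volume] φ :=
  hφ.memLp.coeFn_toLp

/-- A test function as a complex-valued Schwartz function. -/
def IsTest.toSchwartz {φ : Space d → ℝ} (hφ : IsTest φ) : 𝓢(Space d, ℂ) :=
  HasCompactSupport.toSchwartzMap (f := fun x => (φ x : ℂ))
    (hφ.2.comp_left (g := Complex.ofReal) (by simp)) (Complex.ofRealCLM.contDiff.comp hφ.1)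

theorem IsTest.toSchwartz_apply {φ : Space d → ℝ} (hφ : IsTest φ) (x : Space d) :
    hφ.toSchwartz x = φ x := rfl

theorem IsTest.FT_toL2 {φ : Space d → ℝ} (hφ : IsTest φ) :
    FT hφ.toL2 =ᵐ[volume] (𝓕 hφ.toSchwartz : 𝓢(Space d, ℂ)) := by
  have h : (Complex.ofRealCLM.compLp hφ.toL2 : L2C d) = hφ.toSchwartz.toLp 2 := by
    ext1
    filter_upwards [Complex.ofRealCLM.coeFn_compLp hφ.toL2, hφ.coeFn_toL2,
      hφ.toSchwartz.coeFn_toLp 2] with x h1 h2 h3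
    rw [h1, h2, h3]
    rfl
  rw [FT_apply, h, SchwartzMap.toLp_fourier_eq]
  exact SchwartzMap.coeFn_toLp _ 2 volume

theorem laplacian_ofReal {φ : Space d → ℝ} (hφ : ContDiff ℝ 2 φ) (x : Space d) :
    Laplacian.laplacian (fun x => (φ x : ℂ)) x = (Laplacian.laplacian φ x : ℂ) :=
  (hφ.contDiffAt (x := x)).laplacian_CLM_comp_left (l := Complex.ofRealCLM)

theorem IsTest.two {φ : Space d → ℝ} (hφ : IsTest φ) : ContDiff ℝ 2 φ :=
  by exact_mod_cast contDiff_infty.1 hφ.1 2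

theorem IsTest.laplacian {φ : Space d → ℝ} (hφ : IsTest φ) : IsTest (Laplacian.laplacian φ) := by
  have h : Laplacian.laplacian φ = (fun T : ContinuousMultilinearMap ℝ (fun _ : Fin 2 =>
      Space d) ℝ =>
      ∑ i, T ![EuclideanSpace.basisFun (Fin d) ℝ i, EuclideanSpace.basisFun (Fin d) ℝ i]) ∘
      iteratedFDeriv ℝ 2 φ :=
    InnerProductSpace.laplacian_eq_iteratedFDeriv_orthonormalBasis φ (EuclideanSpace.basisFun (Fin d) ℝ)
  rw [h]
  refine ⟨ContDiff.comp ?_ (hφ.1.iteratedFDeriv_right (m := ∞) le_rfl),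
    (hφ.2.iteratedFDeriv 2).comp_left (by simp)⟩
  exact ContDiff.sum fun i _ => (ContinuousMultilinearMap.apply ℝ (fun _ : Fin 2 =>
      Space d) ℝ _).contDiff

theorem IsTest.laplacian_toSchwartz {φ : Space d → ℝ} (hφ : IsTest φ) :
    hφ.laplacian.toSchwartz = Laplacian.laplacian hφ.toSchwartz := by
  ext x
  rw [SchwartzMap.laplacian_apply, toSchwartz_apply]
  exact (laplacian_ofReal hφ.two x).symm

theorem IsTest.fourier_laplacian {φ : Space d → ℝ} (hφ : IsTest φ) (ξ : Space d) :
    (𝓕 hφ.laplacian.toSchwartz : 𝓢(Space d, ℂ)) ξ =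
      ((lapSym ‖ξ‖ : ℝ) : ℂ) * (𝓕 hφ.toSchwartz : 𝓢(Space d, ℂ)) ξ := by
  rw [hφ.laplacian_toSchwartz, SchwartzMap.laplacian_eq_fourierMultiplierCLM,
    FourierTransform.fourier_smul, SchwartzMap.fourierMultiplierCLM_apply,
    FourierTransform.fourier_fourierInv_eq, _root_.smul_apply,
    SchwartzMap.smulLeftCLM_apply_apply (by fun_prop)]
  simp only [Complex.real_smul, lapSym_apply]
  push_cast
  ring

theorem IsTest.FT_laplacian {φ : Space d → ℝ} (hφ : IsTest φ) :
    FT hφ.laplacian.toL2 =ᵐ[volume] fun ξ => ((lapSym ‖ξ‖ : ℝ) : ℂ) * FT hφ.toL2 ξ := by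
  filter_upwards [hφ.FT_toL2, hφ.laplacian.FT_toL2] with ξ h1 h2
  rw [h1, h2, hφ.fourier_laplacian]

theorem IsTest.integrable {φ : Space d → ℝ} (hφ : IsTest φ) : Integrable φ :=
  hφ.1.continuous.integrable_of_hasCompactSupport hφ.2

theorem IsTest.integral_laplacian {φ : Space d → ℝ} (hφ : IsTest φ) :
    ∫ x, Laplacian.laplacian φ x = 0 := by
  have h := hφ.fourier_laplacian 0
  rw [norm_zero, lapSym_apply] at h
  simp only [mul_zero, ne_eq, OfNat.ofNat_ne_zero, not_false_eq_true, zero_pow, neg_zero,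
    Complex.ofReal_zero, zero_mul] at h
  rw [SchwartzMap.fourier_coe, Real.fourier_eq] at h
  simp only [inner_zero_right, neg_zero, AddChar.map_zero_eq_one, one_smul,
    IsTest.toSchwartz_apply] at h
  rw [integral_complex_ofReal] at h
  exact_mod_cast h

theorem IsTest.cutLap_toL2 {φ : Space d → ℝ} (hφ : IsTest φ) (N : ℝ) :
    cutLap N hφ.toL2 = lowPass N hφ.laplacian.toL2 := by
  apply FT.injective
  ext1
  filter_upwards [FT_cutMul lapSym N hφ.toL2, FT_cutMul 1 N hφ.laplacian.toL2, hφ.FT_laplacian]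
    with ξ h1 h2 h3
  rw [h1, h2, h3, cutSymbol, cutSymbol]
  split_ifs <;> simp

theorem IsTest.inner_toL2 {φ : Space d → ℝ} (hφ : IsTest φ) (u : L2 d) :
    inner ℝ u hφ.toL2 = ∫ x, u x * φ x := by
  rw [L2.inner_def]
  apply integral_congr_ae
  filter_upwards [hφ.coeFn_toL2] with x h
  rw [h]
  simp [mul_comm]

/-! ### The weak Laplacian as an inverse Fourier integral -/

/-- The Fourier transform of the Laplacian of `u`. -/
def lapFT (u : L2 d) (ξ : Space d) : ℂ := ((lapSym ‖ξ‖ : ℝ) : ℂ) * FT u ξ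

/-- The Laplacian of `u` as an inverse Fourier integral. It is a bounded continuous function as
soon as `moment 2 u` is finite. -/
def weakLap (u : L2 d) (x : Space d) : ℝ := (𝓕⁻ (lapFT u) x).re

theorem measurable_lapFT (u : L2 d) : Measurable (lapFT u) := by
  have := measurable_FT u
  have h2 : Measurable fun ξ : Space d => lapSym ‖ξ‖ :=
    (lapSym.continuous.comp continuous_norm).measurable
  exact (Complex.measurable_ofReal.comp h2).mul this

theorem enorm_lapFT (u : L2 d) (ξ : Space d) :
    ‖lapFT u ξ‖ₑ = ENNReal.ofReal ((2 * Real.pi * ‖ξ‖) ^ 2) * ‖FT u ξ‖ₑ := by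
  rw [lapFT, enorm_mul, lapSym_apply, ← ofReal_norm (_ : ℂ), Complex.norm_real, norm_neg,
    Real.norm_of_nonneg (by positivity)]

theorem lintegral_lapFT (u : L2 d) : ∫⁻ ξ, ‖lapFT u ξ‖ₑ = moment 2 u := by
  simp_rw [enorm_lapFT]; rfl

theorem integrable_lapFT {u : L2 d} (hu : moment 2 u ≠ ⊤) : Integrable (lapFT u) :=
  ⟨(measurable_lapFT u).aestronglyMeasurable, by
    rw [HasFiniteIntegral, lintegral_lapFT]; exact hu.lt_top⟩

theorem integral_norm_lapFT (u : L2 d) : ∫ ξ, ‖lapFT u ξ‖ = (moment 2 u).toReal := by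
  rw [integral_norm_eq_lintegral_enorm (measurable_lapFT u).aestronglyMeasurable, lintegral_lapFT]

theorem continuous_fourierInv_of_integrable {F : Space d → ℂ} (hF : Integrable F) :
    Continuous (𝓕⁻ F) := by
  rw [Real.fourierInv_eq_fourier_comp_neg]
  exact VectorFourier.fourierIntegral_continuous Real.continuous_fourierChar
    (by simpa using continuous_inner) hF.comp_neg

theorem continuous_weakLap {u : L2 d} (hu : moment 2 u ≠ ⊤) : Continuous (weakLap u) :=
  Complex.continuous_re.comp (continuous_fourierInv_of_integrable (integrable_lapFT hu))

theorem abs_weakLap_le (u : L2 d) (x : Space d) : |weakLap u x| ≤ (moment 2 u).toReal :=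
  (Complex.abs_re_le_norm _).trans ((norm_fourierInv_le _ x).trans (integral_norm_lapFT u).le)

theorem fourierInv_congr_ae {F G : Space d → ℂ} (h : F =ᵐ[volume] G) : 𝓕⁻ F = 𝓕⁻ G := by
  ext x
  rw [Real.fourierInv_eq, Real.fourierInv_eq]
  apply integral_congr_ae
  filter_upwards [h] with ξ hξ
  rw [hξ]

theorem fourierInv_sub_of_integrable {F G : Space d → ℂ} (hF : Integrable F) (hG : Integrable G)
    (x : Space d) : 𝓕⁻ (fun ξ => F ξ - G ξ) x = 𝓕⁻ F x - 𝓕⁻ G x := by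
  have h (F : Space d → ℂ) (hF : Integrable F) : Integrable fun v : Space d =>
      Real.fourierChar (inner ℝ v x) • F v := by
    refine hF.norm.mono' (AEStronglyMeasurable.smul (Continuous.aestronglyMeasurable (by fun_prop)) hF.1) ?_
    filter_upwards with v
    simp
  rw [Real.fourierInv_eq, Real.fourierInv_eq, Real.fourierInv_eq, ← integral_sub (h F hF) (h G hG)]
  simp [smul_sub]

theorem weakLap_sub {u v : L2 d} (hu : moment 2 u ≠ ⊤) (hv : moment 2 v ≠ ⊤) (x : Space d) :
    weakLap (u - v) x = weakLap u x - weakLap v x := by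
  rw [weakLap, weakLap, weakLap, ← Complex.sub_re,
    ← fourierInv_sub_of_integrable (integrable_lapFT hu) (integrable_lapFT hv)]
  congr 2
  refine congrFun (fourierInv_congr_ae ?_) x
  filter_upwards [Lp.coeFn_sub (FT u) (FT v)] with ξ h
  simp only [lapFT]
  rw [FT.map_sub, h, Pi.sub_apply, mul_sub]

theorem abs_weakLap_sub_le {u v : L2 d} (hu : moment 2 u ≠ ⊤) (hv : moment 2 v ≠ ⊤) (x : Space d) :
    |weakLap u x - weakLap v x| ≤ (moment 2 (u - v)).toReal := by
  rw [← weakLap_sub hu hv]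
  exact abs_weakLap_le _ x

theorem cutLap_ae_eq (N : ℝ) (u : L2 d) : cutLap N u =ᵐ[volume] weakLap (lowPass N u) := by
  filter_upwards [ae_eq_fourierInv_FT (integrable_FT_cutLap N u)] with x hx
  rw [weakLap, ← Complex.ofReal_re (cutLap N u x), hx]
  congr 2
  refine congrFun (fourierInv_congr_ae ?_) x
  filter_upwards [FT_cutMul lapSym N u, FT_cutMul 1 N u] with ξ h1 h2
  rw [h1, lapFT, h2, cutSymbol, cutSymbol]
  split_ifs <;> simp

theorem lowPass_lowPass {N M : ℝ} (h : N ≤ M) (u : L2 d) :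
    lowPass M (lowPass N u) = lowPass N u := by
  rw [cutMul_cutMul, mul_one, min_eq_right h]

theorem moment_lowPass_ne_top (k : ℕ) (N : ℝ) (u : L2 d) : moment k (lowPass N u) ≠ ⊤ := by
  rw [moment_eq_ofReal_bandMoment k (lowPass_lowPass le_rfl u)]
  exact ENNReal.ofReal_ne_top

theorem moment_lowPass_le (k : ℕ) (N : ℝ) (u : L2 d) : moment k (lowPass N u) ≤ moment k u := by
  rw [moment_eq_ofReal_bandMoment k (lowPass_lowPass le_rfl u)]
  exact (ENNReal.ofReal_le_ofReal (bandMoment_lowPass_le k N N u)).trans (ofReal_bandMoment_le k N u)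

theorem tendsto_moment_lowPass_sub (k : ℕ) {u : L2 d} (hu : moment k u ≠ ⊤) :
    Tendsto (fun n : ℕ => moment k (lowPass (n : ℝ) u - u)) atTop (𝓝 0) := by
  have h0 : (0 : ℝ≥0∞) = ∫⁻ _ : Space d, 0 := by simp
  rw [h0]
  have hm (u : L2 d) : Measurable fun η : Space d =>
      ENNReal.ofReal ((2 * Real.pi * ‖η‖) ^ k) * ‖FT u η‖ₑ := by
    have := measurable_FT u
    fun_prop
  have hb (n : ℕ) : ∀ᵐ ξ, FT (lowPass (n : ℝ) u - u) ξ = if ‖ξ‖ ≤ n then 0 else - FT u ξ := by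
    rw [FT.map_sub]
    filter_upwards [Lp.coeFn_sub (FT (lowPass (n : ℝ) u)) (FT u), FT_cutMul 1 n u] with ξ h1 h2
    rw [h1, Pi.sub_apply, h2, cutSymbol]
    split_ifs <;> simp
  refine tendsto_lintegral_of_dominated_convergence
    (fun ξ => ENNReal.ofReal ((2 * Real.pi * ‖ξ‖) ^ k) * ‖FT u ξ‖ₑ) (fun n => hm _)
    (fun n => ?_) hu ?_
  · filter_upwards [hb n] with ξ h
    rw [h]
    split_ifs <;> simp
  · filter_upwards [ae_all_iff.2 hb] with ξ h
    refine tendsto_const_nhds.congr' ?_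
    filter_upwards [eventually_ge_atTop ⌈‖ξ‖⌉₊] with n hn
    rw [h, if_pos (Nat.ceil_le.1 hn)]
    simp

theorem tendsto_weakLap_lowPass {u : L2 d} (hu : moment 2 u ≠ ⊤) (x : Space d) :
    Tendsto (fun n : ℕ => weakLap (lowPass (n : ℝ) u) x) atTop (𝓝 (weakLap u x)) := by
  rw [tendsto_iff_norm_sub_tendsto_zero]
  refine squeeze_zero (fun n => norm_nonneg _)
    (fun n => abs_weakLap_sub_le (moment_lowPass_ne_top 2 n u) hu x) ?_
  exact (ENNReal.tendsto_toReal ENNReal.zero_ne_top).comp (tendsto_moment_lowPass_sub 2 hu)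

theorem hasWeakLaplacian_weakLap {u : L2 d} (hu : moment 2 u ≠ ⊤) :
    HasWeakLaplacian u (weakLap u) := by
  refine ⟨(continuous_weakLap hu).locallyIntegrable, fun φ hφ => ?_⟩
  rw [← hφ.laplacian.inner_toL2 u]
  have h1 : Tendsto (fun n : ℕ => inner ℝ (lowPass (n : ℝ) u) hφ.laplacian.toL2) atTop
      (𝓝 (inner ℝ u hφ.laplacian.toL2)) := (tendsto_lowPass u).inner tendsto_const_nhds
  have h2 (n : ℕ) : inner ℝ (lowPass (n : ℝ) u) hφ.laplacian.toL2 =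
      ∫ x, weakLap (lowPass (n : ℝ) u) x * φ x := by
    rw [inner_cutMul_left, ← hφ.cutLap_toL2, ← inner_cutMul_left, hφ.inner_toL2]
    apply integral_congr_ae
    filter_upwards [cutLap_ae_eq n u] with x hx
    rw [hx]
  simp_rw [h2] at h1
  refine tendsto_nhds_unique h1 ?_
  refine tendsto_integral_of_dominated_convergence (fun x => (moment 2 u).toReal * |φ x|)
    (fun n => ((continuous_weakLap (moment_lowPass_ne_top 2 n u)).mul
      hφ.1.continuous).aestronglyMeasurable) (hφ.integrable.abs.const_mul _) (fun n => ?_) ?_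
  · filter_upwards with x
    rw [Real.norm_eq_abs, abs_mul]
    gcongr
    exact (abs_weakLap_le _ x).trans (ENNReal.toReal_mono hu (moment_lowPass_le 2 n u))
  · filter_upwards with x
    exact (tendsto_weakLap_lowPass hu x).mul_const _

/-- The weak Laplacian is unique. -/
theorem HasWeakLaplacian.ae_eq {u : L2 d} (hu : moment 2 u ≠ ⊤) {w : Space d → ℝ}
    (hw : HasWeakLaplacian u w) : w =ᵐ[volume] weakLap u := by
  have h := hasWeakLaplacian_weakLap hu
  refine ae_eq_of_integral_contDiff_smul_eq hw.1 h.1 fun φ h1 h2 => ?_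
  have := (hw.2 φ ⟨h1, h2⟩).symm.trans (h.2 φ ⟨h1, h2⟩)
  simpa [mul_comm] using this

/-! ### The exponential nonlinearity -/

/-- For continuous `ψ` with compact support `∫ e^{-Δu} ψ` is a continuous function of the
Laplacian. -/
theorem tendsto_integral_exp_weakLap {ι : Type*} {l : Filter ι} [l.IsCountablyGenerated]
    {ψ : Space d → ℝ} (hψ : Continuous ψ) (hc : HasCompactSupport ψ) {v : ι → L2 d} {u : L2 d}
    {C : ℝ} (hv : ∀ᶠ i in l, moment 2 (v i) ≠ ⊤) (hC : ∀ᶠ i in l, (moment 2 (v i)).toReal ≤ C)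
    (h : ∀ x, Tendsto (fun i => weakLap (v i) x) l (𝓝 (weakLap u x))) :
    Tendsto (fun i => ∫ x, Real.exp (-weakLap (v i) x) * ψ x) l
      (𝓝 (∫ x, Real.exp (-weakLap u x) * ψ x)) := by
  refine tendsto_integral_filter_of_dominated_convergence (fun x => Real.exp C * |ψ x|) ?_ ?_
    ((hψ.integrable_of_hasCompactSupport hc).abs.const_mul _) ?_
  · filter_upwards [hv] with i hi
    exact ((Real.continuous_exp.comp (continuous_weakLap hi).neg).mul hψ).aestronglyMeasurable
  · filter_upwards [hC] with i hi
    filter_upwards with x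
    rw [norm_mul, Real.norm_eq_abs, Real.norm_eq_abs, Real.abs_exp]
    gcongr
    exact (neg_le_abs _).trans ((abs_weakLap_le _ x).trans hi)
  · filter_upwards with x
    exact ((Real.continuous_exp.tendsto _).comp (h x).neg).mul_const _

theorem exists_moment_lowPass_le (d k : ℕ) (N : ℝ) : ∃ C : ℝ, 0 ≤ C ∧ ∀ u : L2 d,
    (moment k (lowPass N u)).toReal ≤ C * ‖u‖ := by
  obtain ⟨C, hC, h⟩ := exists_bandMoment_le d k (le_max_right N 0)
  refine ⟨C, hC, fun u => ?_⟩
  rw [moment_eq_ofReal_bandMoment k (lowPass_lowPass le_rfl u),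
    ENNReal.toReal_ofReal (bandMoment_nonneg _ _ _)]
  exact (bandMoment_mono k (le_max_left N 0) _).trans ((bandMoment_lowPass_le k _ N u).trans (h u))

theorem continuous_integral_exp_weakLap_lowPass {ψ : Space d → ℝ} (hψ : Continuous ψ)
    (hc : HasCompactSupport ψ) (N : ℝ) :
    Continuous fun u : L2 d => ∫ x, Real.exp (-weakLap (lowPass N u) x) * ψ x := by
  obtain ⟨C, hC, h⟩ := exists_moment_lowPass_le d 2 N
  rw [continuous_iff_continuousAt]
  intro u
  refine tendsto_integral_exp_weakLap hψ hc (C := C * (‖u‖ + 1))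
    (Eventually.of_forall fun v => moment_lowPass_ne_top 2 N v) ?_ fun x => ?_
  · have : ∀ᶠ v : L2 d in 𝓝 u, ‖v‖ < ‖u‖ + 1 :=
      continuous_norm.continuousAt.eventually_lt continuousAt_const (by linarith)
    filter_upwards [this] with v hv
    exact (h v).trans (by gcongr)
  · rw [tendsto_iff_norm_sub_tendsto_zero]
    have h2 : Tendsto (fun v : L2 d => C * ‖v - u‖) (𝓝 u) (𝓝 0) := by
      have : Tendsto (fun v : L2 d => C * ‖v - u‖) (𝓝 u) (𝓝 (C * ‖u - u‖)) :=
        ((continuous_id.sub continuous_const).norm.const_mul C).tendsto u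
      simpa using this
    refine squeeze_zero (fun n => norm_nonneg _) (fun v => ?_) h2
    refine (abs_weakLap_sub_le (moment_lowPass_ne_top 2 N v)
        (moment_lowPass_ne_top 2 N u) x).trans ?_
    rw [← map_sub]
    exact h _

/-- Along a continuous curve in `L²` with finite second moments, `∫ e^{-Δh(s)} ψ` is a measurable
function of time. -/
theorem aestronglyMeasurable_integral_exp {ψ : Space d → ℝ} (hψ : Continuous ψ)
    (hc : HasCompactSupport ψ) {h : ℝ → L2 d} (hh : ContinuousOn h (Ici 0))
    (hm : ∀ s, 0 ≤ s → moment 2 (h s) ≠ ⊤) (t : ℝ) :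
    AEStronglyMeasurable (fun s => ∫ x, Real.exp (-weakLap (h s) x) * ψ x)
      (volume.restrict (Ioc 0 t)) := by
  refine aestronglyMeasurable_of_tendsto_ae atTop
    (f := fun (n : ℕ) s => ∫ x, Real.exp (-weakLap (lowPass (n : ℝ) (h s)) x) * ψ x)
    (fun n => ?_) ?_
  · refine ContinuousOn.aestronglyMeasurable (s := Ioc 0 t) ?_ measurableSet_Ioc
    exact (continuous_integral_exp_weakLap_lowPass hψ hc n).comp_continuousOn
      (hh.mono fun s hs => hs.1.le)
  · filter_upwards [ae_restrict_mem measurableSet_Ioc] with s hs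
    exact tendsto_integral_exp_weakLap hψ hc (C := (moment 2 (h s)).toReal)
      (Eventually.of_forall fun n => moment_lowPass_ne_top 2 n _)
      (Eventually.of_forall fun n => ENNReal.toReal_mono (hm s hs.1.le) (moment_lowPass_le 2 n _))
      fun x => tendsto_weakLap_lowPass (hm s hs.1.le) x

theorem abs_integral_exp_weakLap_le {ψ : Space d → ℝ} (hψ : Integrable ψ) {u : L2 d}
    {C : ℝ} (hu : (moment 2 u).toReal ≤ C) :
    |∫ x, Real.exp (-weakLap u x) * ψ x| ≤ Real.exp C * ∫ x, |ψ x| := by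
  rw [← integral_const_mul, ← Real.norm_eq_abs]
  refine norm_integral_le_of_norm_le (hψ.abs.const_mul _) ?_
  filter_upwards with x
  rw [norm_mul, Real.norm_eq_abs, Real.norm_eq_abs, Real.abs_exp]
  gcongr
  exact (neg_le_abs _).trans ((abs_weakLap_le _ x).trans hu)

/-! ### The limit of the Galerkin flows -/

theorem bandMoment_galerkin_lowPass_le {N y A : ℝ} (hN : 0 ≤ N) {a : L2 d} (hy1 : y ≤ 1)
    (hy : f2 y = 1) (hA0 : 0 ≤ A) (hA : A < y) (ha : moment 2 a ≤ ENNReal.ofReal A) (K : ℝ) {t : ℝ}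
    (ht : 0 ≤ t) : bandMoment 2 N (galerkin N (lowPass K a) t) ≤ A := by
  have h1 : bandMoment 2 N a ≤ A :=
    (ENNReal.ofReal_le_ofReal_iff hA0).1 ((ofReal_bandMoment_le 2 N a).trans ha)
  have h2 : bandMoment 2 N (lowPass N (lowPass K a)) ≤ A :=
    (bandMoment_lowPass_le 2 N N _).trans ((bandMoment_lowPass_le 2 N K a).trans h1)
  exact (bandMoment_galerkin_le hN _ hy1 hy (h2.trans_lt hA) ht).trans h2

theorem bandMoment_galerkin_le_of_moment_le {N y A : ℝ} (hN : 0 ≤ N) {a : L2 d} (hy1 : y ≤ 1)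
    (hy : f2 y = 1) (hA0 : 0 ≤ A) (hA : A < y) (ha : moment 2 a ≤ ENNReal.ofReal A) {t : ℝ}
    (ht : 0 ≤ t) : bandMoment 2 N (galerkin N a t) ≤ A := by
  have h1 : bandMoment 2 N a ≤ A :=
    (ENNReal.ofReal_le_ofReal_iff hA0).1 ((ofReal_bandMoment_le 2 N a).trans ha)
  have h2 : bandMoment 2 N (lowPass N a) ≤ A := (bandMoment_lowPass_le 2 N N _).trans h1
  exact (bandMoment_galerkin_le hN _ hy1 hy (h2.trans_lt hA) ht).trans h2

/-- The Galerkin solutions converge uniformly on `[0, ∞)`. For band-limited data this follows from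
the difference estimate; general data are approximated by their low-pass parts, which is harmless
because the Galerkin flow does not expand `L²` distances. -/
theorem exists_tendstoUniformlyOn_galerkin {y A : ℝ} {a : L2 d} (hy1 : y ≤ 1 / 4)
    (hy : f2 y = 1) (hA0 : 0 ≤ A) (hA : A < y) (ha : moment 2 a ≤ ENNReal.ofReal A) :
    ∃ h : ℝ → L2 d, TendstoUniformlyOn (fun (n : ℕ) t => galerkin (n : ℝ) a t) h atTop (Ici 0) := by
  have hy1' : y ≤ 1 := by linarith
  have key : ∀ (K N M : ℕ), K ≤ N → 0 < N → N ≤ M → ∀ t : ℝ, 0 ≤ t →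
      ‖galerkin (N : ℝ) a t - galerkin (M : ℝ) a t‖ ≤ 2 * ‖lowPass (K : ℝ) a - a‖ +
        2 * ((N : ℝ)⁻¹ * ‖cutGrad (K : ℝ) a‖) := by
    intro K N M hKN hN hNM t ht
    have h1 := norm_galerkin_sub_le N a (lowPass (K : ℝ) a) ht
    have h2 := norm_galerkin_sub_le M (lowPass (K : ℝ) a) a ht
    have h3 := norm_sq_galerkin_sub_le (K := K) (N := N) (M := M) (by exact_mod_cast hN)
      (by exact_mod_cast hKN) (by exact_mod_cast hNM) a
      (fun t ht => (bandMoment_galerkin_lowPass_le (by positivity) hy1' hy hA0 hA ha K ht).trans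
        (by linarith))
      (fun t ht => (bandMoment_galerkin_lowPass_le (by positivity) hy1' hy hA0 hA ha K ht).trans
        (by linarith)) ht
    have h4 : ‖galerkin (N : ℝ) (lowPass (K : ℝ) a) t - galerkin (M : ℝ) (lowPass (K : ℝ) a) t‖ ≤
        2 * ((N : ℝ)⁻¹ * ‖cutGrad (K : ℝ) a‖) := by
      refine le_of_sq_le_sq (h3.trans ?_) (by positivity)
      have := sq_nonneg ((N : ℝ)⁻¹ * ‖cutGrad (K : ℝ) a‖)
      linarith [mul_pow 2 ((N : ℝ)⁻¹ * ‖cutGrad (K : ℝ) a‖) 2]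
    rw [norm_sub_rev a] at h1
    have h5 := norm_add₃_le (a := galerkin (N : ℝ) a t - galerkin N (lowPass (K : ℝ) a) t)
      (b := galerkin (N : ℝ) (lowPass (K : ℝ) a) t - galerkin (M : ℝ) (lowPass (K : ℝ) a) t)
      (c := galerkin (M : ℝ) (lowPass (K : ℝ) a) t - galerkin M a t)
    have h6 : galerkin (N : ℝ) a t - galerkin N (lowPass (K : ℝ) a) t +
        (galerkin (N : ℝ) (lowPass (K : ℝ) a) t - galerkin (M : ℝ) (lowPass (K : ℝ) a) t) +
        (galerkin (M : ℝ) (lowPass (K : ℝ) a) t - galerkin M a t) =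
        galerkin (N : ℝ) a t - galerkin (M : ℝ) a t := by abel
    rw [h6] at h5
    linarith
  have hcauchy : ∀ ε > 0, ∃ N₀ : ℕ, ∀ N ≥ N₀, ∀ M ≥ N, ∀ t : ℝ, 0 ≤ t →
      ‖galerkin (N : ℝ) a t - galerkin (M : ℝ) a t‖ < ε := by
    intro ε hε
    have h1 : ∀ᶠ K : ℕ in atTop, ‖lowPass (K : ℝ) a - a‖ < ε / 4 :=
      (tendsto_iff_norm_sub_tendsto_zero.1 (tendsto_lowPass a)).eventually_lt_const (by linarith)
    obtain ⟨K, hK⟩ := h1.exists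
    have h2 : Tendsto (fun N : ℕ => 2 * ((N : ℝ)⁻¹ * ‖cutGrad (K : ℝ) a‖)) atTop (𝓝 0) := by
      simpa using (tendsto_inv_atTop_nhds_zero_nat (𝕜 := ℝ)).mul_const
        ‖cutGrad (K : ℝ) a‖ |>.const_mul 2
    obtain ⟨N₀, hN₀⟩ := eventually_atTop.1 ((h2.eventually_lt_const (half_pos hε)).and
      ((eventually_ge_atTop K).and (eventually_gt_atTop 0)))
    refine ⟨N₀, fun N hN M hM t ht => ?_⟩
    obtain ⟨e1, e2, e3⟩ := hN₀ N hN
    have := key K N M e2 e3 hM t ht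
    linarith
  have huc : UniformCauchySeqOn (fun (n : ℕ) t => galerkin (n : ℝ) a t) atTop (Ici 0) := by
    rw [Metric.uniformCauchySeqOn_iff]
    intro ε hε
    obtain ⟨N₀, h⟩ := hcauchy ε hε
    refine ⟨N₀, fun m hm n hn t ht => ?_⟩
    rcases le_total m n with hmn | hmn
    · rw [dist_eq_norm]; exact h m hm n hmn t ht
    · rw [dist_comm, dist_eq_norm]; exact h n hn m hmn t ht
  have hlim : ∀ t : ℝ, ∃ x : L2 d, 0 ≤ t → Tendsto (fun n : ℕ => galerkin (n : ℝ) a t) atTop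
      (𝓝 x) := by
    intro t
    by_cases ht : 0 ≤ t
    · obtain ⟨x, hx⟩ := cauchySeq_tendsto_of_complete (huc.cauchySeq ht)
      exact ⟨x, fun _ => hx⟩
    · exact ⟨0, fun h => absurd h ht⟩
  choose h hh using hlim
  exact ⟨h, huc.tendstoUniformlyOn_of_tendsto fun t ht => hh t ht⟩

section Limit

variable {y A : ℝ} {a : L2 d} {h : ℝ → L2 d}

theorem continuousOn_galerkin_limit
    (hlim : TendstoUniformlyOn (fun (n : ℕ) t => galerkin (n : ℝ) a t) h atTop (Ici 0)) :
    ContinuousOn h (Ici 0) :=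
  hlim.continuousOn (Frequently.of_forall fun _ => (continuous_galerkin _ a).continuousOn)

theorem galerkin_limit_zero
    (hlim : TendstoUniformlyOn (fun (n : ℕ) t => galerkin (n : ℝ) a t) h atTop (Ici 0)) :
    h 0 = a := by
  refine tendsto_nhds_unique (hlim.tendsto_at (mem_Ici.2 le_rfl)) ?_
  simp_rw [galerkin_zero]
  exact tendsto_lowPass a

theorem continuousOn_bandMoment (k : ℕ) {L : ℝ} (hL : 0 ≤ L) (hh : ContinuousOn h (Ici 0)) :
    ContinuousOn (fun s => bandMoment k L (h s)) (Ici 0) :=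
  (continuous_bandMoment k hL).comp_continuousOn hh

theorem aemeasurable_moment (k : ℕ) (hh : ContinuousOn h (Ici 0)) (t : ℝ) :
    AEMeasurable (fun s => moment k (h s)) (volume.restrict (Ioc 0 t)) := by
  simp_rw [moment_eq_iSup]
  refine AEMeasurable.iSup fun n => AEMeasurable.ennreal_ofReal ?_
  exact ((continuousOn_bandMoment k (by positivity) hh).mono
    fun s hs => hs.1.le).aemeasurable measurableSet_Ioc

/-- The decay estimate passes to the limit: first band by band, where the moments are continuous,
and then by monotone convergence. -/
theorem moment_add_le_of_limit (hy1 : y ≤ 1 / 4) (hy : f2 y = 1) (hA0 : 0 ≤ A) (hA : A < y)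
    (ha : moment 2 a ≤ ENNReal.ofReal A)
    (hlim : TendstoUniformlyOn (fun (n : ℕ) t => galerkin (n : ℝ) a t) h atTop (Ici 0)) {t : ℝ}
    (ht : 0 ≤ t) :
    moment 2 (h t) + ENNReal.ofReal (1 - f2 A) * ∫⁻ s in Ioc 0 t, moment 6 (h s) ≤ moment 2 a := by
  have hy1' : y ≤ 1 := by linarith
  have hh := continuousOn_galerkin_limit hlim
  have ha' : moment 2 a ≠ ⊤ := (ha.trans_lt ENNReal.ofReal_lt_top).ne
  have hσ : 0 ≤ 1 - f2 A := by
    have := f2_strictMonoOn (mem_Ici.2 hA0) (mem_Ici.2 (hA0.trans hA.le)) hA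
    linarith
  -- on a fixed band the moments are continuous in `L²`, so the Galerkin estimates converge
  have hL : ∀ L : ℕ, bandMoment 2 L (h t) + (1 - f2 A) * ∫ s in (0 : ℝ)..t, bandMoment 6 L (h s) ≤
      (moment 2 a).toReal := by
    intro L
    have hc6 := continuousOn_bandMoment 6 (Nat.cast_nonneg L) hh
    obtain ⟨C, hC, hCb⟩ := exists_bandMoment_le d 6 (Nat.cast_nonneg (α := ℝ) L)
    have t1 : Tendsto (fun n : ℕ => bandMoment 2 L (galerkin (n : ℝ) a t)) atTop
        (𝓝 (bandMoment 2 L (h t))) :=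
      ((continuous_bandMoment 2 (Nat.cast_nonneg L)).tendsto _).comp (hlim.tendsto_at (mem_Ici.2 ht))
    have t2 : Tendsto (fun n : ℕ => ∫ s in (0 : ℝ)..t, bandMoment 6 L (galerkin (n : ℝ) a s)) atTop
        (𝓝 (∫ s in (0 : ℝ)..t, bandMoment 6 L (h s))) := by
      refine intervalIntegral.tendsto_integral_filter_of_dominated_convergence
        (fun s => bandMoment 6 L (h s) + C) (Eventually.of_forall fun n =>
          ((continuous_bandMoment 6 (Nat.cast_nonneg L)).comp
            (continuous_galerkin _ a)).aestronglyMeasurable) ?_ ?_ ?_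
      · filter_upwards [Metric.tendstoUniformlyOn_iff.1 hlim 1 one_pos] with n hn
        filter_upwards with s hs
        rw [uIoc_of_le ht] at hs
        have h1 := hn s (mem_Ici.2 hs.1.le)
        rw [dist_comm, dist_eq_norm] at h1
        rw [Real.norm_of_nonneg (bandMoment_nonneg _ _ _)]
        refine (bandMoment_le_add 6 L _ (h s)).trans (add_le_add le_rfl ((hCb _).trans ?_))
        nlinarith
      · refine ContinuousOn.intervalIntegrable ?_
        rw [uIcc_of_le ht]
        exact (hc6.mono fun s hs => hs.1).add continuousOn_const
      · filter_upwards with s hs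
        rw [uIoc_of_le ht] at hs
        exact ((continuous_bandMoment 6 (Nat.cast_nonneg L)).tendsto _).comp
          (hlim.tendsto_at (mem_Ici.2 hs.1.le))
    refine le_of_tendsto (t1.add (t2.const_mul _)) ?_
    filter_upwards [eventually_ge_atTop L] with n hn
    have hn' : (L : ℝ) ≤ n := by exact_mod_cast hn
    have hn0 : (0 : ℝ) ≤ n := Nat.cast_nonneg n
    have hb : bandMoment 2 n (lowPass (n : ℝ) a) ≤ (moment 2 a).toReal :=
      (bandMoment_lowPass_le 2 n n a).trans (bandMoment_le_toReal_moment 2 n ha')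
    have hmA : (moment 2 a).toReal ≤ A := ENNReal.toReal_le_of_le_ofReal hA0 ha
    have h1 := bandMoment_galerkin_add_le hn0 a hy1' hy hA (hb.trans hmA) ht
    have h2 : ∫ s in (0 : ℝ)..t, bandMoment 6 L (galerkin (n : ℝ) a s) ≤
        ∫ s in (0 : ℝ)..t, bandMoment 6 n (galerkin (n : ℝ) a s) := by
      refine intervalIntegral.integral_mono_on ht ?_ ?_ fun s _ => bandMoment_mono 6 hn' _
      · exact ((continuous_bandMoment 6 (Nat.cast_nonneg L)).comp
          (continuous_galerkin _ a)).intervalIntegrable _ _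
      · exact ((continuous_bandMoment 6 hn0).comp (continuous_galerkin _ a)).intervalIntegrable _ _
    have h3 := bandMoment_mono 2 hn' (galerkin (n : ℝ) a t)
    have h4 := mul_le_mul_of_nonneg_left h2 hσ
    linarith
  -- monotone convergence as the band exhausts the frequencies
  have s1 : Tendsto (fun n : ℕ => ENNReal.ofReal (bandMoment 2 n (h t))) atTop
      (𝓝 (moment 2 (h t))) := by
    rw [moment_eq_iSup]
    exact tendsto_atTop_iSup fun n m hnm =>
      ENNReal.ofReal_le_ofReal (bandMoment_mono 2 (Nat.cast_le.2 hnm) _)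
  have s2 : Tendsto (fun n : ℕ => ∫⁻ s in Ioc 0 t, ENNReal.ofReal (bandMoment 6 n (h s))) atTop
      (𝓝 (∫⁻ s in Ioc 0 t, moment 6 (h s))) := by
    refine lintegral_tendsto_of_tendsto_of_monotone (fun n => AEMeasurable.ennreal_ofReal
      (((continuousOn_bandMoment 6 (by positivity) hh).mono
        fun s hs => hs.1.le).aemeasurable measurableSet_Ioc)) ?_ ?_
    · filter_upwards with s n m hnm
      exact ENNReal.ofReal_le_ofReal (bandMoment_mono 6 (Nat.cast_le.2 hnm) _)
    · filter_upwards with s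
      rw [moment_eq_iSup]
      exact tendsto_atTop_iSup fun n m hnm =>
        ENNReal.ofReal_le_ofReal (bandMoment_mono 6 (Nat.cast_le.2 hnm) _)
  refine le_of_tendsto' (s1.add (ENNReal.Tendsto.const_mul s2 (Or.inr ENNReal.ofReal_ne_top)))
    fun n => ?_
  have hi : IntegrableOn (fun s => bandMoment 6 n (h s)) (Ioc 0 t) :=
    (((continuousOn_bandMoment 6 (Nat.cast_nonneg n) hh).mono
      fun s hs => hs.1).integrableOn_compact isCompact_Icc).mono_set Ioc_subset_Icc_self
  rw [← ofReal_integral_eq_lintegral_ofReal hi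
    (by filter_upwards with s; exact bandMoment_nonneg _ _ _), ← ENNReal.ofReal_mul hσ,
    ← ENNReal.ofReal_add (bandMoment_nonneg _ _ _)
      (mul_nonneg hσ (integral_nonneg fun s => bandMoment_nonneg _ _ _)),
    ← intervalIntegral.integral_of_le ht]
  exact ENNReal.ofReal_le_of_le_toReal (hL n)

end Limit

/-! ### The equation in the limit -/

section Limit

variable {y A : ℝ} {a : L2 d} {h : ℝ → L2 d}

theorem abs_integral_exp_weakLap_sub_le {φ : Space d → ℝ} (hφ : IsTest φ) {u v : L2 d}
    (hu : moment 2 u ≤ 1) (hv : moment 2 v ≤ 1) :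
    |(∫ x, Real.exp (-weakLap u x) * φ x) - ∫ x, Real.exp (-weakLap v x) * φ x| ≤
      Real.exp 1 * (∫ x, |φ x|) * (moment 2 (u - v)).toReal := by
  have hu' : moment 2 u ≠ ⊤ := (hu.trans_lt ENNReal.one_lt_top).ne
  have hv' : moment 2 v ≠ ⊤ := (hv.trans_lt ENNReal.one_lt_top).ne
  have hi (u : L2 d) (hu : moment 2 u ≠ ⊤) : Integrable fun x => Real.exp (-weakLap u x) * φ x :=
    ((Real.continuous_exp.comp (continuous_weakLap hu).neg).mul
      hφ.1.continuous).integrable_of_hasCompactSupport hφ.2.mul_left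
  have hb (u : L2 d) (hu : moment 2 u ≤ 1) (x : Space d) : -weakLap u x ≤ 1 :=
    (neg_le_abs _).trans ((abs_weakLap_le u x).trans (ENNReal.toReal_le_of_le_ofReal zero_le_one
      (by simpa using hu)))
  rw [← integral_sub (hi u hu') (hi v hv')]
  have e : Real.exp 1 * (∫ x, |φ x|) * (moment 2 (u - v)).toReal =
      ∫ x, Real.exp 1 * (moment 2 (u - v)).toReal * |φ x| := by
    rw [integral_const_mul]; ring
  rw [e, ← Real.norm_eq_abs]
  refine norm_integral_le_of_norm_le (hφ.integrable.abs.const_mul _) ?_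
  filter_upwards with x
  rw [← sub_mul, norm_mul, Real.norm_eq_abs, Real.norm_eq_abs]
  refine mul_le_mul_of_nonneg_right ((abs_exp_sub_exp_le (hb u hu x) (hb v hv x)).trans ?_)
    (abs_nonneg _)
  refine mul_le_mul_of_nonneg_left ?_ (Real.exp_pos 1).le
  have := abs_weakLap_sub_le hu' hv' x
  rwa [neg_sub_neg, abs_sub_comm]

/-- For band-limited `u` with small moments the clipped nonlinearity may be replaced by `e^{-Δu}`;
the constant `-1` disappears because `∫ Δφ = 0`. -/
theorem inner_nem_cutLap_eq {φ : Space d → ℝ} (hφ : IsTest φ) {N : ℝ} {u : L2 d}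
    (hu : lowPass N u = u) (hb : bandMoment 2 N u ≤ 1) :
    inner ℝ (nem (cutLap N u)) hφ.laplacian.toL2 =
      ∫ x, Real.exp (-weakLap u x) * Laplacian.laplacian φ x := by
  have hm : moment 2 u ≠ ⊤ := hu ▸ moment_lowPass_ne_top 2 N u
  have hi : Integrable fun x => Real.exp (-weakLap u x) * Laplacian.laplacian φ x :=
    ((Real.continuous_exp.comp (continuous_weakLap hm).neg).mul
      hφ.laplacian.1.continuous).integrable_of_hasCompactSupport hφ.laplacian.2.mul_left
  rw [hφ.laplacian.inner_toL2]
  have e : ∫ x, Real.exp (-weakLap u x) * Laplacian.laplacian φ x =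
      ∫ x, (Real.exp (-weakLap u x) * Laplacian.laplacian φ x - Laplacian.laplacian φ x) := by
    rw [integral_sub hi hφ.laplacian.integrable, hφ.integral_laplacian, sub_zero]
  rw [e]
  apply integral_congr_ae
  filter_upwards [coeFn_nem (cutLap N u), cutLap_ae_eq N u, abs_cutLap_le N u] with x h1 h2 h3
  rw [h1, clipExp_of_abs_le (h3.trans hb), h2, hu]
  ring

theorem hasDerivAt_inner_galerkin {φ : Space d → ℝ} (hφ : IsTest φ) (N : ℝ) (a : L2 d) {t : ℝ}
    (ht : 0 ≤ t) :
    HasDerivAt (fun s => inner ℝ (galerkin N a s) hφ.toL2)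
      (inner ℝ (nem (cutLap N (galerkin N a t))) (lowPass N hφ.laplacian.toL2)) t := by
  have h := (hasDerivAt_galerkin N a ht).inner ℝ (hasDerivAt_const t hφ.toL2)
  rw [inner_zero_right, zero_add, galerkinField, inner_cutMul_left, hφ.cutLap_toL2] at h
  exact h

theorem moment_galerkin_eq {N : ℝ} (k : ℕ) (a : L2 d) {t : ℝ} (ht : 0 ≤ t) :
    moment k (galerkin N a t) = ENNReal.ofReal (bandMoment k N (galerkin N a t)) :=
  moment_eq_ofReal_bandMoment k (lowPass_galerkin le_rfl a ht)

/-- The dissipation bounds the sixth moments in `L¹` in time, uniformly in the truncation. -/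
theorem lintegral_moment_six_galerkin_le (hy1 : y ≤ 1 / 4) (hy : f2 y = 1) (hA0 : 0 ≤ A)
    (hA : A < y) (ha : moment 2 a ≤ ENNReal.ofReal A) (n : ℕ) {t : ℝ} (ht : 0 ≤ t) :
    ∫⁻ s in Ioc 0 t, moment 6 (galerkin (n : ℝ) a s) ≤ ENNReal.ofReal (A / (1 - f2 A)) := by
  have hσ : 0 < 1 - f2 A := by
    have := f2_strictMonoOn (mem_Ici.2 hA0) (mem_Ici.2 (hA0.trans hA.le)) hA
    linarith
  have hn0 : (0 : ℝ) ≤ n := Nat.cast_nonneg n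
  have hb : bandMoment 2 n (lowPass (n : ℝ) a) ≤ A :=
    (bandMoment_lowPass_le 2 n n a).trans
      ((ENNReal.ofReal_le_ofReal_iff hA0).1 ((ofReal_bandMoment_le 2 n a).trans ha))
  have h1 := bandMoment_galerkin_add_le hn0 a (by linarith) hy hA hb ht
  have h2 : ∫⁻ s in Ioc 0 t, moment 6 (galerkin (n : ℝ) a s) =
      ∫⁻ s in Ioc 0 t, ENNReal.ofReal (bandMoment 6 n (galerkin (n : ℝ) a s)) :=
    setLIntegral_congr_fun measurableSet_Ioc fun s hs => moment_galerkin_eq 6 a hs.1.le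
  have hc : Continuous fun s => bandMoment 6 n (galerkin (n : ℝ) a s) :=
    (continuous_bandMoment 6 hn0).comp (continuous_galerkin _ a)
  rw [h2, ← ofReal_integral_eq_lintegral_ofReal hc.integrableOn_Ioc
    (by filter_upwards with s; exact bandMoment_nonneg _ _ _), ← intervalIntegral.integral_of_le ht]
  refine ENNReal.ofReal_le_ofReal ?_
  rw [le_div_iff₀ hσ]
  have := bandMoment_nonneg 2 n (galerkin (n : ℝ) a t)
  linarith

/-- The sixth moments control the high frequencies on time average, hence the second moments of the
Galerkin solutions converge in `L¹` in time. -/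
theorem tendsto_lintegral_moment_sub (hy1 : y ≤ 1 / 4) (hy : f2 y = 1) (hA0 : 0 ≤ A)
    (hA : A < y) (ha : moment 2 a ≤ ENNReal.ofReal A)
    (hlim : TendstoUniformlyOn (fun (n : ℕ) t => galerkin (n : ℝ) a t) h atTop (Ici 0)) {t : ℝ}
    (ht : 0 ≤ t) :
    Tendsto (fun n : ℕ => ∫⁻ s in Ioc 0 t, moment 2 (galerkin (n : ℝ) a s - h s)) atTop (𝓝 0) := by
  have hσ : 0 < 1 - f2 A := by
    have := f2_strictMonoOn (mem_Ici.2 hA0) (mem_Ici.2 (hA0.trans hA.le)) hA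
    linarith
  have hh := continuousOn_galerkin_limit hlim
  set B : ℝ≥0∞ := ENNReal.ofReal (A / (1 - f2 A)) with hB
  have h6 : ∫⁻ s in Ioc 0 t, moment 6 (h s) ≤ B := by
    have h1 := moment_add_le_of_limit hy1 hy hA0 hA ha hlim ht
    have h2 := (le_add_self.trans h1).trans ha
    rw [hB, ENNReal.ofReal_div_of_pos hσ, ENNReal.le_div_iff_mul_le (Or.inl (by simpa using hσ))
      (Or.inl ENNReal.ofReal_ne_top), mul_comm]
    exact h2
  -- low frequencies converge by the convergence in `L²`
  have hlow : ∀ L : ℕ, Tendsto (fun n : ℕ => ∫⁻ s in Ioc 0 t,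
      ENNReal.ofReal (bandMoment 2 L (galerkin (n : ℝ) a s - h s))) atTop (𝓝 0) := by
    intro L
    obtain ⟨C, hC, hCb⟩ := exists_bandMoment_le d 2 (Nat.cast_nonneg (α := ℝ) L)
    have h0 : (0 : ℝ≥0∞) = ∫⁻ _ in Ioc 0 t, 0 := by simp
    rw [h0]
    refine tendsto_lintegral_filter_of_dominated_convergence' (fun _ => ENNReal.ofReal C)
      (Eventually.of_forall fun n => ?_) ?_ ?_ ?_
    · refine AEMeasurable.ennreal_ofReal ?_
      exact ((continuousOn_bandMoment 2 (Nat.cast_nonneg L)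
        ((continuous_galerkin _ a).continuousOn.sub hh)).mono
        fun s hs => hs.1.le).aemeasurable measurableSet_Ioc
    · filter_upwards [Metric.tendstoUniformlyOn_iff.1 hlim 1 one_pos] with n hn
      filter_upwards [ae_restrict_mem measurableSet_Ioc] with s hs
      have h1 := hn s (mem_Ici.2 hs.1.le)
      rw [dist_comm, dist_eq_norm] at h1
      refine ENNReal.ofReal_le_ofReal ((hCb _).trans ?_)
      nlinarith
    · simp [ENNReal.mul_eq_top]
    · filter_upwards [ae_restrict_mem measurableSet_Ioc] with s hs
      have h1 : Tendsto (fun n : ℕ => galerkin (n : ℝ) a s - h s) atTop (𝓝 (h s - h s)) :=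
        (hlim.tendsto_at (mem_Ici.2 hs.1.le)).sub tendsto_const_nhds
      have h2 := ENNReal.tendsto_ofReal
        (((continuous_bandMoment 2 (Nat.cast_nonneg (α := ℝ) L)).tendsto _).comp h1)
      have h3 : bandMoment 2 (L : ℝ) (0 : L2 d) = 0 := by
        refine le_antisymm ?_ (bandMoment_nonneg _ _ _)
        simpa using hCb 0
      simpa [sub_self, h3, Function.comp_def] using h2
  -- frequencies above `L` contribute at most `(2πL)⁻⁴` times the sixth moments
  have hsplit : ∀ L : ℕ, 0 < L → ∀ n : ℕ,
      ∫⁻ s in Ioc 0 t, moment 2 (galerkin (n : ℝ) a s - h s) ≤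
        (∫⁻ s in Ioc 0 t, ENNReal.ofReal (bandMoment 2 L (galerkin (n : ℝ) a s - h s))) +
          ENNReal.ofReal ((2 * Real.pi * L)⁻¹ ^ 4) * (B + B) := by
    intro L hL n
    have hu6 := aemeasurable_moment (h :=
        galerkin (n : ℝ) a) 6 (continuous_galerkin _ a).continuousOn t
    have hbm : AEMeasurable (fun s => ENNReal.ofReal (bandMoment 2 L (galerkin (n : ℝ) a s - h s)))
        (volume.restrict (Ioc 0 t)) := by
      refine AEMeasurable.ennreal_ofReal ?_
      exact ((continuousOn_bandMoment 2 (Nat.cast_nonneg L)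
        ((continuous_galerkin _ a).continuousOn.sub hh)).mono
        fun s hs => hs.1.le).aemeasurable measurableSet_Ioc
    calc ∫⁻ s in Ioc 0 t, moment 2 (galerkin (n : ℝ) a s - h s)
        ≤ ∫⁻ s in Ioc 0 t, (ENNReal.ofReal (bandMoment 2 L (galerkin (n : ℝ) a s - h s)) +
          ENNReal.ofReal ((2 * Real.pi * L)⁻¹ ^ 4) *
            (moment 6 (galerkin (n : ℝ) a s) + moment 6 (h s))) := by
          refine lintegral_mono fun s => ?_
          exact (moment_two_le _ (by exact_mod_cast hL)).trans
            (add_le_add le_rfl (mul_le_mul' le_rfl (moment_sub_le 6 _ _)))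
      _ = (∫⁻ s in Ioc 0 t, ENNReal.ofReal (bandMoment 2 L (galerkin (n : ℝ) a s - h s))) +
          ENNReal.ofReal ((2 * Real.pi * L)⁻¹ ^ 4) * ((∫⁻ s in Ioc 0 t,
              moment 6 (galerkin (n : ℝ) a s)) +
            ∫⁻ s in Ioc 0 t, moment 6 (h s)) := by
          rw [lintegral_add_left' hbm, lintegral_const_mul' _ _ ENNReal.ofReal_ne_top,
            lintegral_add_left' hu6]
      _ ≤ _ := by
          refine add_le_add le_rfl (mul_le_mul' le_rfl (add_le_add ?_ h6))
          exact lintegral_moment_six_galerkin_le hy1 hy hA0 hA ha n ht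
  have hc : Tendsto (fun L : ℕ => ENNReal.ofReal ((2 * Real.pi * L)⁻¹ ^ 4) * (B + B)) atTop
      (𝓝 0) := by
    have h1 : Tendsto (fun L : ℕ => (2 * Real.pi * (L : ℝ))⁻¹ ^ 4) atTop (𝓝 0) := by
      have h2 : Tendsto (fun L : ℕ => 2 * Real.pi * (L : ℝ)) atTop atTop :=
        tendsto_natCast_atTop_atTop.const_mul_atTop (by positivity)
      simpa using h2.inv_tendsto_atTop.pow 4
    have h3 := ENNReal.Tendsto.mul_const (b := B + B) (ENNReal.tendsto_ofReal h1)
      (Or.inr (by simp [hB]))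
    simpa using h3
  rw [ENNReal.tendsto_nhds_zero]
  intro ε hε
  have hε2 : 0 < ε / 2 := ENNReal.half_pos hε.ne'
  obtain ⟨L, hL1, hL2⟩ := ((ENNReal.tendsto_nhds_zero.1 hc (ε / 2) hε2).and
    (eventually_gt_atTop 0)).exists
  filter_upwards [ENNReal.tendsto_nhds_zero.1 (hlow L) (ε / 2) hε2] with n hn
  calc _ ≤ _ := hsplit L hL2 n
    _ ≤ ε / 2 + ε / 2 := add_le_add hn hL1
    _ = ε := ENNReal.add_halves ε

theorem moment_two_limit_le (hy1 : y ≤ 1 / 4) (hy : f2 y = 1) (hA0 : 0 ≤ A)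
    (hA : A < y) (ha : moment 2 a ≤ ENNReal.ofReal A)
    (hlim : TendstoUniformlyOn (fun (n : ℕ) t => galerkin (n : ℝ) a t) h atTop (Ici 0)) {t : ℝ}
    (ht : 0 ≤ t) : moment 2 (h t) ≤ ENNReal.ofReal A :=
  (le_self_add.trans (moment_add_le_of_limit hy1 hy hA0 hA ha hlim ht)).trans ha

/-- The limit of the Galerkin solutions solves the equation. -/
theorem equation_of_limit (hy1 : y ≤ 1 / 4) (hy : f2 y = 1) (hA0 : 0 ≤ A)
    (hA : A < y) (ha : moment 2 a ≤ ENNReal.ofReal A)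
    (hlim : TendstoUniformlyOn (fun (n : ℕ) t => galerkin (n : ℝ) a t) h atTop (Ici 0))
    {φ : Space d → ℝ} (hφ : IsTest φ) {t : ℝ} (ht : 0 ≤ t) :
    IntervalIntegrable (fun s => ∫ x, Real.exp (-weakLap (h s) x) * Laplacian.laplacian φ x)
      volume 0 t ∧
    (∫ x, h t x * φ x) - ∫ x, a x * φ x =
      ∫ s in (0 : ℝ)..t, ∫ x, Real.exp (-weakLap (h s) x) * Laplacian.laplacian φ x := by
  have hh := continuousOn_galerkin_limit hlim
  have hA1 : A ≤ 1 := by linarith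
  have hm1 : ∀ s, 0 ≤ s → moment 2 (h s) ≤ 1 := fun s hs =>
    (moment_two_limit_le hy1 hy hA0 hA ha hlim hs).trans (by simpa using ENNReal.ofReal_le_ofReal hA1)
  have hmt : ∀ s, 0 ≤ s → moment 2 (h s) ≠ ⊤ := fun s hs =>
      ((hm1 s hs).trans_lt ENNReal.one_lt_top).ne
  have hbu : ∀ (n : ℕ) (s : ℝ), 0 ≤ s → bandMoment 2 n (galerkin (n : ℝ) a s) ≤ 1 := fun n s hs =>
    (bandMoment_galerkin_le_of_moment_le (Nat.cast_nonneg n)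
        (by linarith) hy hA0 hA ha hs).trans hA1
  set ψ := Laplacian.laplacian φ with hψ
  set G : ℝ → ℝ := fun s => ∫ x, Real.exp (-weakLap (h s) x) * ψ x with hG
  have hGm : AEStronglyMeasurable G (volume.restrict (Ioc 0 t)) :=
    aestronglyMeasurable_integral_exp hφ.laplacian.1.continuous hφ.laplacian.2 hh hmt t
  have hGi : IntegrableOn G (Ioc 0 t) := by
    refine Integrable.mono' (g := fun _ => Real.exp 1 * ∫ x, |ψ x|)
      (integrable_const _) hGm ?_
    filter_upwards [ae_restrict_mem measurableSet_Ioc] with s hs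
    exact abs_integral_exp_weakLap_le hφ.laplacian.integrable
      (ENNReal.toReal_le_of_le_ofReal zero_le_one (by simpa using hm1 s hs.1.le))
  refine ⟨(intervalIntegrable_iff_integrableOn_Ioc_of_le ht).2 hGi, ?_⟩
  set Gn : ℕ → ℝ → ℝ := fun n s =>
    inner ℝ (nem (cutLap n (galerkin (n : ℝ) a s))) (lowPass (n : ℝ) hφ.laplacian.toL2) with hGn
  have hGnc : ∀ n, Continuous (Gn n) := fun n =>
    (lipschitzWith_nem.continuous.comp
      ((cutLap (n : ℝ)).continuous.comp (continuous_galerkin _ a))).inner continuous_const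
  -- the Galerkin solutions satisfy the equation tested with the projection of `φ`
  have heq : ∀ n : ℕ, inner ℝ (galerkin (n : ℝ) a t) hφ.toL2 - inner ℝ (lowPass (n : ℝ) a) hφ.toL2 =
      ∫ s in Ioc 0 t, Gn n s := by
    intro n
    rw [← intervalIntegral.integral_of_le ht, intervalIntegral.integral_eq_sub_of_hasDerivAt
      (f := fun s => inner ℝ (galerkin (n : ℝ) a s) hφ.toL2)
      (fun s hs => hasDerivAt_inner_galerkin hφ n a (by rw [uIcc_of_le ht] at hs; exact hs.1))
      ((hGnc n).intervalIntegrable _ _), galerkin_zero]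
  -- the errors come from the projection of `Δφ` and from the difference of the Laplacians
  have herr : ∀ (n : ℕ) (s : ℝ), 0 ≤ s → ‖Gn n s - G s‖ₑ ≤
      ENNReal.ofReal (‖lowPass (n : ℝ) hφ.laplacian.toL2 - hφ.laplacian.toL2‖ * Real.exp 1) *
        ENNReal.ofReal (1 + ‖cutLap n (galerkin (n : ℝ) a s)‖ ^ 2) +
      ENNReal.ofReal (Real.exp 1 * ∫ x, |ψ x|) * moment 2 (galerkin (n : ℝ) a s - h s) := by
    intro n s hs
    have hlow := lowPass_galerkin (le_refl (n : ℝ)) a hs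
    have hmu : moment 2 (galerkin (n : ℝ) a s) ≤ 1 := by
      rw [moment_galerkin_eq 2 a hs, ← ENNReal.ofReal_one]
      exact ENNReal.ofReal_le_ofReal (hbu n s hs)
    have hmd : moment 2 (galerkin (n : ℝ) a s - h s) ≠ ⊤ :=
      ((moment_sub_le 2 _ _).trans_lt (ENNReal.add_lt_top.2
        ⟨hmu.trans_lt ENNReal.one_lt_top, (hmt s hs).lt_top⟩)).ne
    have h1 : Gn n s - G s = inner ℝ (nem (cutLap n (galerkin (n : ℝ) a s)))
        (lowPass (n : ℝ) hφ.laplacian.toL2 - hφ.laplacian.toL2) +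
        ((∫ x, Real.exp (-weakLap (galerkin (n : ℝ) a s) x) * ψ x) - G s) := by
      rw [inner_sub_right, inner_nem_cutLap_eq hφ hlow (hbu n s hs)]
      simp only [hGn]
      ring
    have h2 := abs_integral_exp_weakLap_sub_le hφ.laplacian hmu (hm1 s hs)
    have h3 := (abs_real_inner_le_norm (nem (cutLap n (galerkin (n : ℝ) a s)))
      (lowPass (n : ℝ) hφ.laplacian.toL2 - hφ.laplacian.toL2)).trans
      (mul_le_mul_of_nonneg_right (norm_nem_le _) (norm_nonneg _))
    have h4 : ‖cutLap n (galerkin (n : ℝ) a s)‖ ≤ 1 + ‖cutLap n (galerkin (n : ℝ) a s)‖ ^ 2 := by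
      nlinarith [sq_nonneg (‖cutLap n (galerkin (n : ℝ) a s)‖ - 1)]
    rw [← ENNReal.ofReal_mul (by positivity), ← ENNReal.ofReal_toReal hmd,
      ← ENNReal.ofReal_mul (mul_nonneg (Real.exp_pos 1).le (integral_nonneg fun x => abs_nonneg _)),
      ← ENNReal.ofReal_add (by positivity) (mul_nonneg (mul_nonneg (Real.exp_pos 1).le
        (integral_nonneg fun x => abs_nonneg _)) ENNReal.toReal_nonneg), ← ofReal_norm,
      Real.norm_eq_abs, h1]
    refine ENNReal.ofReal_le_ofReal ((abs_add_le _ _).trans (add_le_add (h3.trans ?_) h2))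
    calc Real.exp 1 * ‖cutLap n (galerkin (n : ℝ) a s)‖ *
          ‖lowPass (n : ℝ) hφ.laplacian.toL2 - hφ.laplacian.toL2‖
        = (‖lowPass (n : ℝ) hφ.laplacian.toL2 - hφ.laplacian.toL2‖ * Real.exp 1) *
          ‖cutLap n (galerkin (n : ℝ) a s)‖ := by ring
      _ ≤ _ := mul_le_mul_of_nonneg_left h4 (by positivity)
  set B : ℝ≥0∞ := ENNReal.ofReal (t + Real.exp 1 / 2 * ‖a‖ ^ 2) with hB
  -- the energy estimate controls the first error uniformly in `n`
  have hen : ∀ n : ℕ, ∫⁻ s in Ioc 0 t, ENNReal.ofReal (1 + ‖cutLap n (galerkin (n : ℝ) a s)‖ ^ 2) ≤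
      B := by
    intro n
    have hc : Continuous fun s => ‖cutLap n (galerkin (n : ℝ) a s)‖ ^ 2 :=
      (((cutLap (n : ℝ)).continuous.comp (continuous_galerkin _ a)).norm).pow 2
    have hc1 : Continuous fun s => 1 + ‖cutLap n (galerkin (n : ℝ) a s)‖ ^ 2 := by fun_prop
    rw [← ofReal_integral_eq_lintegral_ofReal hc1.integrableOn_Ioc
      (by filter_upwards with s; simp only [Pi.zero_apply]; positivity),
          ← intervalIntegral.integral_of_le ht,
      intervalIntegral.integral_add (by simp) (hc.intervalIntegrable _ _)]
    refine ENNReal.ofReal_le_ofReal (add_le_add (by simp) ?_)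
    have h1 := integral_norm_sq_cutLap_le n a (hbu n) ht
    rw [Real.exp_neg] at h1
    have h2 := Real.exp_pos 1
    calc ∫ s in (0 : ℝ)..t, ‖cutLap n (galerkin (n : ℝ) a s)‖ ^ 2
        = Real.exp 1 / 2 * (2 * (Real.exp 1)⁻¹ *
          ∫ s in (0 : ℝ)..t, ‖cutLap n (galerkin (n : ℝ) a s)‖ ^ 2) := by field_simp
      _ ≤ _ := mul_le_mul_of_nonneg_left h1 (by positivity)
  have hL1 : Tendsto (fun n => ∫⁻ s in Ioc 0 t, ‖Gn n s - G s‖ₑ) atTop (𝓝 0) := by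
    have t1 : Tendsto (fun n : ℕ => ENNReal.ofReal
        (‖lowPass (n : ℝ) hφ.laplacian.toL2 - hφ.laplacian.toL2‖ * Real.exp 1) * B) atTop
        (𝓝 0) := by
      have h1 := (tendsto_iff_norm_sub_tendsto_zero.1 (tendsto_lowPass hφ.laplacian.toL2)).mul_const
        (Real.exp 1)
      have h2 := ENNReal.Tendsto.mul_const (b := B) (ENNReal.tendsto_ofReal h1)
        (Or.inr ENNReal.ofReal_ne_top)
      simpa using h2
    have t2 := ENNReal.Tendsto.const_mul (a := ENNReal.ofReal (Real.exp 1 * ∫ x, |ψ x|))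
      (tendsto_lintegral_moment_sub hy1 hy hA0 hA ha hlim ht) (Or.inr ENNReal.ofReal_ne_top)
    have t3 := t1.add t2
    rw [mul_zero, add_zero] at t3
    refine tendsto_of_tendsto_of_tendsto_of_le_of_le tendsto_const_nhds t3 (fun _ =>
        bot_le) fun n => ?_
    have hc : Continuous fun s => ‖cutLap n (galerkin (n : ℝ) a s)‖ ^ 2 :=
      (((cutLap (n : ℝ)).continuous.comp (continuous_galerkin _ a)).norm).pow 2
    refine (setLIntegral_mono' measurableSet_Ioc fun s hs => herr n s hs.1.le).trans ?_
    have hc1 : Continuous fun s => 1 + ‖cutLap n (galerkin (n : ℝ) a s)‖ ^ 2 := by fun_prop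
    rw [lintegral_add_left' (AEMeasurable.const_mul hc1.measurable.ennreal_ofReal.aemeasurable _),
      lintegral_const_mul' _ _ ENNReal.ofReal_ne_top,
          lintegral_const_mul' _ _ ENNReal.ofReal_ne_top]
    exact add_le_add (mul_le_mul' le_rfl (hen n)) le_rfl
  have hlimG := tendsto_integral_of_L1 (μ := volume.restrict (Ioc 0 t)) G hGm
    (Eventually.of_forall fun n => (hGnc n).integrableOn_Ioc) hL1
  have hlimu : Tendsto (fun n : ℕ => inner ℝ (galerkin (n : ℝ) a t) hφ.toL2 -
      inner ℝ (lowPass (n : ℝ) a) hφ.toL2) atTop (𝓝 (inner ℝ (h t) hφ.toL2 - inner ℝ a hφ.toL2)) :=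
    ((hlim.tendsto_at (mem_Ici.2 ht)).inner tendsto_const_nhds).sub
      ((tendsto_lowPass a).inner tendsto_const_nhds)
  simp_rw [heq] at hlimu
  rw [intervalIntegral.integral_of_le ht, ← hφ.inner_toL2, ← hφ.inner_toL2]
  exact tendsto_nhds_unique hlimu hlimG

end Limit

/-! ### Existence and decay -/

theorem sNorm_two_eq (u : L2 d) :
    sNorm 2 u = ENNReal.ofReal ((2 * Real.pi) ^ ((d : ℝ) / 2)) * moment 2 u := by
  exact_mod_cast sNorm_eq 2 u

theorem sNorm_six_eq (u : L2 d) :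
    sNorm 6 u = ENNReal.ofReal ((2 * Real.pi) ^ ((d : ℝ) / 2)) * moment 6 u := by
  exact_mod_cast sNorm_eq 6 u

theorem moment_two_le_sNorm (u : L2 d) : moment 2 u ≤ sNorm 2 u := by
  exact_mod_cast moment_le_sNorm 2 u

theorem toReal_sNorm_lt {y : ℝ} {a : L2 d} (ha : sNorm 2 a < ENNReal.ofReal y) :
    (sNorm 2 a).toReal < y := by
  rwa [← ENNReal.ofReal_toReal (ha.trans ENNReal.ofReal_lt_top).ne,
    ENNReal.ofReal_lt_ofReal_iff_of_nonneg ENNReal.toReal_nonneg] at ha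

theorem sigma21_pos {y : ℝ} (hy : f2 y = 1) {a : L2 d} (ha : sNorm 2 a < ENNReal.ofReal y) :
    0 < sigma21 a := by
  have hA := toReal_sNorm_lt ha
  have := f2_strictMonoOn (mem_Ici.2 ENNReal.toReal_nonneg)
    (mem_Ici.2 (ENNReal.toReal_nonneg.trans hA.le)) hA
  rw [sigma21]
  linarith

/-- Existence with the decay estimate. The moments of the data are smaller than their norms, so the
estimates apply with `A = ‖h₀‖₂`; the decay estimate for moments is multiplied by `(2π)^{d/2}`. -/
theorem exists_isSolution {y : ℝ} (hy1 : y ≤ 1 / 4) (hy : f2 y = 1) {a : L2 d}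
    (ha : sNorm 2 a < ENNReal.ofReal y) :
    ∃ h : ℝ → L2 d, IsSolution a h ∧ ∀ t, 0 ≤ t →
      sNorm 2 (h t) + ENNReal.ofReal (sigma21 a) * ∫⁻ τ in Ioc (0 : ℝ) t, sNorm 6 (h τ) ≤
        sNorm 2 a := by
  have hA := toReal_sNorm_lt ha
  have hA0 : 0 ≤ (sNorm 2 a).toReal := ENNReal.toReal_nonneg
  have hm : moment 2 a ≤ ENNReal.ofReal (sNorm 2 a).toReal := by
    rw [ENNReal.ofReal_toReal (ha.trans ENNReal.ofReal_lt_top).ne]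
    exact moment_two_le_sNorm a
  obtain ⟨h, hlim⟩ := exists_tendstoUniformlyOn_galerkin hy1 hy hA0 hA hm
  have hbound : ∀ t, 0 ≤ t → sNorm 2 (h t) +
      ENNReal.ofReal (sigma21 a) * ∫⁻ τ in Ioc (0 : ℝ) t, sNorm 6 (h τ) ≤ sNorm 2 a := by
    intro t ht
    simp_rw [sNorm_two_eq, sNorm_six_eq]
    rw [lintegral_const_mul' _ _ ENNReal.ofReal_ne_top, mul_left_comm, ← mul_add]
    exact mul_le_mul' le_rfl (moment_add_le_of_limit hy1 hy hA0 hA hm hlim ht)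
  have hfin : ∀ t, 0 ≤ t → moment 2 (h t) ≠ ⊤ := fun t ht =>
    ((moment_two_limit_le hy1 hy hA0 hA hm hlim ht).trans_lt ENNReal.ofReal_lt_top).ne
  refine ⟨h, ⟨continuousOn_galerkin_limit hlim, galerkin_limit_zero hlim, fun T => ?_, ?_⟩, hbound⟩
  · exact ⟨sNorm 2 a, (ha.trans ENNReal.ofReal_lt_top).ne, fun t ht =>
      le_self_add.trans (hbound t ht.1)⟩
  · exact ⟨fun t => weakLap (h t), fun t ht => hasWeakLaplacian_weakLap (hfin t ht),
      fun φ hφ t ht => equation_of_limit hy1 hy hA0 hA hm hlim hφ ht⟩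

/-! ### Calculus of gradients and the weighted dissipation estimate -/

/-- The partial derivative in the direction of the `i`-th coordinate. -/
def pd (i : Fin d) (f : Space d → ℝ) (x : Space d) : ℝ :=
  fderiv ℝ f x (EuclideanSpace.basisFun (Fin d) ℝ i)

/-- The inner product of the gradients of `f` and `g`. -/
def gradInner (f g : Space d → ℝ) (x : Space d) : ℝ := ∑ i, pd i f x * pd i g x

theorem contDiff_pd {f : Space d → ℝ} {m n : WithTop ℕ∞} (hf : ContDiff ℝ n f) (h : m + 1 ≤ n)
    (i : Fin d) : ContDiff ℝ m (pd i f) :=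
  (hf.fderiv_right h).clm_apply contDiff_const

theorem contDiff_gradInner {f g : Space d → ℝ} {m n : WithTop ℕ∞} (hf : ContDiff ℝ n f)
    (hg : ContDiff ℝ n g) (h : m + 1 ≤ n) : ContDiff ℝ m (gradInner f g) :=
  ContDiff.sum fun i _ => (contDiff_pd hf h i).mul (contDiff_pd hg h i)

theorem pd_mul {f g : Space d → ℝ} {x : Space d} (hf : DifferentiableAt ℝ f x)
    (hg : DifferentiableAt ℝ g x) (i : Fin d) :
    pd i (fun z => f z * g z) x = f x * pd i g x + g x * pd i f x := by
  rw [pd, fderiv_fun_mul hf hg]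
  simp [pd]

theorem pd_add {f g : Space d → ℝ} {x : Space d} (hf : DifferentiableAt ℝ f x)
    (hg : DifferentiableAt ℝ g x) (i : Fin d) :
    pd i (fun z => f z + g z) x = pd i f x + pd i g x := by
  rw [pd, fderiv_fun_add hf hg]
  simp [pd]

theorem laplacian_eq_sum_pd {f : Space d → ℝ} (hf : ContDiff ℝ 2 f) (x : Space d) :
    Laplacian.laplacian f x = ∑ i, pd i (pd i f) x := by
  rw [congrFun (InnerProductSpace.laplacian_eq_iteratedFDeriv_orthonormalBasis f
    (EuclideanSpace.basisFun (Fin d) ℝ)) x]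
  refine Finset.sum_congr rfl fun i _ => ?_
  have h1 : DifferentiableAt ℝ (fderiv ℝ f) x :=
    ((hf.fderiv_right (m := 1) (by norm_num)).differentiable (by norm_num)).differentiableAt
  rw [iteratedFDeriv_two_apply]
  unfold pd
  rw [fderiv_clm_apply h1 (differentiableAt_const _)]
  simp

theorem continuous_laplacian {f : Space d → ℝ} (hf : ContDiff ℝ 2 f) :
    Continuous (Laplacian.laplacian f) := by
  have : Laplacian.laplacian f = fun x => ∑ i, pd i (pd i f) x := funext (laplacian_eq_sum_pd hf)
  rw [this]
  exact continuous_finsetSum _ fun i _ =>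
    (contDiff_pd (m := 0) (contDiff_pd (m := 1) hf (by norm_num) i) (by norm_num) i).continuous

theorem hasCompactSupport_pd {f : Space d → ℝ} (hf : HasCompactSupport f) (i : Fin d) :
    HasCompactSupport (pd i f) :=
  hf.fderiv_apply (𝕜 := ℝ) _

theorem hasCompactSupport_laplacian {f : Space d → ℝ} (hf : HasCompactSupport f) :
    HasCompactSupport (Laplacian.laplacian f) := by
  rw [InnerProductSpace.laplacian_eq_iteratedFDeriv_orthonormalBasis f
    (EuclideanSpace.basisFun (Fin d) ℝ)]
  exact (hf.iteratedFDeriv (𝕜 := ℝ) 2).comp_left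
    (g := fun T : ContinuousMultilinearMap ℝ (fun _ : Fin 2 => Space d) ℝ =>
      ∑ i, T ![EuclideanSpace.basisFun (Fin d) ℝ i, EuclideanSpace.basisFun (Fin d) ℝ i]) (by simp)

theorem laplacian_mul {f g : Space d → ℝ} (hf : ContDiff ℝ 2 f) (hg : ContDiff ℝ 2 g)
    (x : Space d) : Laplacian.laplacian (fun z => f z * g z) x =
      f x * Laplacian.laplacian g x + 2 * gradInner f g x + g x * Laplacian.laplacian f x := by
  have df : Differentiable ℝ f := hf.differentiable (by norm_num)
  have dg : Differentiable ℝ g := hg.differentiable (by norm_num)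
  have dpf (i) : Differentiable ℝ (pd i f) :=
    (contDiff_pd (m := 1) hf (by norm_num) i).differentiable (by norm_num)
  have dpg (i) : Differentiable ℝ (pd i g) :=
    (contDiff_pd (m := 1) hg (by norm_num) i).differentiable (by norm_num)
  rw [laplacian_eq_sum_pd (hf.mul hg), laplacian_eq_sum_pd hf, laplacian_eq_sum_pd hg, gradInner,
    Finset.mul_sum, Finset.mul_sum, Finset.mul_sum, ← Finset.sum_add_distrib,
        ← Finset.sum_add_distrib]
  refine Finset.sum_congr rfl fun i _ => ?_
  have h : pd i (fun z => f z * g z) = fun z => f z * pd i g z + g z * pd i f z :=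
    funext fun z => pd_mul (df z) (dg z) i
  rw [h, pd_add (f := fun z => f z * pd i g z) (g := fun z => g z * pd i f z)
    ((df x).mul (dpg i x)) ((dg x).mul (dpf i x)), pd_mul (df x) (dpg i x),
    pd_mul (dg x) (dpf i x)]
  ring

theorem gradInner_mul_left {f g k : Space d → ℝ} (hf : Differentiable ℝ f) (hg : Differentiable ℝ g)
    (x : Space d) : gradInner (fun z => f z * g z) k x =
      f x * gradInner g k x + g x * gradInner f k x := by
  simp only [gradInner, Finset.mul_sum, ← Finset.sum_add_distrib]
  refine Finset.sum_congr rfl fun i _ => ?_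
  rw [pd_mul (hf x) (hg x)]
  ring

theorem gradInner_comm (f g : Space d → ℝ) (x : Space d) : gradInner f g x = gradInner g f x := by
  simp only [gradInner, mul_comm]

theorem gradInner_self_nonneg (f : Space d → ℝ) (x : Space d) : 0 ≤ gradInner f f x :=
  Finset.sum_nonneg fun _ _ => mul_self_nonneg _

theorem gradInner_sq_le (f g : Space d → ℝ) (x : Space d) :
    gradInner f g x ^ 2 ≤ gradInner f f x * gradInner g g x := by
  have := Finset.sum_mul_sq_le_sq_mul_sq Finset.univ (fun i => pd i f x) (fun i => pd i g x)
  simpa only [gradInner, ← pow_two] using this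

/-- Green's formula. -/
theorem integral_mul_laplacian_eq {f φ : Space d → ℝ} (hf : ContDiff ℝ 2 f) (hφ : ContDiff ℝ 2 φ)
    (hc : HasCompactSupport φ) :
    ∫ x, f x * Laplacian.laplacian φ x = ∫ x, Laplacian.laplacian f x * φ x := by
  have cf : Continuous f := hf.continuous
  have cφ : Continuous φ := hφ.continuous
  have df : Differentiable ℝ f := hf.differentiable (by norm_num)
  have dφ : Differentiable ℝ φ := hφ.differentiable (by norm_num)
  have p1 {f : Space d → ℝ} (hf : ContDiff ℝ 2 f) (i) : ContDiff ℝ 1 (pd i f) :=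
    contDiff_pd hf (by norm_num) i
  have p2 {f : Space d → ℝ} (hf : ContDiff ℝ 2 f) (i) : Continuous (pd i (pd i f)) :=
    (contDiff_pd (m := 0) (p1 hf i) (by norm_num) i).continuous
  have key (i) : ∫ x, f x * pd i (pd i φ) x = ∫ x, pd i (pd i f) x * φ x := by
    have hcp := hasCompactSupport_pd hc i
    have i1 : Integrable fun x => f x * pd i (pd i φ) x :=
      (cf.mul (p2 hφ i)).integrable_of_hasCompactSupport (hasCompactSupport_pd hcp i).mul_left
    have i2 : Integrable fun x => pd i f x * pd i φ x :=
      ((p1 hf i).continuous.mul (p1 hφ i).continuous).integrable_of_hasCompactSupport hcp.mul_left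
    have i3 : Integrable fun x => f x * pd i φ x :=
      (cf.mul (p1 hφ i).continuous).integrable_of_hasCompactSupport hcp.mul_left
    have i4 : Integrable fun x => pd i (pd i f) x * φ x :=
      ((p2 hf i).mul cφ).integrable_of_hasCompactSupport hc.mul_left
    have i5 : Integrable fun x => pd i f x * φ x :=
      ((p1 hf i).continuous.mul cφ).integrable_of_hasCompactSupport hc.mul_left
    have e1 := integral_mul_fderiv_eq_neg_fderiv_mul_of_integrable (μ := volume)
      (v := EuclideanSpace.basisFun (Fin d) ℝ i) (f := f) (g := pd i φ) i2 i1 i3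
      (fun x _ => df x) (fun x _ => ((p1 hφ i).differentiable (by norm_num)) x)
    have e2 := integral_mul_fderiv_eq_neg_fderiv_mul_of_integrable (μ := volume)
      (v := EuclideanSpace.basisFun (Fin d) ℝ i) (f := pd i f) (g := φ) i4 i2 i5
      (fun x _ => ((p1 hf i).differentiable (by norm_num)) x) (fun x _ => dφ x)
    exact e1.trans (by rw [← neg_eq_iff_eq_neg] at e2; exact e2)
  simp_rw [laplacian_eq_sum_pd hφ, laplacian_eq_sum_pd hf, Finset.mul_sum, Finset.sum_mul]
  rw [integral_finsetSum, integral_finsetSum]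
  · exact Finset.sum_congr rfl fun i _ => key i
  · exact fun i _ => ((p2 hf i).mul cφ).integrable_of_hasCompactSupport hc.mul_left
  · exact fun i _ => (cf.mul (p2 hφ i)).integrable_of_hasCompactSupport
      (hasCompactSupport_pd (hasCompactSupport_pd hc i) i).mul_left

/-- The pointwise form of the weighted estimate: `F` is monotonically coupled to `L = Δγ`, and the
terms in which derivatives fall on the weight are absorbed. -/
theorem weighted_pointwise_le {c C ε η F L G g n D γ : ℝ} (hc : 0 < c)
    (h0 : 0 ≤ η) (h1 : η ≤ 1) (hε : 0 ≤ ε) (hFL : F * L ≤ -c * L ^ 2) (hF : F ^ 2 ≤ C ^ 2 * L ^ 2)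
    (hG : G ^ 2 ≤ n * g) (hn0 : 0 ≤ n) (hg : 0 ≤ g) (hn : n ≤ ε) (hD : |D| ≤ ε) :
    F * (η ^ 4 * L + 8 * η ^ 3 * G + γ * (4 * η ^ 3 * D + 12 * η ^ 2 * n)) ≤
      64 * C ^ 2 / c * ε * (η ^ 2 * (γ * L + g)) +
        ((64 * C ^ 2 / c) ^ 2 / (2 * c) + 256 * C ^ 2 / c) * ε ^ 2 * γ ^ 2 := by
  have young (p q : ℝ) : p * q ≤ c / 4 * p ^ 2 + q ^ 2 / c := by
    have : c / 4 * p ^ 2 + q ^ 2 / c - p * q = (c / 2 * p - q) ^ 2 / c := by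
      field_simp; ring
    have h2 : 0 ≤ (c / 2 * p - q) ^ 2 / c := by positivity
    linarith
  have hη3 : η ^ 3 ≤ η ^ 2 := pow_le_pow_of_le_one h0 h1 (by norm_num)
  set m := 4 * η ^ 3 * D + 12 * η ^ 2 * n with hm
  have hm2 : m ^ 2 ≤ (16 * ε * η ^ 2) ^ 2 := by
    apply sq_le_sq'
    · have h3 := (abs_le.1 hD).1
      have h4 : 0 ≤ η ^ 2 * n := by positivity
      have h5 : -(ε * η ^ 2) ≤ η ^ 3 * D := by
        calc -(ε * η ^ 2) ≤ -(ε * η ^ 3) := by nlinarith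
          _ = η ^ 3 * -ε := by ring
          _ ≤ η ^ 3 * D := mul_le_mul_of_nonneg_left h3 (by positivity)
      have h6 : 0 ≤ ε * η ^ 2 := by positivity
      rw [hm]; nlinarith
    · have h3 := (abs_le.1 hD).2
      have h4 : η ^ 2 * n ≤ η ^ 2 * ε := mul_le_mul_of_nonneg_left hn (by positivity)
      have h5 : η ^ 3 * D ≤ ε * η ^ 2 := by
        calc η ^ 3 * D ≤ η ^ 3 * ε := mul_le_mul_of_nonneg_left h3 (by positivity)
          _ ≤ η ^ 2 * ε := mul_le_mul_of_nonneg_right hη3 hε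
          _ = _ := by ring
      rw [hm]; nlinarith
  have hC2 : 0 ≤ C ^ 2 := sq_nonneg C
  -- strict monotonicity: this negative term has to absorb the others
  have t1 : F * (η ^ 4 * L) ≤ -c * (η ^ 4 * L ^ 2) := by
    calc F * (η ^ 4 * L) = η ^ 4 * (F * L) := by ring
      _ ≤ η ^ 4 * (-c * L ^ 2) := mul_le_mul_of_nonneg_left hFL (by positivity)
      _ = _ := by ring
  -- for `C = 0` the divisions by `C²` below are meaningless, but then `F = 0`
  rcases eq_or_lt_of_le hC2 with hC0 | hCpos
  · have hF0 : F = 0 := by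
      rw [← hC0, zero_mul] at hF
      exact pow_eq_zero_iff (two_ne_zero) |>.1 (le_antisymm hF (sq_nonneg F))
    rw [hF0, ← hC0]
    simp
  have hCne : C ≠ 0 := by rintro rfl; simp at hCpos
  -- the term with `∇η · ∇γ`, by Young's inequality and `F² ≤ C² L²`
  have t2 : F * (8 * η ^ 3 * G) ≤ c / 4 * (η ^ 4 * L ^ 2) + 64 * C ^ 2 / c * ε * (η ^ 2 * g) := by
    have hy : η ^ 2 * F * (8 * η * G) ≤
        c / (4 * C ^ 2) * (η ^ 2 * F) ^ 2 + C ^ 2 * (8 * η * G) ^ 2 / c := by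
      have : c / (4 * C ^ 2) * (η ^ 2 * F) ^ 2 + C ^ 2 * (8 * η * G) ^ 2 / c - η ^ 2 * F * (8 * η *
          G) =
          (c / 2 * (η ^ 2 * F) - C ^ 2 * (8 * η * G)) ^ 2 / (c * C ^ 2) := by
        field_simp; ring
      have h2 : 0 ≤ (c / 2 * (η ^ 2 * F) - C ^ 2 * (8 * η * G)) ^ 2 / (c * C ^ 2) := by positivity
      linarith
    have h3 : c / (4 * C ^ 2) * (η ^ 2 * F) ^ 2 ≤ c / 4 * (η ^ 4 * L ^ 2) := by
      calc c / (4 * C ^ 2) * (η ^ 2 * F) ^ 2 = c / (4 * C ^ 2) * η ^ 4 * F ^ 2 := by ring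
        _ ≤ c / (4 * C ^ 2) * η ^ 4 * (C ^ 2 * L ^ 2) :=
            mul_le_mul_of_nonneg_left hF (by positivity)
        _ = _ := by field_simp
    have h4 : C ^ 2 * (8 * η * G) ^ 2 / c ≤ 64 * C ^ 2 / c * ε * (η ^ 2 * g) := by
      calc C ^ 2 * (8 * η * G) ^ 2 / c = 64 * C ^ 2 / c * η ^ 2 * G ^ 2 := by ring
        _ ≤ 64 * C ^ 2 / c * η ^ 2 * (ε * g) := mul_le_mul_of_nonneg_left
            (hG.trans (mul_le_mul_of_nonneg_right hn hg)) (by positivity)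
        _ = _ := by ring
    calc F * (8 * η ^ 3 * G) = η ^ 2 * F * (8 * η * G) := by ring
      _ ≤ _ := hy
      _ ≤ _ := add_le_add h3 h4
  -- the term in which both derivatives fall on the weight
  have t3 : F * (γ * m) ≤ c / 4 * (η ^ 4 * L ^ 2) + 256 * C ^ 2 / c * ε ^ 2 * γ ^ 2 := by
    have h3 : (F * (γ * m)) ^ 2 ≤ (16 * |C| * ε * |γ| * (η ^ 2 * |L|)) ^ 2 := by
      calc (F * (γ * m)) ^ 2 = F ^ 2 * γ ^ 2 * m ^ 2 := by ring
        _ ≤ (C ^ 2 * L ^ 2) * γ ^ 2 * (16 * ε * η ^ 2) ^ 2 := by gcongr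
        _ = (16 * ε * (η ^ 2)) ^ 2 * |C| ^ 2 * |γ| ^ 2 * |L| ^ 2 := by
          rw [sq_abs, sq_abs, sq_abs]; ring
        _ = _ := by ring
    have h4 := (abs_le_of_sq_le_sq' h3 (by positivity)).2
    have h5 := young (η ^ 2 * |L|) (16 * |C| * ε * |γ|)
    have h6 : (16 * |C| * ε * |γ|) ^ 2 / c = 256 * C ^ 2 / c * ε ^ 2 * γ ^ 2 := by
      calc (16 * |C| * ε * |γ|) ^ 2 / c = 256 * |C| ^ 2 / c * ε ^ 2 * |γ| ^ 2 := by ring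
        _ = _ := by rw [sq_abs, sq_abs]
    have h7 : c / 4 * (η ^ 2 * |L|) ^ 2 = c / 4 * (η ^ 4 * L ^ 2) := by
      rw [mul_pow, sq_abs]; ring
    rw [h6, h7] at h5
    linarith
  -- `g = |∇γ|²` is replaced by `γ L + g = Δ(γ²) / 2`, and `γ L` is absorbed as well
  have t4 : -(64 * C ^ 2 / c * ε * (η ^ 2 * (γ * L))) ≤
      c / 2 * (η ^ 4 * L ^ 2) + (64 * C ^ 2 / c) ^ 2 / (2 * c) * ε ^ 2 * γ ^ 2 := by
    set k := 64 * C ^ 2 / c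
    have : c / 2 * (η ^ 4 * L ^ 2) + k ^ 2 / (2 * c) * ε ^ 2 * γ ^ 2 + k * ε * (η ^ 2 * (γ * L)) =
        (c * (η ^ 2 * L) + k * ε * γ) ^ 2 / (2 * c) := by
      field_simp; ring
    have h2 : 0 ≤ (c * (η ^ 2 * L) + k * ε * γ) ^ 2 / (2 * c) := by positivity
    linarith
  have e : F * (η ^ 4 * L + 8 * η ^ 3 * G + γ * m) =
      F * (η ^ 4 * L) + F * (8 * η ^ 3 * G) + F * (γ * m) := by ring
  have e2 : 64 * C ^ 2 / c * ε * (η ^ 2 * (γ * L + g)) =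
      64 * C ^ 2 / c * ε * (η ^ 2 * (γ * L)) + 64 * C ^ 2 / c * ε * (η ^ 2 * g) := by ring
  have e3 : ((64 * C ^ 2 / c) ^ 2 / (2 * c) + 256 * C ^ 2 / c) * ε ^ 2 * γ ^ 2 =
      (64 * C ^ 2 / c) ^ 2 / (2 * c) * ε ^ 2 * γ ^ 2 + 256 * C ^ 2 / c * ε ^ 2 * γ ^ 2 := by ring
  rw [e, e2, e3]
  linarith

/-- The weighted dissipation estimate. If `F` is comparable to `-Δγ`, then `∫ F Δ(η⁴ γ)` is bounded
by the square of the size of the derivatives of the weight. -/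
theorem integral_mul_laplacian_weight_le {c C ε : ℝ} {γ η F : Space d → ℝ} (hc : 0 < c)
    (hε : 0 ≤ ε) (hγ : ContDiff ℝ 2 γ) (hγ2 : Integrable fun x => γ x ^ 2) (hη : ContDiff ℝ 2 η)
    (hηc : HasCompactSupport η) (h0 : ∀ x, 0 ≤ η x) (h1 : ∀ x, η x ≤ 1)
    (hn : ∀ x, gradInner η η x ≤ ε) (hD : ∀ x, |Laplacian.laplacian η x| ≤ ε)
    (hF : Continuous F) (hFL : ∀ x, F x * Laplacian.laplacian γ x ≤ -c *
        Laplacian.laplacian γ x ^ 2)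
    (hFC : ∀ x, F x ^ 2 ≤ C ^ 2 * Laplacian.laplacian γ x ^ 2) :
    ∫ x, F x * Laplacian.laplacian (fun z => η z ^ 4 * γ z) x ≤
      (128 * C ^ 2 / c + ((64 * C ^ 2 / c) ^ 2 / (2 * c) + 256 * C ^ 2 / c)) * ε ^ 2 *
        ∫ x, γ x ^ 2 := by
  set K := (64 * C ^ 2 / c) ^ 2 / (2 * c) + 256 * C ^ 2 / c with hK
  set q : Space d → ℝ := fun z => η z * η z with hq
  have hqc : ContDiff ℝ 2 q := hη.mul hη
  have dη : Differentiable ℝ η := hη.differentiable (by norm_num)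
  have dq : Differentiable ℝ q := hqc.differentiable (by norm_num)
  have hqs : HasCompactSupport q := hηc.mul_left
  have hρ : (fun z => η z ^ 4 * γ z) = fun z => (fun z => q z * q z) z * γ z := by
    ext z; simp only [hq]; ring
  have hlapq (x) : Laplacian.laplacian q x =
      2 * η x * Laplacian.laplacian η x + 2 * gradInner η η x := by
    rw [hq, laplacian_mul hη hη]; ring
  have hgq (k : Space d → ℝ) (x) : gradInner q k x = 2 * η x * gradInner η k x := by
    rw [hq, gradInner_mul_left dη dη]; ring
  have hlap (x) : Laplacian.laplacian (fun z => η z ^ 4 * γ z) x =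
      η x ^ 4 * Laplacian.laplacian γ x + 8 * η x ^ 3 * gradInner η γ x +
        γ x * (4 * η x ^ 3 * Laplacian.laplacian η x + 12 * η x ^ 2 * gradInner η η x) := by
    rw [hρ, laplacian_mul (hqc.mul hqc) hγ, laplacian_mul hqc hqc, gradInner_mul_left dq dq,
      hgq, hlapq, hgq, gradInner_comm η q, hgq]
    simp only [hq]
    ring
  have hγγ : ContDiff ℝ 2 fun z => γ z * γ z := hγ.mul hγ
  -- this identity expresses `γ Δγ + |∇γ|²` by a Laplacian, which is integrated by parts below
  have hlap2 (x) : Laplacian.laplacian (fun z => γ z * γ z) x =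
      2 * (γ x * Laplacian.laplacian γ x + gradInner γ γ x) := by
    rw [laplacian_mul hγ hγ]; ring
  have hpt (x) : F x * Laplacian.laplacian (fun z => η z ^ 4 * γ z) x ≤
      32 * C ^ 2 / c * ε * (Laplacian.laplacian (fun z => γ z * γ z) x * q x) + K * ε ^ 2 *
          γ x ^ 2 := by
    rw [hlap]
    refine (weighted_pointwise_le hc (h0 x) (h1 x) hε (hFL x) (hFC x) (gradInner_sq_le η γ x)
      (gradInner_self_nonneg η x) (gradInner_self_nonneg γ x) (hn x) (hD x)).trans (le_of_eq ?_)
    rw [hlap2, ← hK]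
    simp only [hq]
    ring
  have i1 : Integrable fun x => Laplacian.laplacian (fun z => γ z * γ z) x * q x :=
    ((continuous_laplacian hγγ).mul hqc.continuous).integrable_of_hasCompactSupport hqs.mul_left
  have cρ : ContDiff ℝ 2 fun z => η z ^ 4 * γ z := (hη.pow 4).mul hγ
  have sρ : HasCompactSupport fun z => η z ^ 4 * γ z :=
    HasCompactSupport.mul_right (hηc.comp_left (g := fun t => t ^ 4) (by norm_num))
  have i2 : Integrable fun x => F x * Laplacian.laplacian (fun z => η z ^ 4 * γ z) x :=
    (hF.mul (continuous_laplacian cρ)).integrable_of_hasCompactSupport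
      (hasCompactSupport_laplacian sρ).mul_left
  have i3 : Integrable fun x => γ x * γ x * Laplacian.laplacian q x :=
    ((hγ.continuous.mul hγ.continuous).mul (continuous_laplacian hqc)).integrable_of_hasCompactSupport
      (hasCompactSupport_laplacian hqs).mul_left
  -- by Green's formula both derivatives fall on `η²`, which yields a second factor `ε`
  have hgreen : ∫ x, Laplacian.laplacian (fun z => γ z * γ z) x * q x ≤ 4 * ε * ∫ x, γ x ^ 2 := by
    rw [← integral_mul_laplacian_eq hγγ hqc hqs, ← integral_const_mul]
    refine integral_mono i3 (hγ2.const_mul _) fun x => ?_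
    have h2 : Laplacian.laplacian q x ≤ 4 * ε := by
      rw [hlapq]
      have h3 := (abs_le.1 (hD x)).2
      have h4 := hn x
      have h5 : η x * Laplacian.laplacian η x ≤ ε := by
        calc η x * Laplacian.laplacian η x ≤ η x * ε := mul_le_mul_of_nonneg_left h3 (h0 x)
          _ ≤ 1 * ε := mul_le_mul_of_nonneg_right (h1 x) hε
          _ = ε := one_mul ε
      linarith
    have := mul_le_mul_of_nonneg_left h2 (sq_nonneg (γ x))
    change γ x * γ x * Laplacian.laplacian q x ≤ 4 * ε * γ x ^ 2
    nlinarith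
  calc ∫ x, F x * Laplacian.laplacian (fun z => η z ^ 4 * γ z) x
      ≤ ∫ x, (32 * C ^ 2 / c * ε * (Laplacian.laplacian (fun z => γ z * γ z) x * q x) +
          K * ε ^ 2 * γ x ^ 2) :=
        integral_mono i2 ((i1.const_mul _).add (hγ2.const_mul _)) hpt
    _ = 32 * C ^ 2 / c * ε * (∫ x, Laplacian.laplacian (fun z => γ z * γ z) x * q x) +
          K * ε ^ 2 * ∫ x, γ x ^ 2 := by
        rw [integral_add (i1.const_mul _) (hγ2.const_mul _), integral_const_mul, integral_const_mul]
    _ ≤ 32 * C ^ 2 / c * ε * (4 * ε * ∫ x, γ x ^ 2) + K * ε ^ 2 * ∫ x, γ x ^ 2 := by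
        have : 0 ≤ 32 * C ^ 2 / c * ε := by positivity
        linarith [mul_le_mul_of_nonneg_left hgreen this]
    _ = _ := by ring

/-! ### The regular representative -/

/-- The inverse Fourier integral of the Fourier transform of `u`: the regular representative of `u`,
which is twice continuously differentiable if `moment 2 u` is finite. -/
def contRep (u : L2 d) (x : Space d) : ℝ := (𝓕⁻ (FT u : Space d → ℂ) x).re

theorem measurable_moment_integrand (k : ℕ) (u : L2 d) : Measurable fun ξ : Space d =>
    ENNReal.ofReal ((2 * Real.pi * ‖ξ‖) ^ k) * ‖FT u ξ‖ₑ := by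
  have := measurable_FT u
  fun_prop

theorem moment_zero_eq (u : L2 d) : moment 0 u = ∫⁻ ξ, ‖FT u ξ‖ₑ := by simp [moment]

theorem moment_zero_le (u : L2 d) :
    moment 0 u ≤ ENNReal.ofReal (bandMoment 0 1 u) + moment 2 u := by
  have hs : MeasurableSet (Metric.closedBall (0 : Space d) 1) :=
    Metric.isClosed_closedBall.measurableSet
  rw [ofReal_bandMoment, moment, ← lintegral_add_compl _ hs]
  refine add_le_add le_rfl ?_
  refine le_trans ?_ (setLIntegral_le_lintegral (Metric.closedBall (0 : Space d) 1)ᶜ _)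
  refine setLIntegral_mono (measurable_moment_integrand 2 u) fun ξ hξ => ?_
  have hξ' : 1 < ‖ξ‖ := by simpa using hξ
  refine mul_le_mul' (ENNReal.ofReal_le_ofReal ?_) le_rfl
  rw [pow_zero]
  refine one_le_pow₀ ?_
  nlinarith [Real.pi_gt_three]

theorem moment_zero_ne_top {u : L2 d} (hu : moment 2 u ≠ ⊤) : moment 0 u ≠ ⊤ :=
  ((moment_zero_le u).trans_lt (ENNReal.add_lt_top.2 ⟨ENNReal.ofReal_lt_top, hu.lt_top⟩)).ne

theorem moment_one_le (u : L2 d) : moment 1 u ≤ moment 0 u + moment 2 u := by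
  unfold moment
  rw [← lintegral_add_left (measurable_moment_integrand 0 u)]
  refine lintegral_mono fun ξ => ?_
  rw [← add_mul, ← ENNReal.ofReal_add (by positivity) (by positivity)]
  refine mul_le_mul' (ENNReal.ofReal_le_ofReal ?_) le_rfl
  nlinarith [sq_nonneg (2 * Real.pi * ‖ξ‖ - 1)]

theorem moment_one_ne_top {u : L2 d} (hu : moment 2 u ≠ ⊤) : moment 1 u ≠ ⊤ :=
  ((moment_one_le u).trans_lt (ENNReal.add_lt_top.2 ⟨(moment_zero_ne_top hu).lt_top, hu.lt_top⟩)).ne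

theorem integrable_moment_integrand {k : ℕ} {u : L2 d} (hu : moment k u ≠ ⊤) :
    Integrable fun ξ : Space d => (2 * Real.pi * ‖ξ‖) ^ k * ‖FT u ξ‖ := by
  refine ⟨(by have := measurable_FT u; fun_prop : Measurable _).aestronglyMeasurable, ?_⟩
  rw [HasFiniteIntegral]
  refine lt_of_eq_of_lt ?_ hu.lt_top
  refine lintegral_congr fun ξ => ?_
  rw [← ofReal_norm, norm_mul, norm_norm, Real.norm_of_nonneg (by positivity),
    ENNReal.ofReal_mul (by positivity), ofReal_norm]

theorem integral_moment_integrand (k : ℕ) (u : L2 d) :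
    ∫ ξ : Space d, (2 * Real.pi * ‖ξ‖) ^ k * ‖FT u ξ‖ = (moment k u).toReal := by
  rw [integral_eq_lintegral_of_nonneg_ae (by filter_upwards with ξ; simp only [Pi.zero_apply]; positivity)
    (by have := measurable_FT u; fun_prop : Measurable _).aestronglyMeasurable]
  congr 1
  refine lintegral_congr fun ξ => ?_
  rw [ENNReal.ofReal_mul (by positivity), ofReal_norm]

theorem integrable_pow_mul_FT {k : ℕ} {u : L2 d} (hu : moment k u ≠ ⊤) :
    Integrable fun ξ : Space d => ‖ξ‖ ^ k * ‖FT u ξ‖ := by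
  have h := (integrable_moment_integrand hu).const_mul ((2 * Real.pi) ^ k)⁻¹
  refine h.congr ?_
  filter_upwards with ξ
  have hp : (2 * Real.pi) ^ k ≠ 0 := by positivity
  rw [mul_pow (2 * Real.pi) ‖ξ‖ k, mul_assoc ((2 * Real.pi) ^ k), inv_mul_cancel_left₀ hp]

theorem integrable_FT {u : L2 d} (hu : moment 2 u ≠ ⊤) : Integrable (FT u : Space d → ℂ) :=
  ⟨Lp.aestronglyMeasurable _, by
    rw [HasFiniteIntegral, ← moment_zero_eq]; exact (moment_zero_ne_top hu).lt_top⟩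

theorem coeFn_ae_eq_contRep {u : L2 d} (hu : moment 2 u ≠ ⊤) : u =ᵐ[volume] contRep u := by
  filter_upwards [ae_eq_fourierInv_FT (integrable_FT hu)] with x hx
  rw [contRep, ← hx, Complex.ofReal_re]

theorem contRep_eq (u : L2 d) : contRep u = fun x => (𝓕 (fun ξ => FT u (-ξ)) x).re := by
  ext x
  rw [contRep, Real.fourierInv_eq_fourier_comp_neg]

theorem contDiff_contRep_of_moment {u : L2 d} {N : ℕ∞} (hu : ∀ n : ℕ, n ≤ N → moment n u ≠ ⊤) :
    ContDiff ℝ N (contRep u) := by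
  rw [contRep_eq]
  refine Complex.reCLM.contDiff.comp (Real.contDiff_fourier fun n hn => ?_)
  have h := (integrable_pow_mul_FT (hu n hn)).comp_neg
  simpa using h

theorem contDiff_contRep {u : L2 d} (hu : moment 2 u ≠ ⊤) : ContDiff ℝ 2 (contRep u) := by
  refine contDiff_contRep_of_moment (N := 2) fun n hn => ?_
  have hn' : n ≤ 2 := by exact_mod_cast hn
  interval_cases n
  · exact moment_zero_ne_top hu
  · exact moment_one_ne_top hu
  · exact hu

theorem contDiff_contRep_lowPass (N : ℝ) (u : L2 d) : ContDiff ℝ ∞ (contRep (lowPass N u)) :=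
  contDiff_contRep_of_moment fun n _ => moment_lowPass_ne_top n N u

theorem abs_contRep_le (u : L2 d) (x : Space d) : |contRep u x| ≤ (moment 0 u).toReal := by
  refine (Complex.abs_re_le_norm _).trans ((norm_fourierInv_le _ x).trans (le_of_eq ?_))
  rw [← integral_moment_integrand]
  simp

theorem abs_pd_contRep_le {u : L2 d} (hu : moment 2 u ≠ ⊤) (i : Fin d) (x : Space d) :
    |pd i (contRep u) x| ≤ (moment 1 u).toReal := by
  have h0 : Integrable fun ξ => FT u (-ξ) := (integrable_FT hu).comp_neg
  have h1 : Integrable fun ξ : Space d => ‖ξ‖ * ‖FT u (-ξ)‖ := by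
    simpa using (integrable_pow_mul_FT (moment_one_ne_top hu)).comp_neg
  have hd := Real.hasFDerivAt_fourier h0 h1 x
  have hd2 := Complex.reCLM.hasFDerivAt.comp x hd
  have h2 : ∫ ξ : Space d, 2 * Real.pi * ‖ξ‖ * ‖FT u (-ξ)‖ = (moment 1 u).toReal := by
    rw [← integral_moment_integrand, ← integral_neg_eq_self
      (fun ξ : Space d => (2 * Real.pi * ‖ξ‖) ^ 1 * ‖FT u ξ‖)]
    simp
  have he : contRep u = Complex.reCLM ∘ 𝓕 (fun ξ => FT u (-ξ)) := contRep_eq u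
  rw [pd, he, hd2.fderiv, ContinuousLinearMap.comp_apply, Complex.reCLM_apply]
  refine (Complex.abs_re_le_norm _).trans ?_
  refine (ContinuousLinearMap.le_opNorm _ _).trans ?_
  rw [OrthonormalBasis.norm_eq_one, mul_one, Real.fourier_eq]
  refine (norm_integral_le_integral_norm _).trans ?_
  rw [← h2]
  refine integral_mono_of_nonneg (by filter_upwards with ξ; exact norm_nonneg _) ?_ ?_
  · have := h1.const_mul (2 * Real.pi)
    simpa only [mul_assoc] using this
  · filter_upwards with ξ
    rw [Circle.norm_smul]
    refine (VectorFourier.norm_fourierSMulRight_le _ _ _).trans ?_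
    have : ‖innerSL ℝ (E := Space d)‖ ≤ 1 := norm_innerSL_le ℝ
    have h3 : 0 ≤ 2 * Real.pi * (‖ξ‖ * ‖FT u (-ξ)‖) := by positivity
    nlinarith

theorem laplacian_contRep {u : L2 d} (hu : moment 2 u ≠ ⊤) :
    Laplacian.laplacian (contRep u) = weakLap u := by
  have hc := contDiff_contRep hu
  have hw : HasWeakLaplacian u (Laplacian.laplacian (contRep u)) := by
    refine ⟨(continuous_laplacian hc).locallyIntegrable, fun φ hφ => ?_⟩
    rw [← integral_mul_laplacian_eq hc hφ.two hφ.2]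
    apply integral_congr_ae
    filter_upwards [coeFn_ae_eq_contRep hu] with x hx
    rw [hx]
  exact (Continuous.ae_eq_iff_eq volume (continuous_laplacian hc) (continuous_weakLap hu)).1
    (hw.ae_eq hu)

theorem contRep_sub {u v : L2 d} (hu : moment 2 u ≠ ⊤) (hv : moment 2 v ≠ ⊤) (x : Space d) :
    contRep (u - v) x = contRep u x - contRep v x := by
  rw [contRep, contRep, contRep, ← Complex.sub_re,
    ← fourierInv_sub_of_integrable (integrable_FT hu) (integrable_FT hv)]
  congr 1
  refine congrFun (fourierInv_congr_ae ?_) x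
  rw [FT.map_sub]
  filter_upwards [Lp.coeFn_sub (FT u) (FT v)] with ξ h
  rw [h, Pi.sub_apply]

theorem moment_sub_ne_top {k : ℕ} {u v : L2 d} (hu : moment k u ≠ ⊤) (hv : moment k v ≠ ⊤) :
    moment k (u - v) ≠ ⊤ :=
  ((moment_sub_le k u v).trans_lt (ENNReal.add_lt_top.2 ⟨hu.lt_top, hv.lt_top⟩)).ne

/-- The Laplacian of a localised regular representative is controlled by the moments. -/
theorem exists_laplacian_mul_contRep_le {ρ : Space d → ℝ} (hρ : ContDiff ℝ 2 ρ)
    (hc : HasCompactSupport ρ) : ∃ K : ℝ, 0 ≤ K ∧ ∀ u : L2 d, moment 2 u ≠ ⊤ → ∀ x,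
      |Laplacian.laplacian (fun z => ρ z * contRep u z) x| ≤ K * (moment 0 u +
          moment 2 u).toReal := by
  have hp (i) : Continuous (pd i ρ) := (contDiff_pd (m := 1) hρ (by norm_num) i).continuous
  obtain ⟨K₁, h1⟩ := hc.exists_bound_of_continuous hρ.continuous
  obtain ⟨K₂, h2⟩ := (hasCompactSupport_laplacian hc).exists_bound_of_continuous (continuous_laplacian hρ)
  choose K₃ h3 using fun i => (hasCompactSupport_pd hc i).exists_bound_of_continuous (hp i)
  have k1 : 0 ≤ K₁ := (norm_nonneg _).trans (h1 0)
  have k2 : 0 ≤ K₂ := (norm_nonneg _).trans (h2 0)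
  have k3 (i) : 0 ≤ K₃ i := (norm_nonneg _).trans (h3 i 0)
  have k4 : 0 ≤ ∑ i, K₃ i := Finset.sum_nonneg fun i _ => k3 i
  refine ⟨K₁ + 2 * (∑ i, K₃ i) + K₂, by positivity, fun u hu x => ?_⟩
  have hu0 := moment_zero_ne_top hu
  have hu02 : moment 0 u + moment 2 u ≠ ⊤ := ENNReal.add_ne_top.2 ⟨hu0, hu⟩
  set S := (moment 0 u + moment 2 u).toReal with hS
  have s0 : |contRep u x| ≤ S := (abs_contRep_le u x).trans (ENNReal.toReal_mono hu02 le_self_add)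
  have s1 (i) : |pd i (contRep u) x| ≤ S :=
    (abs_pd_contRep_le hu i x).trans (ENNReal.toReal_mono hu02 (moment_one_le u))
  have s2 : |Laplacian.laplacian (contRep u) x| ≤ S := by
    rw [laplacian_contRep hu]
    exact (abs_weakLap_le u x).trans (ENNReal.toReal_mono hu02 le_add_self)
  have hS0 : 0 ≤ S := ENNReal.toReal_nonneg
  rw [laplacian_mul hρ (contDiff_contRep hu)]
  have hg : |gradInner ρ (contRep u) x| ≤ (∑ i, K₃ i) * S := by
    rw [gradInner, Finset.sum_mul]
    refine (Finset.abs_sum_le_sum_abs _ _).trans (Finset.sum_le_sum fun i _ => ?_)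
    rw [abs_mul]
    exact mul_le_mul (h3 i x) (s1 i) (abs_nonneg _) (k3 i)
  have ha : |ρ x * Laplacian.laplacian (contRep u) x| ≤ K₁ * S := by
    rw [abs_mul]; exact mul_le_mul (h1 x) s2 (abs_nonneg _) k1
  have hb : |contRep u x * Laplacian.laplacian ρ x| ≤ S * K₂ := by
    rw [abs_mul]; exact mul_le_mul s0 (h2 x) (abs_nonneg _) hS0
  calc _ ≤ |ρ x * Laplacian.laplacian (contRep u) x| + |2 * gradInner ρ (contRep u) x| +
        |contRep u x * Laplacian.laplacian ρ x| := abs_add_three _ _ _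
    _ ≤ K₁ * S + 2 * ((∑ i, K₃ i) * S) + S * K₂ := by
        rw [abs_mul 2, abs_of_pos (two_pos : (0 : ℝ) < 2)]
        linarith
    _ = _ := by ring

/-! ### Pairing with localised Laplacians -/

/-- The size of the zeroth and second moments. -/
def momentNorm (u : L2 d) : ℝ := (moment 0 u + moment 2 u).toReal

theorem momentNorm_nonneg (u : L2 d) : 0 ≤ momentNorm u := ENNReal.toReal_nonneg

theorem exists_momentNorm_le (d : ℕ) : ∃ C : ℝ, 0 ≤ C ∧ ∀ u : L2 d, moment 2 u ≠ ⊤ →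
    momentNorm u ≤ C * ‖u‖ + 2 * (moment 2 u).toReal := by
  obtain ⟨C, hC, h⟩ := exists_bandMoment_le d 0 zero_le_one
  refine ⟨C, hC, fun u hu => ?_⟩
  have h2 : (moment 0 u).toReal ≤ C * ‖u‖ + (moment 2 u).toReal := by
    have := ENNReal.toReal_mono (ENNReal.add_ne_top.2 ⟨ENNReal.ofReal_ne_top, hu⟩)
        (moment_zero_le u)
    rw [ENNReal.toReal_add ENNReal.ofReal_ne_top hu,
        ENNReal.toReal_ofReal (bandMoment_nonneg _ _ _)]
      at this
    linarith [h u]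
  rw [momentNorm, ENNReal.toReal_add (moment_zero_ne_top hu) hu]
  linarith

theorem tendsto_momentNorm_lowPass_sub {u : L2 d} (hu : moment 2 u ≠ ⊤) :
    Tendsto (fun n : ℕ => momentNorm (lowPass (n : ℝ) u - u)) atTop (𝓝 0) := by
  have h := (tendsto_moment_lowPass_sub 0 (moment_zero_ne_top hu)).add (tendsto_moment_lowPass_sub 2 hu)
  rw [add_zero] at h
  exact (ENNReal.tendsto_toReal ENNReal.zero_ne_top).comp h

/-- The pairing `∫ f Δ(ρ u)`. -/
def lapPair (f ρ : Space d → ℝ) (u : L2 d) : ℝ :=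
  ∫ x, f x * Laplacian.laplacian (fun z => ρ z * contRep u z) x

section Pairing

variable {ρ : Space d → ℝ}

theorem contDiff_mul_contRep (hρ : ContDiff ℝ 2 ρ) {u : L2 d} (hu : moment 2 u ≠ ⊤) :
    ContDiff ℝ 2 fun z => ρ z * contRep u z := hρ.mul (contDiff_contRep hu)

theorem laplacian_mul_contRep_eq_zero (u : L2 d) {x : Space d} (hx : x ∉ tsupport ρ) :
    Laplacian.laplacian (fun z => ρ z * contRep u z) x = 0 := by
  have h : (fun z => ρ z * contRep u z) =ᶠ[𝓝 x] fun _ => 0 := by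
    have := (isClosed_tsupport ρ).isOpen_compl.mem_nhds hx
    filter_upwards [this] with z hz
    rw [image_eq_zero_of_notMem_tsupport hz, zero_mul]
  rw [(InnerProductSpace.laplacian_congr_nhds h).eq_of_nhds]
  simp

theorem integrable_lapPair (hρ : ContDiff ℝ 2 ρ) (hc : HasCompactSupport ρ) {f : Space d → ℝ}
    (hf : Continuous f) {u : L2 d} (hu : moment 2 u ≠ ⊤) :
    Integrable fun x => f x * Laplacian.laplacian (fun z => ρ z * contRep u z) x :=
  (hf.mul (continuous_laplacian (contDiff_mul_contRep hρ hu))).integrable_of_hasCompactSupport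
    (hasCompactSupport_laplacian hc.mul_right).mul_left

theorem lapPair_sub (hρ : ContDiff ℝ 2 ρ) (hc : HasCompactSupport ρ) {f : Space d → ℝ}
    (hf : Continuous f) {u v : L2 d} (hu : moment 2 u ≠ ⊤) (hv : moment 2 v ≠ ⊤) :
    lapPair f ρ (u - v) = lapPair f ρ u - lapPair f ρ v := by
  unfold lapPair
  rw [← integral_sub (integrable_lapPair hρ hc hf hu) (integrable_lapPair hρ hc hf hv)]
  congr 1; ext x
  have h : (fun z => ρ z * contRep (u - v) z) =
      (fun z => ρ z * contRep u z) - fun z => ρ z * contRep v z := by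
    ext z
    rw [contRep_sub hu hv, Pi.sub_apply, mul_sub]
  rw [h, (contDiff_mul_contRep hρ hu).contDiffAt.laplacian_sub
    (contDiff_mul_contRep hρ hv).contDiffAt, mul_sub]

/-- The pairing is bounded by the `L¹` norm of `f` on the support of the weight. -/
theorem exists_abs_lapPair_le (hρ : ContDiff ℝ 2 ρ) (hc : HasCompactSupport ρ) :
    ∃ K : ℝ, 0 ≤ K ∧ ∀ (f : Space d → ℝ), IntegrableOn f (tsupport ρ) → ∀ u : L2 d, moment 2 u ≠ ⊤ →
      |lapPair f ρ u| ≤ K * momentNorm u * ∫ x in tsupport ρ, |f x| := by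
  obtain ⟨K, hK, h⟩ := exists_laplacian_mul_contRep_le hρ hc
  refine ⟨K, hK, fun f hf u hu => ?_⟩
  have hs : MeasurableSet (tsupport ρ) := (isClosed_tsupport ρ).measurableSet
  rw [lapPair, ← integral_const_mul, ← integral_indicator hs, ← Real.norm_eq_abs]
  refine norm_integral_le_of_norm_le ((integrable_indicator_iff hs).2 (hf.abs.const_mul _)) ?_
  filter_upwards with x
  by_cases hx : x ∈ tsupport ρ
  · rw [indicator_of_mem hx, norm_mul, Real.norm_eq_abs, Real.norm_eq_abs, mul_comm]
    exact mul_le_mul_of_nonneg_right (h u hu x) (abs_nonneg _)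
  · rw [indicator_of_notMem hx, laplacian_mul_contRep_eq_zero u hx, mul_zero, norm_zero]

/-- The pairing is sequentially continuous for `L²` convergence with bounded second moments:
replacing `f` by a test function turns it into an `L²` inner product. -/
theorem tendsto_lapPair {ι : Type*} {l : Filter ι} (hρ : ContDiff ℝ ∞ ρ) (hc : HasCompactSupport ρ)
    {f : Space d → ℝ} (hf : Continuous f) {v : ι → L2 d} {u : L2 d} {C : ℝ}
    (hu : moment 2 u ≠ ⊤) (huC : momentNorm u ≤ C) (hv : ∀ᶠ i in l, moment 2 (v i) ≠ ⊤)
    (hvC : ∀ᶠ i in l, momentNorm (v i) ≤ C) (h : Tendsto v l (𝓝 u)) :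
    Tendsto (fun i => lapPair f ρ (v i)) l (𝓝 (lapPair f ρ u)) := by
  have hρ2 : ContDiff ℝ 2 ρ := by exact_mod_cast contDiff_infty.1 hρ 2
  obtain ⟨K, hK, hb⟩ := exists_abs_lapPair_le hρ2 hc
  have hC : 0 ≤ C := (momentNorm_nonneg u).trans huC
  have hs : MeasurableSet (tsupport ρ) := (isClosed_tsupport ρ).measurableSet
  rw [Metric.tendsto_nhds]
  intro ε hε
  set δ := ε / (3 * (K * C + 1)) with hδ
  have hKC : 0 < K * C + 1 := by positivity
  have hδ0 : 0 < δ := by positivity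
  have hfi : IntegrableOn f (tsupport ρ) := hf.continuousOn.integrableOn_compact hc
  obtain ⟨k, k1, k2, k3⟩ := MemLp.exist_eLpNorm_sub_le (p := 1) ENNReal.one_ne_top le_rfl
    (memLp_one_iff_integrable.2 ((integrable_indicator_iff hs).2 hfi)) hδ0
  have hk2 : ContDiff ℝ 2 k := by exact_mod_cast contDiff_infty.1 k2 2
  have hkt : IsTest k := ⟨k2, k1⟩
  have hki : Integrable k := hkt.integrable
  have hfk : ∫ x in tsupport ρ, |f x - k x| ≤ δ := by
    have e1 : ∫ x in tsupport ρ, |f x - k x| ≤ ∫ x, |(tsupport ρ).indicator f x - k x| := by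
      have i1 : Integrable fun x => |(tsupport ρ).indicator f x - k x| :=
        (((integrable_indicator_iff hs).2 hfi).sub hki).abs
      refine le_trans (le_of_eq ?_) (setIntegral_le_integral (s := tsupport ρ) i1
        (by filter_upwards with x; exact abs_nonneg _))
      refine setIntegral_congr_fun hs fun x hx => ?_
      simp only [indicator_of_mem hx]
    refine e1.trans ?_
    rw [eLpNorm_one_eq_lintegral_enorm] at k3
    have e2 : ∫ x, |(tsupport ρ).indicator f x - k x| =
        (∫⁻ x, ‖((tsupport ρ).indicator f - k) x‖ₑ).toReal := by
      rw [← integral_norm_eq_lintegral_enorm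
        (((integrable_indicator_iff hs).2 hfi).sub hki).aestronglyMeasurable]
      rfl
    rw [e2]
    exact ENNReal.toReal_le_of_le_ofReal hδ0.le k3
  -- replacing `f` by the test function `k` costs little, uniformly in `w`
  have herr : ∀ w : L2 d, moment 2 w ≠ ⊤ → momentNorm w ≤ C →
      |lapPair f ρ w - lapPair k ρ w| ≤ ε / 3 := by
    intro w hw hwC
    have e1 : lapPair f ρ w - lapPair k ρ w = lapPair (fun x => f x - k x) ρ w := by
      unfold lapPair
      rw [← integral_sub (integrable_lapPair hρ2 hc hf hw)
        (integrable_lapPair hρ2 hc k2.continuous hw)]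
      congr 1; ext x; ring
    rw [e1]
    refine (hb _ (hfi.sub hki.integrableOn) w hw).trans ?_
    calc K * momentNorm w * ∫ x in tsupport ρ, |f x - k x| ≤ K * C * δ :=
          mul_le_mul (mul_le_mul_of_nonneg_left hwC hK) hfk
            (integral_nonneg fun x => abs_nonneg _) (by positivity)
      _ ≤ (K * C + 1) * δ := by nlinarith
      _ = ε / 3 := by rw [hδ]; field_simp
  -- by Green's formula the pairing with `k` is an `L²` inner product with `ρ Δk`
  have ht : IsTest fun x => ρ x * Laplacian.laplacian k x :=
    ⟨hρ.mul hkt.laplacian.1, hc.mul_right⟩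
  have hpk : ∀ w : L2 d, moment 2 w ≠ ⊤ → lapPair k ρ w = inner ℝ w ht.toL2 := by
    intro w hw
    rw [lapPair, integral_mul_laplacian_eq hk2 (contDiff_mul_contRep hρ2 hw) hc.mul_right,
      ht.inner_toL2]
    apply integral_congr_ae
    filter_upwards [coeFn_ae_eq_contRep hw] with x hx
    rw [hx]; ring
  have hlim : Tendsto (fun i => inner ℝ (v i) ht.toL2) l (𝓝 (inner ℝ u ht.toL2)) :=
    h.inner tendsto_const_nhds
  filter_upwards [hv, hvC, Metric.tendsto_nhds.1 hlim (ε / 3) (by positivity)] with i h1 h2 h3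
  rw [← hpk _ h1, ← hpk _ hu, Real.dist_eq] at h3
  have h4 := herr _ h1 h2
  have h5 := herr _ hu huC
  rw [Real.dist_eq]
  rw [abs_le] at h4 h5
  rw [abs_lt] at h3 ⊢
  constructor <;> linarith [h4.1, h4.2, h5.1, h5.2, h3.1, h3.2]

end Pairing

/-! ### Riemann sums and cut-off functions -/

/-- A bound for the diagonal of a symmetric function `e` whose increments in the first variable
are integrals of `B`. Formally `d/dt e(t, t) = 2 B(t, t)`; as `B` is only measurable in `τ` and
continuous in `σ`, this is obtained from Riemann sums over uniform partitions. -/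
theorem diag_sub_le {e B : ℝ → ℝ → ℝ} {T K δ : ℝ} (hT : 0 < T) (hsymm : ∀ s t, e s t = e t s)
    (hint : ∀ σ ∈ Icc 0 T, IntervalIntegrable (fun τ => B τ σ) volume 0 T)
    (he : ∀ s ∈ Icc 0 T, ∀ t ∈ Icc 0 T, s ≤ t → ∀ σ ∈ Icc 0 T,
      e t σ - e s σ = ∫ τ in s..t, B τ σ)
    (hK : ∀ τ ∈ Icc 0 T, ∀ σ ∈ Icc 0 T, |B τ σ| ≤ K)
    (hcont : ∀ τ ∈ Icc 0 T, ContinuousWithinAt (fun σ => B τ σ) (Icc 0 T) τ)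
    (hd : ∀ τ ∈ Icc 0 T, B τ τ ≤ δ) : e T T - e 0 0 ≤ 2 * δ * T := by
  -- `lo n τ` and `hi n τ` are the end points of the interval of length `T / n` which contains `τ`
  set lo : ℕ → ℝ → ℝ := fun n τ => ⌊τ * n / T⌋₊ * T / n with hlo
  set hi : ℕ → ℝ → ℝ := fun n τ => min T ((⌊τ * n / T⌋₊ + 1) * T / n) with hhi
  set b : ℕ → ℝ → ℝ := fun n τ => B τ (hi n τ) + B τ (lo n τ) with hb
  have hlo_mem : ∀ n : ℕ, 0 < n → ∀ τ ∈ Icc 0 T, lo n τ ∈ Icc 0 T ∧ lo n τ ≤ τ ∧ τ - T / n ≤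
      lo n τ := by
    intro n hn τ hτ
    have hn' : (0 : ℝ) < n := by exact_mod_cast hn
    have h1 := Nat.floor_le (a := τ * n / T) (by have := hτ.1; positivity)
    have h2 := (Nat.lt_floor_add_one (τ * n / T)).le
    have h3 : lo n τ ≤ τ := by
      rw [hlo]; simp only
      rw [div_le_iff₀ hn', ← le_div_iff₀ hT]; exact h1
    refine ⟨⟨by positivity, h3.trans hτ.2⟩, h3, ?_⟩
    rw [hlo]; simp only
    rw [sub_le_iff_le_add, ← add_div, le_div_iff₀ hn']
    rw [div_le_iff₀ hT] at h2
    linarith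
  have hhi_mem : ∀ n : ℕ, 0 < n → ∀ τ ∈ Icc 0 T, hi n τ ∈ Icc 0 T ∧ τ ≤ hi n τ ∧ hi n τ ≤ τ +
      T / n := by
    intro n hn τ hτ
    have hn' : (0 : ℝ) < n := by exact_mod_cast hn
    have h1 := Nat.floor_le (a := τ * n / T) (by have := hτ.1; positivity)
    have h2 := (Nat.lt_floor_add_one (τ * n / T)).le
    have h3 : τ ≤ (⌊τ * n / T⌋₊ + 1) * T / n := by
      rw [le_div_iff₀ hn', ← div_le_iff₀ hT]; exact h2
    have h4 : (⌊τ * n / T⌋₊ + 1) * T / n ≤ τ + T / n := by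
      rw [div_le_iff₀ hn', add_mul, add_mul, div_mul_cancel₀ _ hn'.ne', one_mul]
      rw [le_div_iff₀ hT] at h1
      linarith
    exact ⟨⟨le_min hT.le (hτ.1.trans h3), min_le_left _ _⟩, le_min hτ.2 h3,
        (min_le_right _ _).trans h4⟩
  -- by symmetry `e(t', t') - e(t, t) = (e(t', t') - e(t, t')) + (e(t', t) - e(t, t))`, which is
  -- summed over the partition
  have hpart : ∀ n : ℕ, 0 < n → IntervalIntegrable (b n) volume 0 T ∧ ∫ τ in (0 : ℝ)..T, b n τ =
      e T T - e 0 0 := by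
    intro n hn
    have hn' : (0 : ℝ) < n := by exact_mod_cast hn
    set t : ℕ → ℝ := fun k => k * T / n with ht
    have ht0 : t 0 = 0 := by simp [ht]
    have htn : t n = T := by simp only [ht]; field_simp
    have htm : ∀ k l : ℕ, k ≤ l → t k ≤ t l := fun k l hkl => by
      simp only [ht]
      have : (k : ℝ) ≤ l := by exact_mod_cast hkl
      gcongr
    have htI : ∀ k, k ≤ n → t k ∈ Icc 0 T := fun k hk =>
      ⟨ht0 ▸ htm 0 k (Nat.zero_le k), htn ▸ htm k n hk⟩
    have hsub : ∀ k, k < n → uIcc (t k) (t (k + 1)) ⊆ uIcc 0 T := fun k hk => by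
      rw [uIcc_of_le (htm k (k + 1) (Nat.le_succ k)), uIcc_of_le hT.le]
      exact Icc_subset_Icc (htI k hk.le).1 (htI (k + 1) hk).2
    have hcongr : ∀ k, k < n → ∀ᵐ τ, τ ∈ uIoc (t k) (t (k + 1)) →
        B τ (t (k + 1)) + B τ (t k) = b n τ := by
      intro k hk
      filter_upwards [Measure.ae_ne volume (t (k + 1))] with τ hne hτ
      rw [uIoc_of_le (htm k (k + 1) (Nat.le_succ k))] at hτ
      have h1 : τ < t (k + 1) := lt_of_le_of_ne hτ.2 hne
      have hτ0 : 0 ≤ τ := (htI k hk.le).1.trans hτ.1.le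
      have hfl : ⌊τ * n / T⌋₊ = k := by
        rw [Nat.floor_eq_iff (by positivity), le_div_iff₀ hT, div_lt_iff₀ hT]
        have h2 := hτ.1.le
        simp only [ht] at h1 h2
        rw [lt_div_iff₀ hn'] at h1
        rw [div_le_iff₀ hn'] at h2
        push_cast at h1
        exact ⟨h2, h1⟩
      have h3 : hi n τ = t (k + 1) := by
        have h4 := (htI (k + 1) hk).2
        simp only [hhi, hfl]
        simp only [ht] at h4 ⊢
        push_cast at h4 ⊢
        exact min_eq_right h4
      have h5 : lo n τ = t k := by simp only [hlo, hfl, ht]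
      simp only [hb, h3, h5]
    have hII : ∀ k, k ≤ n → ∀ l, l < n →
        IntervalIntegrable (fun τ => B τ (t k)) volume (t l) (t (l + 1)) :=
      fun k hk l hl => (hint (t k) (htI k hk)).mono_set (hsub l hl)
    have hbI : ∀ k < n, IntervalIntegrable (b n) volume (t k) (t (k + 1)) := fun k hk =>
      ((hII (k + 1) hk k hk).add (hII k hk.le k hk)).congr_ae
        ((ae_restrict_iff' measurableSet_uIoc).2 (hcongr k hk))
    refine ⟨?_, ?_⟩
    · have := IntervalIntegrable.trans_iterate hbI
      rwa [ht0, htn] at this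
    · have hsum := intervalIntegral.sum_integral_adjacent_intervals hbI
      rw [ht0, htn] at hsum
      rw [← hsum]
      have hstep : ∀ k ∈ Finset.range n, ∫ τ in (t k)..(t (k + 1)), b n τ =
          e (t (k + 1)) (t (k + 1)) - e (t k) (t k) := by
        intro k hk
        have hk' := Finset.mem_range.1 hk
        rw [← intervalIntegral.integral_congr_ae (hcongr k hk'),
          intervalIntegral.integral_add (hII (k + 1) hk' k hk') (hII k hk'.le k hk'),
          ← he _ (htI k hk'.le) _ (htI (k + 1) hk') (htm _ _ (Nat.le_succ k)) _ (htI (k + 1) hk'),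
          ← he _ (htI k hk'.le) _ (htI (k + 1) hk') (htm _ _ (Nat.le_succ k)) _ (htI k hk'.le),
          hsymm (t k) (t (k + 1))]
        ring
      rw [Finset.sum_congr rfl hstep, Finset.sum_range_sub (fun k => e (t k) (t k)), ht0, htn]
  -- both end points converge to `τ`, where `B τ` is continuous
  have hTn : Tendsto (fun n : ℕ => T / n) atTop (𝓝 0) := tendsto_const_div_atTop_nhds_zero_nat T
  have hlim : ∀ τ ∈ Icc 0 T, Tendsto (fun n => b n τ) atTop (𝓝 (B τ τ + B τ τ)) := by
    intro τ hτ
    have hpos := eventually_gt_atTop (α := ℕ) 0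
    have l1 : Tendsto (fun n => lo n τ) atTop (𝓝 τ) := by
      refine tendsto_of_tendsto_of_tendsto_of_le_of_le' (g := fun n : ℕ => τ - T / n) (h :=
          fun _ => τ)
        (by simpa using hTn.const_sub τ) tendsto_const_nhds ?_ ?_
      · filter_upwards [hpos] with n hn using (hlo_mem n hn τ hτ).2.2
      · filter_upwards [hpos] with n hn using (hlo_mem n hn τ hτ).2.1
    have l2 : Tendsto (fun n => hi n τ) atTop (𝓝 τ) := by
      refine tendsto_of_tendsto_of_tendsto_of_le_of_le' (g := fun _ => τ) (h := fun n : ℕ => τ +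
          T / n)
        tendsto_const_nhds (by simpa using hTn.const_add τ) ?_ ?_
      · filter_upwards [hpos] with n hn using (hhi_mem n hn τ hτ).2.1
      · filter_upwards [hpos] with n hn using (hhi_mem n hn τ hτ).2.2
    refine Tendsto.add ((hcont τ hτ).tendsto.comp (tendsto_nhdsWithin_iff.2 ⟨l2, ?_⟩))
      ((hcont τ hτ).tendsto.comp (tendsto_nhdsWithin_iff.2 ⟨l1, ?_⟩))
    · filter_upwards [hpos] with n hn using (hhi_mem n hn τ hτ).1
    · filter_upwards [hpos] with n hn using (hlo_mem n hn τ hτ).1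
  have hbK : ∀ n : ℕ, 0 < n → ∀ τ ∈ Icc 0 T, ‖b n τ‖ ≤ 2 * K := by
    intro n hn τ hτ
    have h1 := hK τ hτ _ (hhi_mem n hn τ hτ).1
    have h2 := hK τ hτ _ (hlo_mem n hn τ hτ).1
    rw [Real.norm_eq_abs]
    refine (abs_add_le _ _).trans ?_
    linarith
  have hIoc : ∀ τ ∈ uIoc 0 T, τ ∈ Icc 0 T := fun τ hτ => by
    rw [uIoc_of_le hT.le] at hτ; exact Ioc_subset_Icc_self hτ
  have hconv := intervalIntegral.tendsto_integral_filter_of_dominated_convergence (μ := volume)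
    (a := 0) (b := T) (l := atTop) (F := fun n : ℕ => b (n + 1)) (f := fun τ => B τ τ + B τ τ)
    (fun _ => 2 * K) (Eventually.of_forall fun n => (intervalIntegrable_iff.1 (hpart (n +
        1) n.succ_pos).1).aestronglyMeasurable)
    (Eventually.of_forall fun n => by
      filter_upwards with τ hτ using hbK (n + 1) n.succ_pos τ (hIoc τ hτ)) (by simp)
    (by filter_upwards with τ hτ using (tendsto_add_atTop_iff_nat 1).2 (hlim τ (hIoc τ hτ)))
  simp_rw [fun n : ℕ => (hpart (n + 1) n.succ_pos).2] at hconv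
  have hE := tendsto_nhds_unique tendsto_const_nhds hconv
  rw [hE]
  have hm : AEStronglyMeasurable (fun τ => B τ τ + B τ τ) (volume.restrict (uIoc 0 T)) :=
    aestronglyMeasurable_of_tendsto_ae atTop (f := fun n : ℕ => b (n + 1))
      (fun n => (intervalIntegrable_iff.1 (hpart (n + 1) n.succ_pos).1).aestronglyMeasurable)
      (by filter_upwards [ae_restrict_mem measurableSet_uIoc] with τ hτ using
        (tendsto_add_atTop_iff_nat 1).2 (hlim τ (hIoc τ hτ)))
  have hI : IntervalIntegrable (fun τ => B τ τ + B τ τ) volume 0 T := by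
    rw [intervalIntegrable_iff]
    refine Integrable.mono' (g := fun _ => 2 * K) (by
      rw [uIoc_of_le hT.le]; exact integrable_const _) hm ?_
    filter_upwards [ae_restrict_mem measurableSet_uIoc] with τ hτ
    have h1 := hK τ (hIoc τ hτ) τ (hIoc τ hτ)
    rw [Real.norm_eq_abs]
    refine (abs_add_le _ _).trans ?_
    linarith
  have hfin : ∫ τ in (0 : ℝ)..T, (B τ τ + B τ τ) ≤ ∫ _ in (0 : ℝ)..T, 2 * δ :=
    intervalIntegral.integral_mono_on hT.le hI (by simp) fun τ hτ => by linarith [hd τ hτ]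
  refine hfin.trans (le_of_eq ?_)
  simp
  ring

/-- Smooth cut-off functions which are equal to one on the ball of radius `R` and whose derivatives
of order one (squared) and two are `O(R⁻²)`. -/
theorem exists_cutoff (d : ℕ) : ∃ K : ℝ, 0 ≤ K ∧ ∀ R : ℝ, 0 < R → ∃ η : Space d → ℝ,
    ContDiff ℝ ∞ η ∧ HasCompactSupport η ∧ (∀ x, 0 ≤ η x) ∧ (∀ x, η x ≤ 1) ∧
    (∀ x, ‖x‖ ≤ R → η x = 1) ∧ (∀ x, gradInner η η x ≤ K / R ^ 2) ∧
    ∀ x, |Laplacian.laplacian η x| ≤ K / R ^ 2 := by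
  let ψ : ContDiffBump (0 : Space d) := ⟨1, 2, one_pos, one_lt_two⟩
  have hψ : ContDiff ℝ ∞ ψ := ψ.contDiff
  have hψ2 : ContDiff ℝ 2 ψ := ψ.contDiff
  have hc : HasCompactSupport ψ := ψ.hasCompactSupport
  have cg : Continuous (gradInner ψ ψ) :=
    (contDiff_gradInner (m := 0) hψ2 hψ2 (by norm_num)).continuous
  have sg : HasCompactSupport (gradInner ψ ψ) := by
    refine HasCompactSupport.of_support_subset_isCompact hc (fun x hx => ?_)
    by_contra h
    refine hx (Finset.sum_eq_zero fun i _ => ?_)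
    have : pd i ψ x = 0 := by
      by_contra h2
      exact h (tsupport_fderiv_subset ℝ (subset_tsupport _ (fun h3 => h2 (by rw [pd, h3]; simp))))
    rw [this, zero_mul]
  obtain ⟨K₁, h1⟩ := sg.exists_bound_of_continuous cg
  obtain ⟨K₂, h2⟩ := (hasCompactSupport_laplacian hc).exists_bound_of_continuous
    (continuous_laplacian hψ2)
  refine ⟨max K₁ K₂, le_max_of_le_left ((norm_nonneg _).trans (h1 0)), fun R hR => ?_⟩
  have hpd (f : Space d → ℝ) (i) : pd i (fun x => f (R⁻¹ • x)) =
      fun x => R⁻¹ * pd i f (R⁻¹ • x) := by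
    ext x
    rw [pd, fderiv_comp_smul]
    simp [pd]
  have hpd2 (f : Space d → ℝ) (i) : pd i (fun x => R⁻¹ * f (R⁻¹ • x)) =
      fun x => R⁻¹ * (R⁻¹ * pd i f (R⁻¹ • x)) := by
    ext x
    have this : pd i (fun x => f (R⁻¹ • x)) x = R⁻¹ * pd i f (R⁻¹ • x) := congrFun (hpd f i) x
    rw [← this, pd, pd]
    have h := fderiv_const_smul_field (𝕜 := ℝ) (f := fun x => f (R⁻¹ • x)) R⁻¹
    have h' : (fun x => R⁻¹ * f (R⁻¹ • x)) = R⁻¹ • fun x => f (R⁻¹ • x) := rfl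
    rw [h', h]
    simp
  have hη : ContDiff ℝ ∞ fun x : Space d => ψ (R⁻¹ • x) := hψ.comp (contDiff_const_smul _)
  have hη2 : ContDiff ℝ 2 fun x : Space d => ψ (R⁻¹ • x) := hψ2.comp (contDiff_const_smul _)
  refine ⟨fun x => ψ (R⁻¹ • x), hη, hc.comp_smul (inv_ne_zero hR.ne'), fun x => ψ.nonneg,
    fun x => ψ.le_one, fun x hx => ?_, fun x => ?_, fun x => ?_⟩
  · refine ψ.one_of_mem_closedBall ?_
    rw [mem_closedBall_zero_iff, norm_smul, norm_inv, Real.norm_of_nonneg hR.le, inv_mul_eq_div]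
    exact div_le_one_of_le₀ hx hR.le
  · have e : gradInner (fun x : Space d => ψ (R⁻¹ • x)) (fun x => ψ (R⁻¹ • x)) x =
        gradInner ψ ψ (R⁻¹ • x) / R ^ 2 := by
      simp only [gradInner, hpd, Finset.sum_div]
      refine Finset.sum_congr rfl fun i _ => ?_
      field_simp
    rw [e]
    gcongr
    exact (le_abs_self _).trans ((h1 _).trans (le_max_left _ _))
  · have e : Laplacian.laplacian (fun x : Space d => ψ (R⁻¹ • x)) x =
        Laplacian.laplacian (ψ : Space d → ℝ) (R⁻¹ • x) / R ^ 2 := by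
      rw [laplacian_eq_sum_pd hη2, laplacian_eq_sum_pd hψ2, Finset.sum_div]
      refine Finset.sum_congr rfl fun i _ => ?_
      rw [hpd, hpd2]
      field_simp
    rw [e, abs_div, abs_of_nonneg (sq_nonneg R)]
    gcongr
    exact (h2 _).trans (le_max_right _ _)

/-! ### The equation for the difference of two solutions -/

variable {a : L2 d} {h h' : ℝ → L2 d}

theorem IsSolution.exists_moment_le (hs : IsSolution a h) (T : ℝ) :
    ∃ M : ℝ, 0 ≤ M ∧ ∀ t ∈ Icc 0 T, moment 2 (h t) ≤ ENNReal.ofReal M := by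
  obtain ⟨M, hM, hb⟩ := hs.bounded T
  refine ⟨M.toReal, ENNReal.toReal_nonneg, fun t ht => ?_⟩
  rw [ENNReal.ofReal_toReal hM]
  exact (moment_two_le_sNorm _).trans (hb t ht)

theorem IsSolution.moment_ne_top (hs : IsSolution a h) {t : ℝ} (ht : 0 ≤ t) :
    moment 2 (h t) ≠ ⊤ := by
  obtain ⟨M, -, hb⟩ := hs.exists_moment_le t
  exact ((hb t ⟨ht, le_rfl⟩).trans_lt ENNReal.ofReal_lt_top).ne

theorem IsSolution.exists_common_moment_le (hs : IsSolution a h) (hs' : IsSolution a h') (T : ℝ) :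
    ∃ M : ℝ, 0 ≤ M ∧ (∀ t ∈ Icc 0 T, moment 2 (h t) ≤ ENNReal.ofReal M) ∧
      ∀ t ∈ Icc 0 T, moment 2 (h' t) ≤ ENNReal.ofReal M := by
  obtain ⟨M₁, hM₁, hb1⟩ := hs.exists_moment_le T
  obtain ⟨M₂, hM₂, hb2⟩ := hs'.exists_moment_le T
  exact ⟨max M₁ M₂, le_max_of_le_left hM₁,
    fun s hs0 => (hb1 s hs0).trans (ENNReal.ofReal_le_ofReal (le_max_left _ _)),
    fun s hs0 => (hb2 s hs0).trans (ENNReal.ofReal_le_ofReal (le_max_right _ _))⟩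

/-- The weak equation with the Laplacian written as an inverse Fourier integral. -/
theorem IsSolution.equation_weakLap (hs : IsSolution a h) {φ : Space d → ℝ} (hφ : IsTest φ) {t : ℝ}
    (ht : 0 ≤ t) :
    IntervalIntegrable (fun s => ∫ x, Real.exp (-weakLap (h s) x) * Laplacian.laplacian φ x)
      volume 0 t ∧
    (∫ x, h t x * φ x) - ∫ x, a x * φ x =
      ∫ s in (0 : ℝ)..t, ∫ x, Real.exp (-weakLap (h s) x) * Laplacian.laplacian φ x := by
  obtain ⟨w, hw, he⟩ := hs.equation
  obtain ⟨h1, h2⟩ := he φ hφ t ht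
  have hc : ∀ s, 0 ≤ s → ∫ x, Real.exp (-(w s x)) * Laplacian.laplacian φ x =
      ∫ x, Real.exp (-weakLap (h s) x) * Laplacian.laplacian φ x := by
    intro s hs'
    apply integral_congr_ae
    filter_upwards [(hw s hs').ae_eq (hs.moment_ne_top hs')] with x hx
    rw [hx]
  refine ⟨h1.congr fun s hs' => hc s ?_, h2.trans (intervalIntegral.integral_congr fun s hs' =>
      hc s ?_)⟩
  · rw [uIoc_of_le ht] at hs'; exact hs'.1.le
  · rw [uIcc_of_le ht] at hs'; exact hs'.1

/-- The difference of the nonlinearities of two curves. -/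
def expDiff (h h' : ℝ → L2 d) (s : ℝ) (x : Space d) : ℝ :=
  Real.exp (-weakLap (h s) x) - Real.exp (-weakLap (h' s) x)

theorem continuous_expDiff {s : ℝ} (h1 : moment 2 (h s) ≠ ⊤) (h2 : moment 2 (h' s) ≠ ⊤) :
    Continuous (expDiff h h' s) :=
  (Real.continuous_exp.comp (continuous_weakLap h1).neg).sub
    (Real.continuous_exp.comp (continuous_weakLap h2).neg)

theorem abs_weakLap_le_of_moment_le {u : L2 d} {M : ℝ} (hM : 0 ≤ M)
    (hu : moment 2 u ≤ ENNReal.ofReal M) (x : Space d) : |weakLap u x| ≤ M :=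
  (abs_weakLap_le u x).trans (ENNReal.toReal_le_of_le_ofReal hM hu)

theorem abs_expDiff_le {s M : ℝ} (hM : 0 ≤ M) (h1 : moment 2 (h s) ≤ ENNReal.ofReal M)
    (h2 : moment 2 (h' s) ≤ ENNReal.ofReal M) (x : Space d) :
    |expDiff h h' s x| ≤ Real.exp M * |weakLap (h s) x - weakLap (h' s) x| := by
  have b1 := (abs_le.1 (abs_weakLap_le_of_moment_le hM h1 x)).1
  have b2 := (abs_le.1 (abs_weakLap_le_of_moment_le hM h2 x)).1
  have := abs_exp_sub_exp_le (a := -weakLap (h s) x) (b := -weakLap (h' s) x) (C := M)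
    (by linarith) (by linarith)
  rwa [neg_sub_neg, abs_sub_comm (weakLap (h' s) x)] at this

/-- The exponential is strongly decreasing on bounded sets. -/
theorem exp_neg_sub_mul_le {p q M : ℝ} (hp : p ≤ M) (hq : q ≤ M) :
    (Real.exp (-p) - Real.exp (-q)) * (p - q) ≤ -Real.exp (-M) * (p - q) ^ 2 := by
  wlog hpq : q ≤ p generalizing p q
  · have := this hq hp (le_of_not_ge hpq)
    nlinarith
  have h1 : Real.exp (-p) * (p - q + 1) ≤ Real.exp (-q) := by
    have h2 : Real.exp (-q) = Real.exp (-p) * Real.exp (p - q) := by rw [← Real.exp_add]; ring_nf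
    rw [h2]
    exact mul_le_mul_of_nonneg_left (Real.add_one_le_exp _) (Real.exp_pos _).le
  have h3 : Real.exp (-M) ≤ Real.exp (-p) := Real.exp_le_exp.2 (by linarith)
  have h4 : 0 ≤ p - q := by linarith
  have h5 : Real.exp (-M) * (p - q) ≤ Real.exp (-p) * (p - q) := mul_le_mul_of_nonneg_right h3 h4
  have h6 : Real.exp (-p) - Real.exp (-q) ≤ -(Real.exp (-M) * (p - q)) := by linarith
  have := mul_le_mul_of_nonneg_right h6 h4
  linarith

section Uniqueness

variable {T : ℝ} {ρ : Space d → ℝ}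

theorem integral_sub_test_eq (hs : IsSolution a h) (hs' : IsSolution a h') {φ : Space d → ℝ}
    (hφ : IsTest φ) {t : ℝ} (ht : 0 ≤ t) :
    IntervalIntegrable (fun s => ∫ x, expDiff h h' s x * Laplacian.laplacian φ x) volume 0 t ∧
    ∫ x, (h t - h' t) x * φ x =
      ∫ s in (0 : ℝ)..t, ∫ x, expDiff h h' s x * Laplacian.laplacian φ x := by
  obtain ⟨i1, e1⟩ := hs.equation_weakLap hφ ht
  obtain ⟨i2, e2⟩ := hs'.equation_weakLap hφ ht
  have hI (u : L2 d) (hu : moment 2 u ≠ ⊤) :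
      Integrable fun x => Real.exp (-weakLap u x) * Laplacian.laplacian φ x :=
    ((Real.continuous_exp.comp (continuous_weakLap hu).neg).mul
      hφ.laplacian.1.continuous).integrable_of_hasCompactSupport hφ.laplacian.2.mul_left
  have hsub : ∀ s, 0 ≤ s → (∫ x, Real.exp (-weakLap (h s) x) * Laplacian.laplacian φ x) -
      ∫ x, Real.exp (-weakLap (h' s) x) * Laplacian.laplacian φ x =
      ∫ x, expDiff h h' s x * Laplacian.laplacian φ x := by
    intro s hs0
    rw [← integral_sub (hI _ (hs.moment_ne_top hs0)) (hI _ (hs'.moment_ne_top hs0))]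
    congr 1; ext x
    rw [expDiff, sub_mul]
  refine ⟨(i1.sub i2).congr fun s hs0 => hsub s ?_, ?_⟩
  · rw [uIoc_of_le ht] at hs0; exact hs0.1.le
  · rw [← hφ.inner_toL2, inner_sub_left, hφ.inner_toL2, hφ.inner_toL2]
    have : (∫ x, h t x * φ x) - ∫ x, h' t x * φ x =
        (∫ s in (0 : ℝ)..t, ∫ x, Real.exp (-weakLap (h s) x) * Laplacian.laplacian φ x) -
        ∫ s in (0 : ℝ)..t, ∫ x, Real.exp (-weakLap (h' s) x) * Laplacian.laplacian φ x := by
      rw [← e1, ← e2]; ring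
    rw [this, ← intervalIntegral.integral_sub i1 i2]
    refine intervalIntegral.integral_congr fun s hs0 => hsub s ?_
    rw [uIcc_of_le ht] at hs0; exact hs0.1

theorem exists_abs_lapPair_expDiff_le (hs : IsSolution a h) (hs' : IsSolution a h')
    (hρ : ContDiff ℝ 2 ρ) (hc : HasCompactSupport ρ) (T : ℝ) :
    ∃ V : ℝ, 0 ≤ V ∧ ∀ s ∈ Icc 0 T, ∀ v : L2 d, moment 2 v ≠ ⊤ →
      |lapPair (expDiff h h' s) ρ v| ≤ V * momentNorm v := by
  obtain ⟨M, hM0, hb1, hb2⟩ := hs.exists_common_moment_le hs' T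
  obtain ⟨K, hK, hpair⟩ := exists_abs_lapPair_le hρ hc
  have hF : ∀ s ∈ Icc 0 T, ∀ x, |expDiff h h' s x| ≤ Real.exp M * (2 * M) := fun s hs0 x => by
    refine (abs_expDiff_le hM0 (hb1 s hs0) (hb2 s hs0) x).trans ?_
    have b1 := abs_weakLap_le_of_moment_le hM0 (hb1 s hs0) x
    have b2 := abs_weakLap_le_of_moment_le hM0 (hb2 s hs0) x
    have := abs_sub (weakLap (h s) x) (weakLap (h' s) x)
    gcongr
    linarith
  have hcomp : IsCompact (tsupport ρ) := hc
  refine ⟨K * (Real.exp M * (2 * M) * volume.real (tsupport ρ)), by positivity,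
    fun s hs0 v hv => ?_⟩
  have hi : IntegrableOn (expDiff h h' s) (tsupport ρ) :=
    (continuous_expDiff (hs.moment_ne_top hs0.1)
      (hs'.moment_ne_top hs0.1)).continuousOn.integrableOn_compact hcomp
  refine (hpair _ hi v hv).trans ?_
  have h1 : ∫ x in tsupport ρ, |expDiff h h' s x| ≤
      Real.exp M * (2 * M) * volume.real (tsupport ρ) := by
    have := integral_mono (μ := volume.restrict (tsupport ρ)) hi.abs
      (integrableOn_const (C := Real.exp M * (2 * M)) hcomp.measure_lt_top.ne) (hF s hs0)
    refine this.trans (le_of_eq ?_)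
    rw [setIntegral_const, smul_eq_mul, mul_comm]
  have := mul_le_mul_of_nonneg_left h1 (mul_nonneg hK (momentNorm_nonneg v))
  linarith

/-- The weak equation for the difference of two solutions may be tested with `ρ u`, where `ρ` is a
smooth weight and `u` has finite moments: the low-pass parts of `u` are smooth. -/
theorem integral_sub_mul_eq (hs : IsSolution a h) (hs' : IsSolution a h') (hρ : ContDiff ℝ ∞ ρ)
    (hc : HasCompactSupport ρ) {u : L2 d} (hu : moment 2 u ≠ ⊤) {t : ℝ} (ht : 0 ≤ t) :
    IntervalIntegrable (fun s => lapPair (expDiff h h' s) ρ u) volume 0 t ∧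
    ∫ x, (h t - h' t) x * (ρ x * contRep u x) =
      ∫ s in (0 : ℝ)..t, lapPair (expDiff h h' s) ρ u := by
  have hρ2 : ContDiff ℝ 2 ρ := by exact_mod_cast contDiff_infty.1 hρ 2
  have hρt : IsTest ρ := ⟨hρ, hc⟩
  obtain ⟨V, hV0, hbound⟩ := exists_abs_lapPair_expDiff_le hs hs' hρ2 hc t
  have hFc : ∀ s ∈ Icc 0 t, Continuous (expDiff h h' s) := fun s hs0 =>
    continuous_expDiff (hs.moment_ne_top hs0.1) (hs'.moment_ne_top hs0.1)
  -- band-limited functions are smooth, so that these products are test functions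
  have htest : ∀ n : ℕ, IsTest fun x => ρ x * contRep (lowPass (n : ℝ) u) x := fun n =>
    ⟨hρ.mul (contDiff_contRep_lowPass n u), hc.mul_right⟩
  have hmn : ∀ n : ℕ, moment 2 (lowPass (n : ℝ) u) ≠ ⊤ := fun n => moment_lowPass_ne_top 2 n u
  have heq := fun n : ℕ => integral_sub_test_eq hs hs' (htest n) ht
  change ∀ n : ℕ, IntervalIntegrable (fun s =>
      lapPair (expDiff h h' s) ρ (lowPass (n : ℝ) u)) volume 0 t ∧
    ∫ x, (h t - h' t) x * (ρ x * contRep (lowPass (n : ℝ) u) x) =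
      ∫ s in (0 : ℝ)..t, lapPair (expDiff h h' s) ρ (lowPass (n : ℝ) u) at heq
  have hconv := tendsto_momentNorm_lowPass_sub hu
  have hpt : ∀ s ∈ Icc 0 t, Tendsto (fun n : ℕ =>
      lapPair (expDiff h h' s) ρ (lowPass (n : ℝ) u)) atTop
      (𝓝 (lapPair (expDiff h h' s) ρ u)) := by
    intro s hs0
    rw [tendsto_iff_norm_sub_tendsto_zero]
    refine squeeze_zero (fun n => norm_nonneg _) (fun n => ?_) (by simpa using hconv.const_mul V)
    rw [← lapPair_sub hρ2 hc (hFc s hs0) (hmn n) hu]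
    exact hbound s hs0 _ (moment_sub_ne_top (hmn n) hu)
  have hN : ∀ n : ℕ, momentNorm (lowPass (n : ℝ) u) ≤ momentNorm u := fun n =>
    ENNReal.toReal_mono (ENNReal.add_ne_top.2 ⟨moment_zero_ne_top hu, hu⟩)
      (add_le_add (moment_lowPass_le 0 n u) (moment_lowPass_le 2 n u))
  have hIoc : ∀ s ∈ uIoc 0 t, s ∈ Icc 0 t := fun s hs0 => by
    rw [uIoc_of_le ht] at hs0; exact Ioc_subset_Icc_self hs0
  have hm : AEStronglyMeasurable (fun s => lapPair (expDiff h h' s) ρ u)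
      (volume.restrict (uIoc 0 t)) :=
    aestronglyMeasurable_of_tendsto_ae atTop
      (f := fun (n : ℕ) s => lapPair (expDiff h h' s) ρ (lowPass (n : ℝ) u))
      (fun n => (intervalIntegrable_iff.1 (heq n).1).aestronglyMeasurable)
      (by filter_upwards [ae_restrict_mem measurableSet_uIoc] with s hs0 using hpt s (hIoc s hs0))
  refine ⟨?_, ?_⟩
  · rw [intervalIntegrable_iff]
    refine Integrable.mono' (g := fun _ => V * momentNorm u) (by
      rw [uIoc_of_le ht]; exact integrable_const _) hm ?_
    filter_upwards [ae_restrict_mem measurableSet_uIoc] with s hs0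
    exact hbound s (hIoc s hs0) u hu
  · have t1 := intervalIntegral.tendsto_integral_filter_of_dominated_convergence (μ := volume)
      (a := 0) (b := t) (l := atTop)
      (F := fun (n : ℕ) s => lapPair (expDiff h h' s) ρ (lowPass (n : ℝ) u))
      (f := fun s => lapPair (expDiff h h' s) ρ u) (fun _ => V * momentNorm u)
      (Eventually.of_forall fun n => (intervalIntegrable_iff.1 (heq n).1).aestronglyMeasurable)
      (Eventually.of_forall fun n => by
        filter_upwards with s hs0
        exact (hbound s (hIoc s hs0) _ (hmn n)).trans (mul_le_mul_of_nonneg_left (hN n) hV0))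
      (by simp) (by filter_upwards with s hs0 using hpt s (hIoc s hs0))
    have hgρ : Integrable fun x => (h t - h' t) x * ρ x := by
      have := (Lp.memLp (h t - h' t)).integrable_mul hρt.memLp
      exact this
    have hm0 : moment 0 u ≠ ⊤ := moment_zero_ne_top hu
    have t2 : Tendsto (fun n : ℕ => ∫ x, (h t - h' t) x * (ρ x *
        contRep (lowPass (n : ℝ) u) x)) atTop
        (𝓝 (∫ x, (h t - h' t) x * (ρ x * contRep u x))) := by
      refine tendsto_integral_of_dominated_convergence
        (fun x => |(h t - h' t) x * ρ x| * (moment 0 u).toReal) (fun n => ?_)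
        (hgρ.abs.mul_const _) (fun n => ?_) ?_
      · exact (Lp.aestronglyMeasurable _).mul
          (hρ.continuous.mul (contDiff_contRep (hmn n)).continuous).aestronglyMeasurable
      · filter_upwards with x
        rw [← mul_assoc, norm_mul, Real.norm_eq_abs, Real.norm_eq_abs]
        refine mul_le_mul_of_nonneg_left ((abs_contRep_le _ x).trans ?_) (abs_nonneg _)
        exact ENNReal.toReal_mono hm0 (moment_lowPass_le 0 n u)
      · filter_upwards with x
        refine Tendsto.const_mul _ (Tendsto.const_mul _ ?_)
        rw [tendsto_iff_norm_sub_tendsto_zero]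
        refine squeeze_zero (fun n => norm_nonneg _) (fun n => ?_)
          ((ENNReal.tendsto_toReal ENNReal.zero_ne_top).comp (tendsto_moment_lowPass_sub 0 hm0))
        rw [← contRep_sub (hmn n) hu]
        exact abs_contRep_le _ x
    simp_rw [fun n => (heq n).2] at t2
    exact tendsto_nhds_unique t2 t1

end Uniqueness

/-! ### Uniqueness -/

theorem integrable_sq_contRep {u : L2 d} (hu : moment 2 u ≠ ⊤) :
    Integrable fun x => contRep u x ^ 2 := by
  refine (Lp.memLp u).integrable_sq.congr ?_
  filter_upwards [coeFn_ae_eq_contRep hu] with x hx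
  rw [hx]

theorem integral_sq_contRep {u : L2 d} (hu : moment 2 u ≠ ⊤) :
    ∫ x, contRep u x ^ 2 = ‖u‖ ^ 2 := by
  rw [← real_inner_self_eq_norm_sq, L2.inner_def]
  apply integral_congr_ae
  filter_upwards [coeFn_ae_eq_contRep hu] with x hx
  rw [← hx, real_inner_self_eq_norm_sq, Real.norm_eq_abs, sq_abs]

/-- The dissipation estimate for the difference of two solutions. -/
theorem lapPair_expDiff_self_le {s M ε : ℝ} {η : Space d → ℝ} (hM : 0 ≤ M)
    (h1 : moment 2 (h s) ≤ ENNReal.ofReal M) (h2 : moment 2 (h' s) ≤ ENNReal.ofReal M)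
    (hε : 0 ≤ ε) (hη : ContDiff ℝ 2 η)
    (hηc : HasCompactSupport η) (h0 : ∀ x, 0 ≤ η x) (hη1 : ∀ x, η x ≤ 1)
    (hn : ∀ x, gradInner η η x ≤ ε) (hD : ∀ x, |Laplacian.laplacian η x| ≤ ε) :
    lapPair (expDiff h h' s) (fun z => η z ^ 4) (h s - h' s) ≤
      (128 * Real.exp M ^ 2 / Real.exp (-M) + ((64 * Real.exp M ^ 2 / Real.exp (-M)) ^ 2 /
        (2 * Real.exp (-M)) + 256 * Real.exp M ^ 2 / Real.exp (-M))) * ε ^ 2 *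
        ‖h s - h' s‖ ^ 2 := by
  have f1 : moment 2 (h s) ≠ ⊤ := (h1.trans_lt ENNReal.ofReal_lt_top).ne
  have f2 : moment 2 (h' s) ≠ ⊤ := (h2.trans_lt ENNReal.ofReal_lt_top).ne
  have f3 : moment 2 (h s - h' s) ≠ ⊤ := moment_sub_ne_top f1 f2
  have hL (x) : Laplacian.laplacian (contRep (h s - h' s)) x =
      weakLap (h s) x - weakLap (h' s) x := by
    rw [laplacian_contRep f3, weakLap_sub f1 f2]
  rw [← integral_sq_contRep f3]
  refine integral_mul_laplacian_weight_le (Real.exp_pos _) hε (contDiff_contRep f3)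
    (integrable_sq_contRep f3) hη hηc h0 hη1 hn hD (continuous_expDiff f1 f2) (fun x =>
        ?_) fun x => ?_
  · rw [hL]
    exact exp_neg_sub_mul_le (abs_le.1 (abs_weakLap_le_of_moment_le hM h1 x)).2
      (abs_le.1 (abs_weakLap_le_of_moment_le hM h2 x)).2
  · rw [hL, ← mul_pow]
    refine sq_le_sq.2 ((abs_expDiff_le hM h1 h2 x).trans ?_)
    rw [abs_mul, abs_of_pos (Real.exp_pos M)]

/-- Solutions are unique. The weighted `L²` norm of the difference grows at most at the rate
`O(R⁻⁴)`, where `R` is the radius of the weight; let `R → ∞`. -/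
theorem IsSolution.eq (hs' : IsSolution a h') (hs : IsSolution a h) {T : ℝ} (hT : 0 ≤ T) :
    h' T = h T := by
  rcases hT.eq_or_lt with rfl | hT
  · rw [hs.initial, hs'.initial]
  obtain ⟨M, hM, hb1, hb2⟩ := hs.exists_common_moment_le hs' T
  set g : ℝ → L2 d := fun s => h s - h' s with hg
  have hgc : ContinuousOn g (Icc 0 T) :=
    (hs.continuousOn.sub hs'.continuousOn).mono fun s hs0 => hs0.1
  obtain ⟨G, hG⟩ := isCompact_Icc.exists_bound_of_continuousOn hgc
  have hgm : ∀ s ∈ Icc 0 T, moment 2 (g s) ≠ ⊤ := fun s hs0 =>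
    moment_sub_ne_top (hs.moment_ne_top hs0.1) (hs'.moment_ne_top hs0.1)
  obtain ⟨C, hC, hmom⟩ := exists_momentNorm_le d
  set P := C * G + 2 * (2 * M) with hP
  have hgP : ∀ s ∈ Icc 0 T, momentNorm (g s) ≤ P := by
    intro s hs0
    refine (hmom _ (hgm s hs0)).trans ?_
    have h1 := (moment_sub_le 2 (h s) (h' s)).trans (add_le_add (hb1 s hs0) (hb2 s hs0))
    rw [← ENNReal.ofReal_add hM hM] at h1
    have h2 := ENNReal.toReal_le_of_le_ofReal (by linarith) h1
    have h3 := mul_le_mul_of_nonneg_left (hG s hs0) hC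
    linarith
  set Q := 128 * Real.exp M ^ 2 / Real.exp (-M) + ((64 * Real.exp M ^ 2 / Real.exp (-M)) ^ 2 /
        (2 * Real.exp (-M)) + 256 * Real.exp M ^ 2 / Real.exp (-M)) with hQ
  have hQ0 : 0 ≤ Q := by positivity
  obtain ⟨K, hK, hcut⟩ := exists_cutoff d
  -- a weight of radius `R` has derivatives of size `ε = K / R²`, and the dissipation estimate is
  -- quadratic in `ε`
  have hR : ∀ R : ℝ, 0 < R → ∃ η : Space d → ℝ, Continuous η ∧ (∀ x, 0 ≤ η x) ∧ (∀ x, η x ≤ 1) ∧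
      (∀ x, ‖x‖ ≤ R → η x = 1) ∧
      ∫ x, g T x * (η x ^ 4 * g T x) ≤ 2 * (Q * (K / R ^ 2) ^ 2 * G ^ 2) * T := by
    intro R hR0
    obtain ⟨η, e1, e2, e3, e4, e5, e6, e7⟩ := hcut R hR0
    refine ⟨η, e1.continuous, e3, e4, e5, ?_⟩
    set ρ : Space d → ℝ := fun z => η z ^ 4 with hρ
    have hρs : ContDiff ℝ ∞ ρ := e1.pow 4
    have hρ2 : ContDiff ℝ 2 ρ := by exact_mod_cast contDiff_infty.1 hρs 2
    have hη2 : ContDiff ℝ 2 η := by exact_mod_cast contDiff_infty.1 e1 2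
    have hρc : HasCompactSupport ρ := e2.comp_left (g := fun t => t ^ 4) (by norm_num)
    obtain ⟨V, hV, hbound⟩ := exists_abs_lapPair_expDiff_le hs hs' hρ2 hρc T
    have heq : ∀ t ∈ Icc 0 T, ∀ σ ∈ Icc 0 T,
        IntervalIntegrable (fun τ => lapPair (expDiff h h' τ) ρ (g σ)) volume 0 t ∧
        ∫ x, g t x * (ρ x * g σ x) = ∫ τ in (0 : ℝ)..t, lapPair (expDiff h h' τ) ρ (g σ) := by
      intro t ht σ hσ
      obtain ⟨i1, i2⟩ := integral_sub_mul_eq hs hs' hρs hρc (hgm σ hσ) ht.1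
      refine ⟨i1, i2 ▸ ?_⟩
      apply integral_congr_ae
      filter_upwards [coeFn_ae_eq_contRep (hgm σ hσ)] with x hx
      rw [hx]
    have hdiag := diag_sub_le (e := fun t σ => ∫ x, g t x * (ρ x * g σ x))
      (B := fun τ σ => lapPair (expDiff h h' τ) ρ (g σ)) (T := T) (K := V * P)
      (δ := Q * (K / R ^ 2) ^ 2 * G ^ 2) hT
      (fun s t => by congr 1; ext x; ring)
      (fun σ hσ => (heq T ⟨hT.le, le_rfl⟩ σ hσ).1)
      (fun s hs0 t ht0 _ σ hσ => by
        rw [(heq t ht0 σ hσ).2, (heq s hs0 σ hσ).2,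
          intervalIntegral.integral_interval_sub_left (heq t ht0 σ hσ).1 (heq s hs0 σ hσ).1])
      (fun τ hτ σ hσ => (hbound τ hτ _ (hgm σ hσ)).trans
        (mul_le_mul_of_nonneg_left (hgP σ hσ) hV))
      (fun τ hτ => tendsto_lapPair hρs hρc
        (continuous_expDiff (hs.moment_ne_top hτ.1) (hs'.moment_ne_top hτ.1)) (hgm τ hτ) (hgP τ hτ)
        (by filter_upwards [self_mem_nhdsWithin] with σ hσ using hgm σ hσ)
        (by filter_upwards [self_mem_nhdsWithin] with σ hσ using hgP σ hσ) (hgc τ hτ))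
      (fun τ hτ => (lapPair_expDiff_self_le hM (hb1 τ hτ) (hb2 τ hτ) (by positivity) hη2 e2 e3 e4
        e6 e7).trans (mul_le_mul_of_nonneg_left
          (pow_le_pow_left₀ (norm_nonneg _) (hG τ hτ) 2) (by positivity)))
    have hzero : ∫ x, g 0 x * (ρ x * g 0 x) = 0 := by
      have := (heq 0 ⟨le_rfl, hT.le⟩ 0 ⟨le_rfl, hT.le⟩).2
      rwa [intervalIntegral.integral_same] at this
    simp only [hzero, sub_zero] at hdiag
    exact hdiag
  -- the weighted norms converge to the norm of `g T`, and their bounds to zero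
  choose η e1 e2 e3 e4 e5 using fun n : ℕ => hR (n + 1) (by positivity)
  have hsq : Integrable fun x => g T x * g T x := by
    have := (Lp.memLp (g T)).integrable_mul (Lp.memLp (g T))
    exact this
  have t1 : Tendsto (fun n : ℕ => ∫ x, g T x * (η n x ^ 4 * g T x)) atTop
      (𝓝 (∫ x, g T x * g T x)) := by
    refine tendsto_integral_of_dominated_convergence (fun x => |g T x * g T x|) (fun n => ?_)
      hsq.abs (fun n => ?_) ?_
    · exact (Lp.aestronglyMeasurable _).mul
        (((e1 n).pow 4).aestronglyMeasurable.mul (Lp.aestronglyMeasurable _))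
    · filter_upwards with x
      have h1 : |η n x ^ 4| ≤ 1 := by
        rw [abs_of_nonneg (pow_nonneg (e2 n x) 4)]
        exact pow_le_one₀ (e2 n x) (e3 n x)
      calc ‖g T x * (η n x ^ 4 * g T x)‖ = |η n x ^ 4| * |g T x * g T x| := by
            rw [Real.norm_eq_abs, ← abs_mul]; ring_nf
        _ ≤ 1 * |g T x * g T x| := mul_le_mul_of_nonneg_right h1 (abs_nonneg _)
        _ = _ := one_mul _
    · filter_upwards with x
      refine tendsto_const_nhds.congr' ?_
      filter_upwards [eventually_ge_atTop ⌈‖x‖⌉₊] with n hn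
      have : ‖x‖ ≤ (n : ℝ) + 1 := (Nat.ceil_le.1 hn).trans (by linarith)
      rw [e4 n x this]
      ring
  have t2 : Tendsto (fun n : ℕ => 2 * (Q * (K / ((n : ℝ) + 1) ^ 2) ^ 2 * G ^ 2) * T) atTop
      (𝓝 0) := by
    have h1 : Tendsto (fun n : ℕ => ((n : ℝ) + 1)) atTop atTop :=
      tendsto_atTop_add_const_right _ _ tendsto_natCast_atTop_atTop
    have h2 : Tendsto (fun n : ℕ => K / ((n : ℝ) + 1) ^ 2) atTop (𝓝 0) :=
      tendsto_const_nhds.div_atTop ((tendsto_pow_atTop two_ne_zero).comp h1)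
    simpa using ((((h2.pow 2).const_mul Q).mul_const (G ^ 2)).const_mul 2).mul_const T
  have hle : ∫ x, g T x * g T x ≤ 0 := le_of_tendsto_of_tendsto' t1 t2 e5
  have hnorm : ‖g T‖ ^ 2 ≤ 0 := by
    rw [← real_inner_self_eq_norm_sq, L2.inner_def]
    exact hle
  have h0 : g T = 0 := by
    rw [← norm_eq_zero]
    exact pow_eq_zero_iff two_ne_zero |>.1 (le_antisymm hnorm (sq_nonneg _))
  exact (sub_eq_zero.1 h0).symm

end ExpPDE

end

theorem theorem1p1 :
    (∀ y : ℝ, HasSum (fun j : ℕ => ((j : ℝ) + 2) ^ 3 / (Nat.factorial (j + 1) : ℝ) * y ^ (j + 1))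
      (ExpPDE.f2 y)) ∧
    ∃ yStar : ℝ,
      0 < yStar ∧ (∀ y : ℝ, 0 < y → (ExpPDE.f2 y = 1 ↔ y = yStar)) ∧
      52 / 500 < yStar ∧ yStar < 105 / 1000 ∧
      ∀ d : ℕ, 1 ≤ d → ∀ h₀ : ExpPDE.L2 d,
        ExpPDE.sNorm 2 h₀ < ENNReal.ofReal yStar →
          0 < ExpPDE.sigma21 h₀ ∧
          ∃ h : ℝ → ExpPDE.L2 d,
            ExpPDE.IsSolution h₀ h ∧
            (∀ h' : ℝ → ExpPDE.L2 d, ExpPDE.IsSolution h₀ h' → ∀ t, 0 ≤ t → h' t = h t) ∧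
            (∀ t, 0 ≤ t →
              ExpPDE.sNorm 2 (h t) +
                  ENNReal.ofReal (ExpPDE.sigma21 h₀) *
                    ∫⁻ τ in Ioc (0 : ℝ) t, ExpPDE.sNorm 6 (h τ) ≤
                ExpPDE.sNorm 2 h₀) := by
  refine ⟨ExpPDE.hasSum_f2, ?_⟩
  obtain ⟨y, hy1, hy2, hy⟩ := ExpPDE.exists_f2_eq_one
  have hy0 : 0 < y := by linarith
  refine ⟨y, hy0, fun z hz => ⟨fun h => ?_, fun h => h ▸ hy⟩, hy1, hy2, fun d _ h₀ hh₀ => ?_⟩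
  · exact ExpPDE.f2_strictMonoOn.injOn (mem_Ici.2 hz.le) (mem_Ici.2 hy0.le) (h.trans hy.symm)
  obtain ⟨h, hs, hb⟩ := ExpPDE.exists_isSolution (by linarith) hy hh₀
  exact ⟨ExpPDE.sigma21_pos hy hh₀, h, hs,
    fun h' hs' t ht => ExpPDE.IsSolution.eq hs' hs ht, hb⟩
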